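/- Conventions. A (bounded positive) trace on a unital $C^*$-algebra $A$ is a positive linear functional $t$ on $A$ with $t(xy)=t(yx)$ for all $x,y\in A$; $T(A)$ is the convex set of tracial states, i.e. traces with $t(1)=1$. A quasitrace on $A$ means a (finite) 2-quasitrace in the sense of Blackadar and Handelman: a map $\tau:A_+\to[0,\infty)$ with $\tau(x^*x)=\tau(xx^*)$ for all $x\in A$, $\tau(\lambda a)=\lambda\tau(a)$ for $\lambda\ge 0$, and $\tau(a+b)=\tau(a)+\tau(b)$ for commuting $a,b\in A_+$, which extends (along $a\mapsto a\otimes e_{11}$) to a map $M_2(A)_+\to[0,\infty)$ with the same properties; $QT(A)$ is the set of quasitraces with $\tau(1)=1$. $K_0(A)$ is the Grothendieck group of the semigroup of Murray–von Neumann classes of projections in matrix algebras over $A$; $S(K_0(A))$ is the convex set of homomorphisms $s:K_0(A)\to\mathbb{R}$ with $s([p])\ge 0$ for all projections $p\in M_n(A)$, $n\ge 1$, and $s([1_A])=1$; and $r_A:T(A)\to S(K_0(A))$ is the affine map $r_A(t)([p])=(t\otimes\mathrm{Tr})(p)$ for projections $p\in M_n(A)$. For $d\ge 0$ let $\mathcal{I}_d$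 be the class of $C^*$-algebras of the form $P M_r(C(X))P$, where $r\ge 1$, $X$ is a nonempty compact subset of a finite CW complex $Y$ of dimension at most $d$, and $P=Q|_X$ for a projection $Q\in M_r(C(Y))$. For $a,b\in A_+$ write $a\lesssim b$ if there are $x_n\in A$ with $\|x_n^*bx_n-a\|\to 0$. A unital simple $C^*$-algebra $A$ is in $\mathcal{C}_1$ if for every finite set $\mathcal{F}\subset A$, all $\varepsilon>0$, $\eta>0$ and every $a\in A_+\setminus\{0\}$ there are a projection $p\in A$, an integer $d\ge 0$ and a $C^*$-subalgebra $C\subset A$ with $1_C=p$ and $C\cong PM_r(C(X))P\in\mathcal{I}_d$ such that $\|px-xp\|<\varepsilon$ and $\mathrm{dist}(pxp,C)<\varepsilon$ for all $x\in\mathcal{F}$, $\mathrm{rank}\,P(\xi)>0$ and $\frac{d+1}{\mathrm{rank}\,P(\xi)}<\frac{\eta}{2}$ for all $\xi\in X$, and $1-p\lesssim a$. Theorem. Let $A$ be a unital simple $C^*$-algebra in $\mathcal{C}_1$. (1) Every quasitrace on $A$ extends to a trace on $A$. Consequently $QT(A)=T(A)$: restriction to $A_+$ is a bijection from $T(A)$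 onto $QT(A)$. (2) If $A$ is moreover separable, then $r_A(\partial_e T(A))=\partial_e S(K_0(A))$, where $\partial_e$ denotes the set of extreme points. -/

import Mathlib

open scoped ComplexOrder Matrix

noncomputable section

namespace TracialAH

/-! ### Positive elements, simplicity, Cuntz subequivalence -/

/-- The positive cone `B₊ = {x* x : x ∈ B}` of a `*`-algebra (used for C*-algebras `A` and for the
matrix algebras `M_n(A)`). -/
def posCone (B : Type*) [Mul B] [Star B] : Set B := {a | ∃ x : B, star x * x = a}

/-- In a C*-algebra `posCone` is the positive cone of Mathlib's order. -/
theorem mem_posCone_iff {A : Type*} [CStarAlgebra A] [PartialOrder A] [StarOrderedRing A] (a : A) :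
    a ∈ posCone A ↔ 0 ≤ a := by
  rw [CStarAlgebra.nonneg_iff_eq_star_mul_self]
  exact ⟨fun ⟨x, hx⟩ => ⟨x, hx.symm⟩, fun ⟨x, hx⟩ => ⟨x, hx.symm⟩⟩

/-- A C*-algebra is simple if it is nonzero and has no closed two-sided ideals besides `0` and
the whole algebra. -/
def IsSimpleCStar (A : Type*) [CStarAlgebra A] : Prop :=
  Nontrivial A ∧ ∀ I : TwoSidedIdeal A, IsClosed (I : Set A) → I = ⊥ ∨ I = ⊤

/-- Cuntz subequivalence `a ≲ b`: there are `x n` with `x n * b x n → a`. -/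
def CuntzLE {A : Type*} [CStarAlgebra A] (a b : A) : Prop :=
  ∃ x : ℕ → A, Filter.Tendsto (fun n => ‖star (x n) * b * x n - a‖) Filter.atTop (nhds 0)

/-! ### The classes `𝓘_d` and `𝓒_g` -/

/-- The corner `P M P` of a `*`-algebra `M` at a projection `P`. -/
def corner {M : Type*} [Ring M] [StarRing M] [Algebra ℂ M] [StarModule ℂ M] (P : M)
    (hP : IsStarProjection P) : NonUnitalStarSubalgebra ℂ M where
  carrier := {x | P * x * P = x}
  add_mem' {a b} ha hb := by
    simp only [Set.mem_ofPred_eq] at ha hb ⊢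
    rw [mul_add, add_mul, ha, hb]
  zero_mem' := by simp
  mul_mem' {a b} ha hb := by
    simp only [Set.mem_ofPred_eq] at ha hb ⊢
    have h1 : P * a = a := by
      rw [← ha, ← mul_assoc, ← mul_assoc, hP.isIdempotentElem.eq]
    have h2 : b * P = b := by
      rw [← hb, mul_assoc, hP.isIdempotentElem.eq]
    rw [← mul_assoc, h1, mul_assoc, h2]
  smul_mem' c x hx := by
    simp only [Set.mem_ofPred_eq] at hx ⊢
    rw [mul_smul_comm, smul_mul_assoc, hx]
  star_mem' {a} ha := by
    simp only [Set.mem_ofPred_eq] at ha ⊢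
    have h : star (P * a * P) = star a := by rw [ha]
    rw [star_mul, star_mul, hP.isSelfAdjoint.star_eq, ← mul_assoc] at h
    exact h

/-- The data of an algebra `P M_r(C(X)) P` in the class `𝓘_d`: `X` is a nonempty compact subset of a
finite CW complex `Y` of dimension at most `d`, and `P` is the restriction to `X` of a projection
`Q ∈ M_r(C(Y))`. -/
structure HomogeneousData (d : ℕ) where
  Y : Type
  [top : TopologicalSpace Y]
  [t2 : T2Space Y]
  [cw : Topology.CWComplex (Set.univ : Set Y)]
  [finite : Topology.CWComplex.Finite (Set.univ : Set Y)]
  dim_le : ∀ n, d < n → IsEmpty (Topology.RelCWComplex.cell (Set.univ : Set Y) n)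
  X : Set Y
  compact_X : IsCompact X
  nonempty_X : X.Nonempty
  r : ℕ
  one_le_r : 1 ≤ r
  Q : Matrix (Fin r) (Fin r) C(Y, ℂ)
  isStarProjection_Q : IsStarProjection Q

namespace HomogeneousData

attribute [instance] HomogeneousData.top HomogeneousData.t2

variable {d : ℕ} (D : HomogeneousData d)

/-- The projection `P = Q|_X ∈ M_r(C(X))`. -/
def P : Matrix (Fin D.r) (Fin D.r) C(D.X, ℂ) := D.Q.map (fun f => f.restrict D.X)

theorem isStarProjection_P : IsStarProjection D.P where
  isIdempotentElem := by
    have h := D.isStarProjection_Q.isIdempotentElem.eq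
    unfold IsIdempotentElem
    ext i j x
    have h' := congrArg (fun f : C(D.Y, ℂ) => f x) (congrFun (congrFun h i) j)
    simpa [P, Matrix.mul_apply] using h'
  isSelfAdjoint := by
    have h := D.isStarProjection_Q.isSelfAdjoint.star_eq
    unfold IsSelfAdjoint
    ext i j x
    have h' := congrArg (fun f : C(D.Y, ℂ) => f x) (congrFun (congrFun h i) j)
    simpa [P, Matrix.star_apply] using h'

/-- The `*`-algebra `P M_r(C(X)) P`. -/
def algebra : NonUnitalStarSubalgebra ℂ (Matrix (Fin D.r) (Fin D.r) C(D.X, ℂ)) :=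
  corner D.P D.isStarProjection_P

/-- The rank of the projection `P(x)`. -/
def rankAt (x : D.X) : ℕ := (D.P.map (fun f => f x)).rank

end HomogeneousData

/-- The class `𝓒_g` (for unital C*-algebras; simplicity is assumed separately).
A `*`-isomorphism between C*-algebras is automatically isometric, so that the C*-subalgebra `C` being
of the form `P M_r(C(X)) P` is expressed by a `*`-isomorphism. -/
def InClassC (g : ℕ → ℕ) (A : Type*) [CStarAlgebra A] : Prop :=
  ∀ (F : Finset A) (ε η : ℝ), 0 < ε → 0 < η → ∀ a ∈ posCone A, a ≠ 0 →
    ∃ (p : A) (C : NonUnitalStarSubalgebra ℂ A) (d : ℕ) (D : HomogeneousData d),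
      IsStarProjection p ∧
      IsClosed (C : Set A) ∧
      Nonempty (C ≃⋆ₐ[ℂ] D.algebra) ∧
      (p ∈ C ∧ ∀ c ∈ C, p * c = c ∧ c * p = c) ∧
      (∀ x ∈ F, ‖p * x - x * p‖ < ε) ∧
      (∀ x ∈ F, Metric.infDist (p * x * p) (C : Set A) < ε) ∧
      (∀ x : D.X, 0 < D.rankAt x ∧ ((d : ℝ) + 1) / (D.rankAt x : ℝ) < η / ((g d : ℝ) + 1)) ∧
      CuntzLE (1 - p) a

/-- The class `𝓒₁`: the class `𝓒_g` for the constant function `g = 1`. -/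
def InClassC1 (A : Type*) [CStarAlgebra A] : Prop := InClassC (fun _ => 1) A

/-! ### Traces and quasitraces -/

/-- A (finite, positive) trace: a positive linear functional with `t(xy) = t(yx)`. -/
structure IsPositiveTrace {A : Type*} [CStarAlgebra A] (t : A →ₗ[ℂ] ℂ) : Prop where
  nonneg : ∀ x, 0 ≤ t (star x * x)
  tracial : ∀ x y, t (x * y) = t (y * x)

/-- `T(A)`: the tracial states of `A`. -/
def tracialStates (A : Type*) [CStarAlgebra A] : Set (A →ₗ[ℂ] ℂ) :=
  {t | IsPositiveTrace t ∧ t 1 = 1}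

/-- A `1`-quasitrace `τ : B₊ → [0, ∞)`: `τ(x* x) = τ(x x*)`, and `τ` is positively homogeneous and
additive on commuting positive elements. -/
structure IsOneQuasitrace {B : Type*} [Ring B] [StarRing B] [Module ℂ B] (τ : posCone B → ℝ) :
    Prop where
  nonneg : ∀ a, 0 ≤ τ a
  star_mul : ∀ x : B, τ ⟨star x * x, x, rfl⟩ = τ ⟨x * star x, star x, by rw [star_star]⟩
  smul : ∀ (c : ℝ) (a b : posCone B), 0 ≤ c → (b : B) = (c : ℂ) • (a : B) → τ b = c * τ a
  add : ∀ a b c : posCone B, Commute (a : B) (b : B) → (c : B) = (a : B) + (b : B) →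
    τ c = τ a + τ b

/-- A quasitrace (in the sense of Blackadar and Handelman, i.e. a `2`-quasitrace) on `A`: a
`1`-quasitrace that extends to a `1`-quasitrace on `M₂(A)`, where `a` is identified with `a ⊗ e₁₁`. -/
def IsQuasitrace {A : Type*} [CStarAlgebra A] (τ : posCone A → ℝ) : Prop :=
  IsOneQuasitrace τ ∧
    ∃ τ₂ : posCone (Matrix (Fin 2) (Fin 2) A) → ℝ, IsOneQuasitrace τ₂ ∧
      ∀ (a : posCone A) (b : posCone (Matrix (Fin 2) (Fin 2) A)),
        (b : Matrix (Fin 2) (Fin 2) A) = Matrix.single 0 0 (a : A) → τ₂ b = τ a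

/-- `QT(A)`: the quasitraces on `A` that are normalized by `τ(1) = 1`. -/
def quasitraces (A : Type*) [CStarAlgebra A] : Set (posCone A → ℝ) :=
  {τ | IsQuasitrace τ ∧ τ ⟨1, 1, by simp⟩ = 1}

/-- The restriction of a linear functional to the positive cone (for positive functionals
the values are real). -/
def restrictPos {A : Type*} [CStarAlgebra A] (t : A →ₗ[ℂ] ℂ) : posCone A → ℝ :=
  fun a => (t a).re

/-! ### The group `K₀(A)` -/

/-- The projections in the matrix algebras `M_n(A)`, `n ∈ ℕ`. -/
structure MatProj (A : Type*) [CStarAlgebra A] where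
  size : ℕ
  mat : Matrix (Fin size) (Fin size) A
  isProj : IsStarProjection mat

section K0

variable {A : Type*} [CStarAlgebra A]

/-- Murray-von Neumann equivalence of `p ∈ M_m(A)` and `q ∈ M_n(A)`. -/
def MvN (p q : MatProj A) : Prop :=
  ∃ v : Matrix (Fin q.size) (Fin p.size) A, vᴴ * v = p.mat ∧ v * vᴴ = q.mat

theorem MatProj.mul_self (p : MatProj A) : p.mat * p.mat = p.mat :=
  p.isProj.isIdempotentElem.eq

theorem MatProj.conj (p : MatProj A) : (p.mat)ᴴ = p.mat := p.isProj.isSelfAdjoint.star_eq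

theorem MvN.refl (p : MatProj A) : MvN p p :=
  ⟨p.mat, by rw [p.conj, p.mul_self], by rw [p.conj, p.mul_self]⟩

theorem MvN.symm {p q : MatProj A} (h : MvN p q) : MvN q p := by
  obtain ⟨v, h1, h2⟩ := h
  exact ⟨vᴴ, by rw [Matrix.conjTranspose_conjTranspose, h2],
    by rw [Matrix.conjTranspose_conjTranspose, h1]⟩

theorem MvN.trans {p q s : MatProj A} (h : MvN p q) (h' : MvN q s) : MvN p s := by
  obtain ⟨v, h1, h2⟩ := h
  obtain ⟨w, h3, h4⟩ := h'
  refine ⟨w * v, ?_, ?_⟩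
  · rw [Matrix.conjTranspose_mul, Matrix.mul_assoc, ← Matrix.mul_assoc wᴴ, h3, ← h2,
      Matrix.mul_assoc, ← Matrix.mul_assoc vᴴ, h1, p.mul_self]
  · rw [Matrix.conjTranspose_mul, Matrix.mul_assoc, ← Matrix.mul_assoc v, h2, ← h3,
      Matrix.mul_assoc, ← Matrix.mul_assoc w, h4, s.mul_self]

instance mvnSetoid (A : Type*) [CStarAlgebra A] : Setoid (MatProj A) where
  r := MvN
  iseqv := ⟨MvN.refl, MvN.symm, MvN.trans⟩

/-- Transport of a projection along a bijection of index sets. -/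
def MatProj.reindex {ι : Type*} [Fintype ι] {n : ℕ} (e : ι ≃ Fin n) (p : Matrix ι ι A)
    (hp : IsStarProjection p) : MatProj A :=
  ⟨n, Matrix.reindex e e p,
    { isIdempotentElem := by
        have h := hp.isIdempotentElem.eq
        unfold IsIdempotentElem
        rw [Matrix.reindex_apply, Matrix.submatrix_mul_equiv, h]
      isSelfAdjoint := by
        have h : pᴴ = p := hp.isSelfAdjoint.star_eq
        change (Matrix.reindex e e p)ᴴ = _
        rw [Matrix.conjTranspose_reindex, h] }⟩

theorem isStarProjection_fromBlocks {m n : Type*} [Fintype m] [Fintype n]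
    {p : Matrix m m A} {q : Matrix n n A} (hp : IsStarProjection p) (hq : IsStarProjection q) :
    IsStarProjection (Matrix.fromBlocks p 0 0 q) where
  isIdempotentElem := by
    have h1 := hp.isIdempotentElem.eq
    have h2 := hq.isIdempotentElem.eq
    unfold IsIdempotentElem
    rw [Matrix.fromBlocks_multiply]
    simp [h1, h2]
  isSelfAdjoint := by
    have h1 : pᴴ = p := hp.isSelfAdjoint.star_eq
    have h2 : qᴴ = q := hq.isSelfAdjoint.star_eq
    change (Matrix.fromBlocks p 0 0 q)ᴴ = _
    rw [Matrix.fromBlocks_conjTranspose, h1, h2]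
    simp

/-- The direct sum `p ⊕ q = diag(p, q)`. -/
def MatProj.sum (p q : MatProj A) : MatProj A :=
  MatProj.reindex finSumFinEquiv (Matrix.fromBlocks p.mat 0 0 q.mat)
    (isStarProjection_fromBlocks p.isProj q.isProj)

theorem MvN.of_reindex {ι κ : Type*} [Fintype ι] [Fintype κ] {m n : ℕ} (e : ι ≃ Fin m)
    (f : κ ≃ Fin n) {p : Matrix ι ι A} {q : Matrix κ κ A} (hp : IsStarProjection p)
    (hq : IsStarProjection q) (v : Matrix κ ι A) (h1 : vᴴ * v = p) (h2 : v * vᴴ = q) :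
    MvN (MatProj.reindex e p hp) (MatProj.reindex f q hq) := by
  refine ⟨Matrix.reindex f e v, ?_, ?_⟩
  · change (Matrix.reindex f e v)ᴴ * Matrix.reindex f e v = Matrix.reindex e e p
    rw [Matrix.conjTranspose_reindex, Matrix.reindex_apply, Matrix.reindex_apply,
      Matrix.submatrix_mul_equiv, h1, Matrix.reindex_apply]
  · change Matrix.reindex f e v * (Matrix.reindex f e v)ᴴ = Matrix.reindex f f q
    rw [Matrix.conjTranspose_reindex, Matrix.reindex_apply, Matrix.reindex_apply,
      Matrix.submatrix_mul_equiv, h2, Matrix.reindex_apply]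

/-- Projections that differ by a bijection of the index sets are equivalent. -/
theorem MvN.of_equiv {ι κ : Type*} [Fintype ι] [Fintype κ] {m n : ℕ} (e : ι ≃ Fin m)
    (f : κ ≃ Fin n) {p : Matrix ι ι A} {q : Matrix κ κ A} (hp : IsStarProjection p)
    (hq : IsStarProjection q) (σ : ι ≃ κ) (h : ∀ i j, q (σ i) (σ j) = p i j) :
    MvN (MatProj.reindex e p hp) (MatProj.reindex f q hq) := by
  have hp1 : pᴴ = p := hp.isSelfAdjoint.star_eq
  have hp2 : p * p = p := hp.isIdempotentElem.eq
  refine MvN.of_reindex e f hp hq (p.submatrix σ.symm id) ?_ ?_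
  · rw [Matrix.conjTranspose_submatrix, Matrix.submatrix_mul_equiv, hp1, hp2,
      Matrix.submatrix_id_id]
  · have h' : (Equiv.refl ι : ι → ι) = id := rfl
    rw [Matrix.conjTranspose_submatrix, ← h', Matrix.submatrix_mul_equiv, hp1, hp2]
    ext i j
    rw [Matrix.submatrix_apply, ← h, Equiv.apply_symm_apply, Equiv.apply_symm_apply]

theorem MvN.sum_congr {p p' q q' : MatProj A} (h : MvN p p') (h' : MvN q q') :
    MvN (p.sum q) (p'.sum q') := by
  obtain ⟨v, h1, h2⟩ := h
  obtain ⟨w, h3, h4⟩ := h'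
  refine MvN.of_reindex _ _ _ _ (Matrix.fromBlocks v 0 0 w) ?_ ?_
  · rw [Matrix.fromBlocks_conjTranspose, Matrix.fromBlocks_multiply]
    simp [h1, h3]
  · rw [Matrix.fromBlocks_conjTranspose, Matrix.fromBlocks_multiply]
    simp [h2, h4]

theorem MvN.sum_comm (p q : MatProj A) : MvN (p.sum q) (q.sum p) := by
  refine MvN.of_equiv _ _ _ _ (Equiv.sumComm _ _) ?_
  rintro (i | i) (j | j) <;> rfl

theorem MvN.sum_assoc (p q s : MatProj A) : MvN ((p.sum q).sum s) (p.sum (q.sum s)) := by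
  obtain ⟨l, p, hp⟩ := p
  obtain ⟨m, q, hq⟩ := q
  obtain ⟨n, s, hs⟩ := s
  let σ : Fin (l + m) ⊕ Fin n ≃ Fin l ⊕ Fin (m + n) :=
    (finSumFinEquiv.symm.sumCongr (Equiv.refl _)).trans
      ((Equiv.sumAssoc _ _ _).trans ((Equiv.refl _).sumCongr finSumFinEquiv))
  have key : ∀ i j : Fin (l + m) ⊕ Fin n,
      Matrix.fromBlocks p 0 0 (Matrix.reindex finSumFinEquiv finSumFinEquiv
        (Matrix.fromBlocks q 0 0 s)) (σ i) (σ j) =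
      Matrix.fromBlocks (Matrix.reindex finSumFinEquiv finSumFinEquiv
        (Matrix.fromBlocks p 0 0 q)) 0 0 s i j := by
    have h1 : ∀ i : Fin l, σ (Sum.inl (finSumFinEquiv (Sum.inl i))) = Sum.inl i := by
      intro i
      simp [σ, -finSumFinEquiv_apply_left]
    have h2 : ∀ i : Fin m, σ (Sum.inl (finSumFinEquiv (Sum.inr i))) =
        Sum.inr (finSumFinEquiv (Sum.inl i)) := by
      intro i
      simp [σ, -finSumFinEquiv_apply_left, -finSumFinEquiv_apply_right]
    have h3 : ∀ i : Fin n, σ (Sum.inr i) = Sum.inr (finSumFinEquiv (Sum.inr i)) := by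
      intro i
      simp [σ, -finSumFinEquiv_apply_right]
    rintro (i | i) (j | j)
    · obtain ⟨i, rfl⟩ := finSumFinEquiv.surjective i
      obtain ⟨j, rfl⟩ := finSumFinEquiv.surjective j
      rcases i with i | i <;> rcases j with j | j <;>
        simp [-finSumFinEquiv_apply_left, -finSumFinEquiv_apply_right, h1, h2]
    · obtain ⟨i, rfl⟩ := finSumFinEquiv.surjective i
      rcases i with i | i <;>
        simp [-finSumFinEquiv_apply_left, -finSumFinEquiv_apply_right, h1, h2, h3]
    · obtain ⟨j, rfl⟩ := finSumFinEquiv.surjective j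
      rcases j with j | j <;>
        simp [-finSumFinEquiv_apply_left, -finSumFinEquiv_apply_right, h1, h2, h3]
    · simp [-finSumFinEquiv_apply_right, h3]
  exact MvN.of_equiv _ _ _ _ σ key

/-- The zero projection, in `M_0(A)`. -/
def MatProj.zero (A : Type*) [CStarAlgebra A] : MatProj A := ⟨0, 0, IsStarProjection.zero _⟩

theorem MvN.zero_sum (p : MatProj A) : MvN ((MatProj.zero A).sum p) p := by
  have h : MvN ((MatProj.zero A).sum p)
      (MatProj.reindex (Equiv.refl (Fin p.size)) p.mat p.isProj) := by
    refine MvN.of_equiv _ _ _ _ (Equiv.emptySum (Fin 0) (Fin p.size)) ?_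
    rintro (i | i) (j | j)
    · exact i.elim0
    · exact i.elim0
    · exact j.elim0
    · rfl
  exact h

end K0

/-- `V(A)`: equivalence classes of projections in matrix algebras over `A`. -/
def VMon (A : Type*) [CStarAlgebra A] : Type _ := Quotient (mvnSetoid A)

instance (A : Type*) [CStarAlgebra A] : Add (VMon A) where
  add := Quotient.map₂ MatProj.sum fun _ _ h _ _ h' => MvN.sum_congr h h'

instance (A : Type*) [CStarAlgebra A] : Zero (VMon A) where
  zero := Quotient.mk _ (MatProj.zero A)

instance (A : Type*) [CStarAlgebra A] : AddCommMonoid (VMon A) where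
  add_assoc := by
    rintro ⟨p⟩ ⟨q⟩ ⟨s⟩
    exact Quotient.sound (MvN.sum_assoc p q s)
  add_comm := by
    rintro ⟨p⟩ ⟨q⟩
    exact Quotient.sound (MvN.sum_comm p q)
  zero_add := by
    rintro ⟨p⟩
    exact Quotient.sound (MvN.zero_sum p)
  add_zero := by
    rintro ⟨p⟩
    exact Quotient.sound ((MvN.sum_comm p _).trans (MvN.zero_sum p))
  nsmul := nsmulRec

/-- `K₀(A)`: the Grothendieck group of `V(A)`. -/
abbrev K0 (A : Type*) [CStarAlgebra A] : Type _ := Algebra.GrothendieckAddGroup (VMon A)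

/-- The class `[p] ∈ K₀(A)` of a projection `p ∈ M_n(A)`. -/
def K0.cls {A : Type*} [CStarAlgebra A] {n : ℕ} (p : Matrix (Fin n) (Fin n) A)
    (hp : IsStarProjection p) : K0 A :=
  Algebra.GrothendieckAddGroup.of (Quotient.mk (mvnSetoid A) ⟨n, p, hp⟩)

/-- `S(K₀(A))`: the homomorphisms `s : K₀(A) → ℝ` that are positive, i.e. `s([p]) ≥ 0` for all
projections `p` in matrix algebras over `A`, and satisfy `s([1_A]) = 1`. (As `K₀(A)` is generated by
its positive cone, homomorphisms to `ℂ` that are positive have real values.) -/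
def stateSpace (A : Type*) [CStarAlgebra A] : Set (K0 A →+ ℝ) :=
  {s | (∀ (n : ℕ) (p : Matrix (Fin n) (Fin n) A) (hp : IsStarProjection p), 0 ≤ s (K0.cls p hp)) ∧
    s (K0.cls (1 : Matrix (Fin 1) (Fin 1) A) (IsStarProjection.one _)) = 1}

section rMap

variable {A : Type*} [CStarAlgebra A]

theorem trace_mvn {t : A →ₗ[ℂ] ℂ} (ht : IsPositiveTrace t) {p q : MatProj A} (h : MvN p q) :
    t (Matrix.trace p.mat) = t (Matrix.trace q.mat) := by
  obtain ⟨v, h1, h2⟩ := h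
  rw [← h1, ← h2]
  simp only [Matrix.trace, Matrix.diag_apply, Matrix.mul_apply, map_sum]
  rw [Finset.sum_comm]
  exact Finset.sum_congr rfl fun i _ => Finset.sum_congr rfl fun j _ => ht.tracial _ _

/-- The additive map `V(A) → ℝ`, `[p] ↦ (t ⊗ Tr)(p)`. -/
def traceV (t : A →ₗ[ℂ] ℂ) (ht : IsPositiveTrace t) : VMon A →+ ℝ where
  toFun := Quotient.lift (fun p : MatProj A => (t (Matrix.trace p.mat)).re)
    fun _ _ h => congrArg Complex.re (trace_mvn ht h)
  map_zero' := by
    change (t (Matrix.trace (0 : Matrix (Fin 0) (Fin 0) A))).re = 0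
    simp
  map_add' := by
    rintro ⟨p⟩ ⟨q⟩
    change (t (Matrix.trace (p.sum q).mat)).re =
      (t (Matrix.trace p.mat)).re + (t (Matrix.trace q.mat)).re
    rw [← Complex.add_re, ← map_add]
    congr 2
    change Matrix.trace (Matrix.reindex finSumFinEquiv finSumFinEquiv
      (Matrix.fromBlocks p.mat 0 0 q.mat)) = _
    simp only [Matrix.trace, Matrix.diag_apply, Matrix.reindex_apply, Matrix.submatrix_apply]
    rw [Equiv.sum_comp finSumFinEquiv.symm
      (fun i => Matrix.fromBlocks p.mat 0 0 q.mat i i), Fintype.sum_sum_type]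
    simp

/-- The homomorphism `K₀(A) → ℝ`, `[p] ↦ (t ⊗ Tr)(p)`. -/
def traceK0 (t : A →ₗ[ℂ] ℂ) (ht : IsPositiveTrace t) : K0 A →+ ℝ :=
  Algebra.GrothendieckAddGroup.lift (traceV t ht)

theorem traceK0_cls (t : A →ₗ[ℂ] ℂ) (ht : IsPositiveTrace t) {n : ℕ}
    (p : Matrix (Fin n) (Fin n) A) (hp : IsStarProjection p) :
    traceK0 t ht (K0.cls p hp) = (t (Matrix.trace p)).re := by
  have h := DFunLike.congr_fun
    (Algebra.GrothendieckAddGroup.lift.symm_apply_apply (traceV t ht))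
    (Quotient.mk (mvnSetoid A) ⟨n, p, hp⟩)
  exact h

theorem traceK0_mem (t : A →ₗ[ℂ] ℂ) (ht : t ∈ tracialStates A) :
    traceK0 t ht.1 ∈ stateSpace A := by
  refine ⟨fun n p hp => ?_, ?_⟩
  · rw [traceK0_cls]
    have h : p = pᴴ * p := by
      have h1 : pᴴ = p := hp.isSelfAdjoint.star_eq
      rw [h1, hp.isIdempotentElem.eq]
    rw [h]
    simp only [Matrix.trace, Matrix.diag_apply, Matrix.mul_apply, map_sum, Complex.re_sum]
    exact Finset.sum_nonneg fun i _ => Finset.sum_nonneg fun j _ =>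
      (Complex.le_def.1 (ht.1.nonneg (p j i))).1
  · rw [traceK0_cls]
    simp [ht.2]

/-- The map `r_A : T(A) → S(K₀(A))`, `r_A(t)([p]) = (t ⊗ Tr)(p)`. -/
def rMap (A : Type*) [CStarAlgebra A] (t : tracialStates A) : stateSpace A :=
  ⟨traceK0 t.1 t.2.1, traceK0_mem t.1 t.2⟩

end rMap

end TracialAH

end

/-! Both parts rest on one reduction. `InClassC1.exists_approximation` approximates finite sets by
elements of `C ⊕ (1-p)A(1-p)`, where `C ≅ P M_r(C(X)) P` has unit `p` and `A` contains `m` mutually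
orthogonal projections equivalent to `1-p`, with `m` prescribed. The largeness of the ranks yields
`m` orthogonal nonzero elements. Simplicity gives one nonzero `w` that factors through all of them,
and `1-p ≲ w* w` then puts a copy of `1-p` under each. So a normalized quasitrace, or a state of
`K₀(A)`, has value at most `1/m` at `1-p`, and questions about `A` become questions about `C`.

(1) It suffices that a quasitrace `τ` is additive on positive elements. Then `τ` extends linearly,
and polarization turns `τ(x* x) = τ(x x*)` into the trace identity. First, `τ` is monotone
(`IsOneQuasitrace.posExt_mono`). Indeed `n a` is a sum of commuting ramp functions of `a`, and for
`a ≤ b` a polar decomposition moves each ramp of `a` below the ramp of `b` two levels lower, so only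
`2 τ(1)` is lost before dividing by `n`. Norm continuity follows. On `C`, local orthonormal frames
and a partition of unity reduce `τ` to a single matrix algebra. There the spectral theorem makes it
a multiple of the trace, so `τ` is additive on `C` (`posExt_toAlg_add`). The reduction above
transports additivity to `A`.

(2) A state of `K₀(A)` sees only the rank function of a projection over `C` (`projVal_lift_eq_sum`).
Two projection fields of equal rank need not be equivalent, but `N` copies of one embed into `N + l`
copies of the other with `l` independent of `N`, and real values cannot detect `l`. Hence a state is
approximated on `C` by a weighted sum of point evaluations of the trace, and an ultrafilter limit
shows that `r_A` is onto (`exists_trace_of_mem_stateSpace`). If moreover `s ≤ M r_A(t)`, then `s` is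
approximated by `t(w ·)` with a density `0 ≤ w ≤ M` in the centre of `C`, so that `s` comes from a
trace below `M t` (`exists_dominated_trace`).

The statement on extreme points is then convexity. If `t` is extreme and `r_A(t) = a s + b s'`, then
`s` comes from a trace `t₁ ≤ t/a`, and `t` is a convex combination of `t₁` and another tracial
state, so `t₁ = t` and `s = r_A(t)`. Conversely, the fibre of `r_A` over an extreme `s` is a
nonempty compact face of `T(A)`, and any extreme point of it is extreme in `T(A)`. -/

noncomputable section

namespace TracialAH

/-! ### Polar decomposition inside a C*-algebra. -/

section Polar

variable {A : Type*} [CStarAlgebra A] [PartialOrder A] [StarOrderedRing A]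

/-- If `c c* ≤ K h`, then `‖ψ(h) c‖² ≤ K sup ψ(t)² t`. -/
theorem norm_cfc_mul_sq_le {c h : A} (hh : 0 ≤ h) {K : ℝ} (hK : 0 ≤ K)
    (hc : c * star c ≤ K • h) (ψ : ℝ → ℝ) (hψ : ContinuousOn ψ (spectrum ℝ h)) {B : ℝ} (hB : 0 ≤ B)
    (hψB : ∀ t ∈ spectrum ℝ h, ψ t ^ 2 * t ≤ B) :
    ‖cfc ψ h * c‖ ^ 2 ≤ K * B := by
  have hs : star (cfc ψ h) = cfc ψ h := (cfc_predicate ψ h : IsSelfAdjoint _).star_eq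
  have e1 : ‖cfc ψ h * c‖ ^ 2 = ‖cfc ψ h * (c * star c) * cfc ψ h‖ := by
    rw [sq, ← CStarRing.norm_self_mul_star, star_mul, hs]
    simp only [mul_assoc]
  have hsp : ∀ t ∈ spectrum ℝ h, 0 ≤ t := fun t ht => spectrum_nonneg_of_nonneg hh ht
  have e2 : cfc ψ h * (K • h) * cfc ψ h = K • cfc (fun t => ψ t ^ 2 * t) h := by
    rw [mul_smul_comm, smul_mul_assoc]
    congr 1
    conv_lhs => rw [show cfc ψ h * h * cfc ψ h = cfc ψ h * cfc (fun t => t) h * cfc ψ h by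
      rw [cfc_id' ℝ h]]
    rw [← cfc_mul ψ _ h, ← cfc_mul _ ψ h]
    congr 1
    ext t
    ring
  have e3 : cfc ψ h * (c * star c) * cfc ψ h ≤ K • cfc (fun t => ψ t ^ 2 * t) h := by
    rw [← e2]
    have := star_left_conjugate_le_conjugate hc (cfc ψ h)
    rwa [hs] at this
  have e4 : 0 ≤ cfc ψ h * (c * star c) * cfc ψ h := by
    have := star_left_conjugate_nonneg (mul_star_self_nonneg c) (cfc ψ h)
    rwa [hs] at this
  rw [e1]
  refine (CStarAlgebra.norm_le_norm_of_nonneg_of_le e4 e3).trans ?_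
  rw [norm_smul, Real.norm_of_nonneg hK]
  gcongr
  refine norm_cfc_le hB fun t ht => ?_
  rw [Real.norm_of_nonneg (mul_nonneg (sq_nonneg _) (hsp t ht))]
  exact hψB t ht

/-- A form of polar decomposition: if `c c* ≤ K T* T`, then `c* c = x* x` for some `x` in the closed
right ideal generated by `T`. -/
theorem exists_star_mul_self_eq_of_le {c T : A} {K : ℝ} (hK : 0 ≤ K)
    (hc : c * star c ≤ K • (star T * T)) :
    ∃ x : A, star x * x = star c * c ∧ ∀ y, y * T = 0 → y * x = 0 := by
  set h : A := star T * T with hdef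
  have hh : 0 ≤ h := star_mul_self_nonneg T
  have hsp : ∀ t ∈ spectrum ℝ h, 0 ≤ t := fun t ht => spectrum_nonneg_of_nonneg hh ht
  let δ : ℕ → ℝ := fun n => 1 / ((n : ℝ) + 1)
  have hδ : ∀ n, 0 < δ n := fun n => by positivity
  -- A regularized `t^(-1/2)`: the elements `T g_n(h)` stand in for the polar part of `T`, which
  -- need not lie in `A`. The products `T g_n(h) c` still converge, because `c c* ≤ K h` makes `c`
  -- small where `h` is small.
  let g : ℕ → ℝ → ℝ := fun n t => (Real.sqrt (t + δ n ^ 2))⁻¹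
  have hpos : ∀ n, ∀ t ∈ spectrum ℝ h, 0 < t + δ n ^ 2 := fun n t ht => by
    have := hsp t ht
    have := hδ n
    positivity
  have hg : ∀ n, ContinuousOn (g n) (spectrum ℝ h) := fun n =>
    ContinuousOn.inv₀ (by fun_prop) fun t ht => (Real.sqrt_pos.2 (hpos n t ht)).ne'
  have hsqrt : ∀ n, ∀ t ∈ spectrum ℝ h, |t * g n t - Real.sqrt t| ≤ δ n := by
    intro n t ht
    have h0 := hsp t ht
    have h1 := Real.sqrt_pos.2 (hpos n t ht)
    have h2 : Real.sqrt t ≤ Real.sqrt (t + δ n ^ 2) := Real.sqrt_le_sqrt (by nlinarith [hδ n])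
    have h3 : Real.sqrt (t + δ n ^ 2) ≤ Real.sqrt t + δ n := by
      refine Real.sqrt_le_iff.2 ⟨by have := hδ n; positivity, ?_⟩
      nlinarith [Real.sq_sqrt h0, Real.sqrt_nonneg t, hδ n]
    have h4 : t * g n t = Real.sqrt t * (Real.sqrt t / Real.sqrt (t + δ n ^ 2)) := by
      simp only [g]
      rw [div_eq_mul_inv, ← mul_assoc, Real.mul_self_sqrt h0]
    have h5 : Real.sqrt t / Real.sqrt (t + δ n ^ 2) ≤ 1 := (div_le_one h1).2 h2
    have h6 : (Real.sqrt t / Real.sqrt (t + δ n ^ 2)) * Real.sqrt (t + δ n ^ 2) = Real.sqrt t :=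
      div_mul_cancel₀ _ h1.ne'
    have h7 : 0 ≤ Real.sqrt t / Real.sqrt (t + δ n ^ 2) := by positivity
    rw [h4, abs_sub_comm, abs_of_nonneg (by nlinarith [Real.sqrt_nonneg t])]
    nlinarith [Real.sqrt_nonneg t, hδ n]
  have hstar : ∀ φ : ℝ → ℝ, star (cfc φ h) = cfc φ h := fun φ =>
    (cfc_predicate φ h : IsSelfAdjoint _).star_eq
  -- Since `T* T = h`, the factor `T` may be replaced by `√h` inside norms, which reduces everything
  -- to functions of `h`.
  have hT : ∀ φ : ℝ → ℝ, ContinuousOn φ (spectrum ℝ h) →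
      ‖T * (cfc φ h * c)‖ = ‖cfc (fun t => φ t * Real.sqrt t) h * c‖ := by
    intro φ hφ
    have hh' : h = cfc (fun t => Real.sqrt t) h * cfc (fun t => Real.sqrt t) h := by
      rw [← cfc_mul _ _ h]
      conv_lhs => rw [← cfc_id' ℝ h]
      exact cfc_congr fun t ht => (Real.mul_self_sqrt (hsp t ht)).symm
    rw [cfc_mul _ _ h, ← sq_eq_sq₀ (norm_nonneg _) (norm_nonneg _), sq, sq,
      ← CStarRing.norm_star_mul_self, ← CStarRing.norm_star_mul_self]
    congr 1
    simp only [star_mul, hstar]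
    have hcomm : cfc φ h * cfc (fun t => Real.sqrt t) h =
        cfc (fun t => Real.sqrt t) h * cfc φ h := cfc_commute_cfc _ _ _
    calc star c * cfc φ h * star T * (T * (cfc φ h * c))
        = star c * (cfc φ h * h * cfc φ h) * c := by simp only [hdef, mul_assoc]
      _ = star c * (cfc φ h * (cfc (fun t => Real.sqrt t) h * cfc (fun t => Real.sqrt t) h) *
          cfc φ h) * c := by rw [← hh']
      _ = _ := by
        rw [hcomm]
        simp only [mul_assoc]
        rw [← mul_assoc (cfc φ h), hcomm]
        simp only [mul_assoc]
  let u : ℕ → A := fun n => T * (cfc (g n) h * c)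
  have hcauchy : CauchySeq u := by
    refine cauchySeq_of_le_tendsto_0 (fun N => Real.sqrt (K * (2 * δ N) ^ 2)) ?_ ?_
    · intro n m N hn hm
      rw [dist_eq_norm]
      have e : u n - u m = T * (cfc (fun t => g n t - g m t) h * c) := by
        rw [cfc_sub _ _ h (hg n) (hg m)]
        simp only [u, sub_mul, mul_sub]
      rw [e, hT (fun t => g n t - g m t) ((hg n).sub (hg m))]
      refine Real.le_sqrt_of_sq_le (norm_cfc_mul_sq_le hh hK hc _ ?_ (by positivity) ?_)
      · exact ((hg n).sub (hg m)).mul Real.continuous_sqrt.continuousOn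
      · intro t ht
        have h1 := hsqrt n t ht
        have h2 := hsqrt m t ht
        have h3 : ∀ k, N ≤ k → δ k ≤ δ N := fun k hk => by
          simp only [δ]
          gcongr
        have e1 : ((g n t - g m t) * Real.sqrt t) ^ 2 * t = (t * g n t - t * g m t) ^ 2 := by
          rw [mul_pow, Real.sq_sqrt (hsp t ht)]
          ring
        rw [e1]
        refine sq_le_sq' ?_ ?_ <;>
          linarith [abs_le.1 h1, abs_le.1 h2, h3 n hn, h3 m hm, (abs_le.1 h1).1, (abs_le.1 h1).2,
            (abs_le.1 h2).1, (abs_le.1 h2).2]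
    · have : Filter.Tendsto δ Filter.atTop (nhds 0) := tendsto_one_div_add_atTop_nhds_zero_nat
      have h2 : Filter.Tendsto (fun N => Real.sqrt (K * (2 * δ N) ^ 2)) Filter.atTop
          (nhds (Real.sqrt (K * (2 * 0) ^ 2))) :=
        (((this.const_mul 2).pow 2).const_mul K).sqrt
      simpa using h2
  obtain ⟨x, hx⟩ := cauchySeq_tendsto_of_complete hcauchy
  refine ⟨x, ?_, fun y hy => ?_⟩
  · have l1 : Filter.Tendsto (fun n => star (u n) * u n) Filter.atTop (nhds (star x * x)) :=
      (hx.star).mul hx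
    have l2 : Filter.Tendsto (fun n => star (u n) * u n) Filter.atTop (nhds (star c * c)) := by
      rw [tendsto_iff_norm_sub_tendsto_zero]
      have hb : ∀ n, ‖star (u n) * u n - star c * c‖ ≤ K * δ n ^ 2 := by
        intro n
        let ψ : ℝ → ℝ := fun t => δ n * g n t
        have hψ : ContinuousOn ψ (spectrum ℝ h) := (hg n).const_smul (δ n)
        -- From `δ² g² = 1 - t g²`: the defect `c* c - u_n* u_n` is itself a square `(ψ(h) c)* (ψ(h)
        -- c)`, of norm at most `K δ²`.
        have e1 : cfc ψ h * cfc ψ h = 1 - cfc (g n) h * h * cfc (g n) h := by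
          conv_rhs => rw [show cfc (g n) h * h * cfc (g n) h =
            cfc (g n) h * cfc (fun t => t) h * cfc (g n) h by rw [cfc_id' ℝ h]]
          have hgt : ContinuousOn (fun t => g n t * t) (spectrum ℝ h) := (hg n).mul continuousOn_id
          rw [← cfc_mul _ _ h hψ hψ, ← cfc_mul (g n) (fun t => t) h (hg n) continuousOn_id,
            ← cfc_mul (fun t => g n t * t) (g n) h hgt (hg n), ← cfc_one ℝ h,
            ← cfc_sub 1 (fun t => g n t * t * g n t) h continuousOn_const (hgt.mul (hg n))]
          refine cfc_congr fun t ht => ?_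
          have h1 := Real.sq_sqrt (hpos n t ht).le
          have h2 := (Real.sqrt_pos.2 (hpos n t ht)).ne'
          simp only [ψ, g]
          field_simp
          rw [h1, Pi.one_apply]
          ring
        have e2 : star c * c - star (u n) * u n = star (cfc ψ h * c) * (cfc ψ h * c) := by
          simp only [u, star_mul, hstar]
          calc _ = star c * (1 - cfc (g n) h * h * cfc (g n) h) * c := by
                simp only [mul_sub, sub_mul, mul_assoc, hdef, mul_one]
            _ = _ := by rw [← e1]; simp only [mul_assoc]
        rw [norm_sub_rev, e2, CStarRing.norm_star_mul_self, ← sq]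
        refine norm_cfc_mul_sq_le hh hK hc _ hψ (by positivity) fun t ht => ?_
        have h1 := Real.sq_sqrt (hpos n t ht).le
        simp only [ψ, g]
        rw [mul_pow, inv_pow, h1, mul_assoc]
        refine mul_le_of_le_one_right (by positivity) ?_
        rw [inv_mul_le_one₀ (hpos n t ht)]
        nlinarith [hδ n]
      have h0 : Filter.Tendsto (fun n => K * δ n ^ 2) Filter.atTop (nhds 0) := by
        have : Filter.Tendsto δ Filter.atTop (nhds 0) := tendsto_one_div_add_atTop_nhds_zero_nat
        simpa using (this.pow 2).const_mul K
      exact squeeze_zero (fun _ => norm_nonneg _) hb h0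
    exact tendsto_nhds_unique l1 l2
  · have l1 : Filter.Tendsto (fun n => y * u n) Filter.atTop (nhds (y * x)) := hx.const_mul y
    have : (fun n => y * u n) = fun _ => 0 := by
      ext n
      simp only [u]
      rw [← mul_assoc, hy, zero_mul]
    rw [this] at l1
    exact (tendsto_nhds_unique l1 tendsto_const_nhds)

end Polar

end TracialAH

end

/-! ### Quasitraces are monotone and norm continuous. -/

noncomputable section

namespace TracialAH

section Quasitrace

variable {A : Type*} [CStarAlgebra A]

open Classical in
/-- The extension by `0` of a function on the positive cone. -/
def posExt (τ : posCone A → ℝ) (a : A) : ℝ := if h : a ∈ posCone A then τ ⟨a, h⟩ else 0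

theorem posExt_of_mem (τ : posCone A → ℝ) {a : A} (h : a ∈ posCone A) : posExt τ a = τ ⟨a, h⟩ :=
  dif_pos h

theorem posExt_coe (τ : posCone A → ℝ) (a : posCone A) : posExt τ (a : A) = τ a :=
  dif_pos a.2

namespace IsOneQuasitrace

variable {τ : posCone A → ℝ} (hτ : IsOneQuasitrace τ)

include hτ in
theorem posExt_star_mul (x : A) : posExt τ (star x * x) = posExt τ (x * star x) := by
  rw [posExt_of_mem τ ⟨x, rfl⟩, posExt_of_mem τ ⟨star x, by rw [star_star]⟩]
  exact hτ.star_mul x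

include hτ in
theorem posExt_nonneg (a : A) : 0 ≤ posExt τ a := by
  unfold posExt
  split_ifs
  exacts [hτ.nonneg _, le_rfl]

variable [PartialOrder A] [StarOrderedRing A]

include hτ

theorem posExt_smul {c : ℝ} (hc : 0 ≤ c) {a : A} (ha : 0 ≤ a) :
    posExt τ (c • a) = c * posExt τ a := by
  rw [posExt_of_mem τ ((mem_posCone_iff _).2 ha),
    posExt_of_mem τ ((mem_posCone_iff _).2 (smul_nonneg hc ha))]
  exact hτ.smul c _ _ hc (Complex.coe_smul c a).symm

theorem posExt_add {a b : A} (ha : 0 ≤ a) (hb : 0 ≤ b) (h : Commute a b) :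
    posExt τ (a + b) = posExt τ a + posExt τ b := by
  rw [posExt_of_mem τ ((mem_posCone_iff _).2 ha), posExt_of_mem τ ((mem_posCone_iff _).2 hb),
    posExt_of_mem τ ((mem_posCone_iff _).2 (add_nonneg ha hb))]
  exact hτ.add _ _ _ h rfl

theorem posExt_zero : posExt τ (0 : A) = 0 := by
  have := hτ.posExt_smul (c := 0) le_rfl (a := (0 : A)) le_rfl
  simpa using this

theorem posExt_le_of_commute {a b : A} (ha : 0 ≤ a) (hab : a ≤ b) (h : Commute a b) :
    posExt τ a ≤ posExt τ b := by
  have := hτ.posExt_add ha (sub_nonneg.2 hab) (h.sub_right (Commute.refl a))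
  rw [add_sub_cancel] at this
  rw [this]
  linarith [hτ.posExt_nonneg (b - a)]

theorem posExt_sum {ι : Type*} (s : Finset ι) (f : ι → A) (hf : ∀ i ∈ s, 0 ≤ f i)
    (hc : ∀ i ∈ s, ∀ j ∈ s, i ≠ j → Commute (f i) (f j)) :
    posExt τ (∑ i ∈ s, f i) = ∑ i ∈ s, posExt τ (f i) := by
  classical
  induction s using Finset.induction_on with
  | empty => simpa using hτ.posExt_zero
  | insert i s hi ih =>
    rw [Finset.sum_insert hi, Finset.sum_insert hi, hτ.posExt_add, ih]
    · exact fun j hj => hf j (Finset.mem_insert_of_mem hj)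
    · exact fun j hj k hk => hc j (Finset.mem_insert_of_mem hj) k (Finset.mem_insert_of_mem hk)
    · exact hf i (Finset.mem_insert_self _ _)
    · exact Finset.sum_nonneg fun j hj => hf j (Finset.mem_insert_of_mem hj)
    · refine Commute.sum_right _ _ _ fun j hj => hc i (Finset.mem_insert_self _ _) j
        (Finset.mem_insert_of_mem hj) ?_
      rintro rfl
      exact hi hj

end IsOneQuasitrace

/-- The piecewise linear function that is `0` for `n t ≤ k` and `1` for `n t ≥ k + 1`. -/
def ramp (n k : ℕ) (t : ℝ) : ℝ := max 0 (min 1 (n * t - k))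

theorem continuous_ramp (n k : ℕ) : Continuous (ramp n k) := by
  unfold ramp
  fun_prop

theorem ramp_nonneg (n k : ℕ) (t : ℝ) : 0 ≤ ramp n k t := le_max_left _ _

theorem ramp_le_one (n k : ℕ) (t : ℝ) : ramp n k t ≤ 1 := max_le zero_le_one (min_le_left _ _)

/-- The partial sums are `min (n t) m`, by induction on `m`. -/
theorem sum_ramp (n m : ℕ) {t : ℝ} (ht : 0 ≤ t) (h : n * t ≤ m) :
    ∑ k ∈ Finset.range m, ramp n k t = n * t := by
  have key : ∀ m : ℕ, ∑ k ∈ Finset.range m, ramp n k t = min (n * t) m := by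
    intro m
    have h0 : 0 ≤ n * t := by positivity
    induction m with
    | zero => simp [h0]
    | succ m ih =>
      rw [Finset.sum_range_succ, ih]
      unfold ramp
      push_cast
      rcases le_total (n * t) m with h1 | h1
      · rw [min_eq_left h1, max_eq_left ((min_le_right _ _).trans (by linarith)), add_zero,
          min_eq_left (by linarith)]
      · rw [min_eq_right h1]
        rcases le_total (n * t) (m + 1) with h2 | h2
        · rw [min_eq_right (by linarith), max_eq_right (by linarith), min_eq_left h2]
          ring
        · rw [min_eq_left (by linarith), max_eq_right zero_le_one, min_eq_right h2]
  rw [key, min_eq_left h]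

section Ramp

variable [PartialOrder A] [StarOrderedRing A]

/-- A layer decomposition into commuting positive contractions, on which a quasitrace is additive.
The bound on `m` ensures that the layers exhaust the spectrum of `a`. -/
theorem sum_cfc_ramp (n m : ℕ) {a : A} (ha : 0 ≤ a) (h : n * ‖a‖ ≤ m) :
    ∑ k ∈ Finset.range m, cfc (ramp n k) a = (n : ℝ) • a := by
  rw [← cfc_sum _ _ _ fun k _ => (continuous_ramp n k).continuousOn]
  conv_rhs => rw [← cfc_id' ℝ a, ← cfc_smul (n : ℝ) (fun t => t) a continuousOn_id]
  refine cfc_congr fun t ht => ?_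
  have h1 : 0 ≤ t := spectrum_nonneg_of_nonneg ha ht
  have h2 : t ≤ ‖a‖ := by
    have h3 : ‖t‖ ≤ ‖a‖ * ‖(1 : A)‖ := spectrum.norm_le_norm_mul_of_mem ht
    have h4 : ‖(1 : A)‖ ≤ 1 := by
      rcases subsingleton_or_nontrivial A with h | h
      · simp [Subsingleton.elim (1 : A) 0]
      · exact CStarRing.norm_one.le
    rw [Real.norm_of_nonneg h1] at h3
    nlinarith [norm_nonneg a]
  rw [Finset.sum_apply, sum_ramp n m h1 (le_trans (by gcongr) h), smul_eq_mul]

theorem cfc_ramp_nonneg (n k : ℕ) (a : A) : 0 ≤ cfc (ramp n k) a :=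
  cfc_nonneg fun t _ => ramp_nonneg n k t

/-- Write `c²` for the ramp of `a` and `r² = (b - s)₊`. Where `c` lives, `a - s ≥ 1/n`, so `c² ≤ n c
(a - s) c ≤ n (r c)* (r c)`. Polar decomposition gives `x* x = c²` with `x` in the closed right
ideal of `r c`. The ramp `g` of `b` is a unit for `r`, so `g x = x`, and `x x*` commutes with `g`
and lies below it. -/
theorem IsOneQuasitrace.posExt_ramp_le {τ : posCone A → ℝ} (hτ : IsOneQuasitrace τ) {a b : A}
    (ha : 0 ≤ a) (hab : a ≤ b) {n : ℕ} (hn : 0 < n) (k : ℕ) :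
    posExt τ (cfc (ramp n (k + 2)) a) ≤ posExt τ (cfc (ramp n k) b) := by
  have hb : 0 ≤ b := ha.trans hab
  have hn' : (0 : ℝ) < n := by exact_mod_cast hn
  -- This level separates the two ramps: ramp `k` equals `1` from `s` on, while ramp `k + 2`
  -- vanishes up to `s + 1/n`. The gap `1/n` is why the index moves by two.
  set s : ℝ := ((k : ℝ) + 1) / n with hs
  set c := cfc (fun t => Real.sqrt (ramp n (k + 2) t)) a with hc
  set r := cfc (fun t => Real.sqrt (max (t - s) 0)) b with hr
  have hcont : Continuous fun t => Real.sqrt (ramp n (k + 2) t) :=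
    Real.continuous_sqrt.comp (continuous_ramp n _)
  have hcs : star c = c := (cfc_predicate _ a : IsSelfAdjoint _).star_eq
  have hrs : star r = r := (cfc_predicate _ b : IsSelfAdjoint _).star_eq
  have hcc : c * c = cfc (ramp n (k + 2)) a := by
    rw [hc, ← cfc_mul _ _ a hcont.continuousOn hcont.continuousOn]
    exact cfc_congr fun t _ => Real.mul_self_sqrt (ramp_nonneg n _ t)
  have hrr : b - algebraMap ℝ A s ≤ r * r := by
    rw [hr, ← cfc_mul _ _ b (by fun_prop) (by fun_prop)]
    conv_lhs => rw [← cfc_id' ℝ b, ← cfc_const s b, ← cfc_sub _ _ b (by fun_prop) (by fun_prop)]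
    refine cfc_mono fun t _ => ?_
    rw [Real.mul_self_sqrt (le_max_right _ _)]
    exact le_max_left _ _
  have h1 : c * (a - algebraMap ℝ A s) * c ≤ star (r * c) * (r * c) := by
    have h2 : a - algebraMap ℝ A s ≤ r * r := (sub_le_sub_right hab _).trans hrr
    have h3 := star_left_conjugate_le_conjugate h2 c
    rw [hcs] at h3
    refine h3.trans_eq ?_
    rw [StarMul.star_mul, hcs, hrs]
    simp only [mul_assoc]
  have h2 : (1 / n : ℝ) • (c * c) ≤ c * (a - algebraMap ℝ A s) * c := by
    have e : c * (a - algebraMap ℝ A s) * c =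
        cfc (fun t => ramp n (k + 2) t * (t - s)) a := by
      conv_lhs => rw [show a - algebraMap ℝ A s = cfc (fun t => t - s) a by
        rw [cfc_sub (fun t => t) (fun _ => s) a continuousOn_id continuousOn_const, cfc_const s a,
          cfc_id' ℝ a]]
      rw [hc, ← cfc_mul _ _ a hcont.continuousOn (by fun_prop),
        ← cfc_mul (fun t => Real.sqrt (ramp n (k + 2) t) * (t - s)) _ a (by fun_prop)
          hcont.continuousOn]
      refine cfc_congr fun t _ => ?_
      have := Real.mul_self_sqrt (ramp_nonneg n (k + 2) t)
      linear_combination (t - s) * this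
    rw [e, hcc, ← cfc_smul _ _ _ (continuous_ramp n _).continuousOn]
    refine cfc_mono (fun t _ => ?_) ((continuous_ramp n (k + 2)).const_smul (1 / n : ℝ)).continuousOn
      ((continuous_ramp n _).mul (by fun_prop)).continuousOn
    rw [smul_eq_mul, mul_comm]
    rcases le_or_gt (n * t) (k + 2) with h | h
    · have : ramp n (k + 2) t = 0 := by
        unfold ramp
        push_cast
        exact max_eq_left ((min_le_right _ _).trans (by linarith))
      simp [this]
    · refine mul_le_mul_of_nonneg_left ?_ (ramp_nonneg n _ t)
      rw [hs, le_sub_iff_add_le, ← add_div, div_le_iff₀ hn']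
      linarith
  have h3 : c * star c ≤ (n : ℝ) • (star (r * c) * (r * c)) := by
    have := smul_le_smul_of_nonneg_left (h2.trans h1) hn'.le
    rw [smul_smul, mul_one_div_cancel hn'.ne', one_smul] at this
    rwa [hcs]
  obtain ⟨x, hx1, hx2⟩ := exists_star_mul_self_eq_of_le hn'.le h3
  rw [hcs] at hx1
  set g := cfc (ramp n k) b with hg
  have hgs : star g = g := (cfc_predicate _ b : IsSelfAdjoint _).star_eq
  have hgx : g * x = x := by
    have h4 : (1 - g) * (r * c) = 0 := by
      rw [← mul_assoc]
      have : (1 - g) * r = 0 := by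
        rw [hg, hr, ← cfc_one ℝ b, ← cfc_sub 1 _ b continuousOn_const
          (continuous_ramp n k).continuousOn, ← cfc_mul (fun t => (1 : ℝ → ℝ) t - ramp n k t) _ b
          (continuous_const.sub (continuous_ramp n k)).continuousOn (by fun_prop)]
        rw [← cfc_zero ℝ b]
        refine cfc_congr fun t _ => ?_
        simp only [Pi.one_apply, Pi.zero_apply, mul_eq_zero]
        rcases le_or_gt t s with h | h
        · right
          rw [max_eq_right (by linarith), Real.sqrt_zero]
        · left
          rw [hs, div_lt_iff₀ hn'] at h
          unfold ramp
          rw [min_eq_left (by linarith), max_eq_right zero_le_one, sub_self]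
      rw [this, zero_mul]
    have h5 := hx2 _ h4
    rw [sub_mul, one_mul, sub_eq_zero] at h5
    exact h5.symm
  have hxg : star x * g = star x := by
    conv_rhs => rw [← hgx, StarMul.star_mul, hgs]
  have hg2 : g * g ≤ g := by
    rw [hg, ← cfc_mul _ _ b (continuous_ramp n k).continuousOn (continuous_ramp n k).continuousOn]
    exact cfc_mono (fun t _ => mul_le_of_le_one_left (ramp_nonneg n k t) (ramp_le_one n k t))
      ((continuous_ramp n k).mul (continuous_ramp n k)).continuousOn
      (continuous_ramp n k).continuousOn
  have hx3 : x * star x ≤ 1 := by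
    have h6 : ‖x‖ * ‖x‖ ≤ 1 := by
      rw [← CStarRing.norm_star_mul_self, hx1, hcc]
      refine norm_cfc_le zero_le_one fun t _ => ?_
      rw [Real.norm_of_nonneg (ramp_nonneg n _ t)]
      exact ramp_le_one n _ t
    rw [← CStarAlgebra.norm_le_one_iff_of_nonneg _ (mul_star_self_nonneg x),
      CStarRing.norm_self_mul_star]
    exact h6
  have hx4 : x * star x ≤ g := by
    have h6 := star_left_conjugate_le_conjugate hx3 g
    rw [hgs, mul_one, ← mul_assoc, hgx, mul_assoc, hxg] at h6
    exact h6.trans hg2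
  rw [← hcc, ← hx1, hτ.posExt_star_mul]
  refine hτ.posExt_le_of_commute (mul_star_self_nonneg x) hx4 ?_
  rw [commute_iff_eq, mul_assoc, hxg, ← mul_assoc, hgx]

/-- `1`-quasitraces are order preserving. -/
theorem IsOneQuasitrace.posExt_mono {τ : posCone A → ℝ} (hτ : IsOneQuasitrace τ) {a b : A}
    (ha : 0 ≤ a) (hab : a ≤ b) : posExt τ a ≤ posExt τ b := by
  have hb : 0 ≤ b := ha.trans hab
  have hsum : ∀ (n m : ℕ) {x : A}, 0 ≤ x → n * ‖x‖ ≤ m →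
      n * posExt τ x = ∑ k ∈ Finset.range m, posExt τ (cfc (ramp n k) x) := by
    intro n m x hx h
    rw [← hτ.posExt_smul (Nat.cast_nonneg n) hx, ← sum_cfc_ramp n m hx h]
    exact hτ.posExt_sum _ _ (fun k _ => cfc_ramp_nonneg n k x)
      fun i _ j _ _ => cfc_commute_cfc _ _ _
  have hone : ∀ (n k : ℕ) (x : A), posExt τ (cfc (ramp n k) x) ≤ posExt τ (1 : A) := by
    intro n k x
    exact hτ.posExt_le_of_commute (cfc_ramp_nonneg n k x)
      (cfc_le_one _ _ fun t _ => ramp_le_one n k t) (Commute.one_right _)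
  -- The first two layers of `a` have no partner among the layers of `b`; each costs at most `τ(1)`.
  have key : ∀ n : ℕ, 0 < n → n * posExt τ a ≤ n * posExt τ b + 2 * posExt τ (1 : A) := by
    intro n hn
    obtain ⟨m, hm⟩ := exists_nat_ge (n * ‖b‖)
    have hm' : n * ‖a‖ ≤ (m + 2 : ℕ) := by
      have : ‖a‖ ≤ ‖b‖ := CStarAlgebra.norm_le_norm_of_nonneg_of_le ha hab
      push_cast
      have : n * ‖a‖ ≤ n * ‖b‖ := by gcongr
      linarith
    rw [hsum n m hb hm, hsum n (m + 2) ha hm', Finset.sum_range_succ', Finset.sum_range_succ']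
    have h1 : ∑ k ∈ Finset.range m, posExt τ (cfc (ramp n (k + 1 + 1)) a) ≤
        ∑ k ∈ Finset.range m, posExt τ (cfc (ramp n k) b) :=
      Finset.sum_le_sum fun k _ => hτ.posExt_ramp_le ha hab hn k
    linarith [hone n (0 + 1) a, hone n 0 a]
  refine le_of_forall_pos_le_add fun ε hε => ?_
  obtain ⟨n, hn⟩ := exists_nat_gt (2 * posExt τ (1 : A) / ε)
  have h1 : 0 ≤ posExt τ (1 : A) := hτ.posExt_nonneg 1
  have hn' : (0 : ℝ) < n := lt_of_le_of_lt (by positivity) hn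
  have h2 := key n (by exact_mod_cast hn')
  rw [div_lt_iff₀ hε] at hn
  by_contra! h3
  nlinarith

/-- `1`-quasitraces are norm continuous. -/
theorem IsOneQuasitrace.posExt_le_add_norm_sub {τ : posCone A → ℝ} (hτ : IsOneQuasitrace τ)
    {a b : A} (ha : 0 ≤ a) (hb : 0 ≤ b) :
    posExt τ a ≤ posExt τ b + ‖a - b‖ * posExt τ (1 : A) := by
  have h1 : a ≤ b + ‖a - b‖ • (1 : A) := by
    have : a - b ≤ algebraMap ℝ A ‖a - b‖ :=
      IsSelfAdjoint.le_algebraMap_norm_self (ha.isSelfAdjoint.sub hb.isSelfAdjoint)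
    rw [Algebra.algebraMap_eq_smul_one, sub_le_iff_le_add] at this
    rwa [add_comm]
  have h2 : (0 : A) ≤ ‖a - b‖ • (1 : A) := smul_nonneg (norm_nonneg _) zero_le_one
  refine (hτ.posExt_mono ha h1).trans_eq ?_
  rw [hτ.posExt_add hb h2 ((Commute.one_right b).smul_right _),
    hτ.posExt_smul (norm_nonneg _) zero_le_one]

end Ramp

end Quasitrace
end TracialAH

end

/-! ### Projections in matrix algebras, corners and matrix-valued functions. -/

noncomputable section

namespace TracialAH

open scoped Matrix.Norms.L2Operator

section Frame

/-- A projection of rank `k` is `w w*` for an isometry `w : ℂ^k → ℂ^ι`. -/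
theorem exists_frame {ι : Type*} [Fintype ι] [DecidableEq ι] {e : Matrix ι ι ℂ}
    (he : IsStarProjection e) {k : ℕ} (hk : e.rank = k) :
    ∃ w : Matrix ι (Fin k) ℂ, wᴴ * w = 1 ∧ w * wᴴ = e := by
  subst hk
  have hH : e.IsHermitian := he.isSelfAdjoint.star_eq
  set U : Matrix ι ι ℂ := (hH.eigenvectorUnitary : Matrix ι ι ℂ) with hU
  have hU1 : Uᴴ * U = 1 := Unitary.coe_star_mul_self hH.eigenvectorUnitary
  have hU2 : U * Uᴴ = 1 := Unitary.coe_mul_star_self hH.eigenvectorUnitary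
  set D : Matrix ι ι ℂ := Matrix.diagonal (fun i => (hH.eigenvalues i : ℂ)) with hD
  have hspec : e = U * D * Uᴴ := hH.spectral_theorem
  have hDD : D * D = D := by
    have h1 : Uᴴ * (e * e) * U = Uᴴ * e * U := by rw [he.isIdempotentElem.eq]
    have h2 : ∀ Z : Matrix ι ι ℂ, Uᴴ * (U * Z * Uᴴ) * U = Z := by
      intro Z
      calc _ = (Uᴴ * U) * Z * (Uᴴ * U) := by simp only [Matrix.mul_assoc]
        _ = Z := by rw [hU1, Matrix.one_mul, Matrix.mul_one]
    have h3 : e * e = U * (D * D) * Uᴴ := by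
      rw [hspec]
      calc _ = U * D * (Uᴴ * U) * D * Uᴴ := by simp only [Matrix.mul_assoc]
        _ = _ := by rw [hU1, Matrix.mul_one]; simp only [Matrix.mul_assoc]
    rw [h3, h2] at h1
    rw [h1]
    conv_lhs => rw [hspec]
    exact h2 D
  have hev : ∀ i, hH.eigenvalues i ≠ 0 → hH.eigenvalues i = 1 := by
    intro i hi
    have h1 := congrFun (congrFun hDD i) i
    simp only [hD, Matrix.diagonal_mul_diagonal, Matrix.diagonal_apply_eq] at h1
    have h2 : hH.eigenvalues i * hH.eigenvalues i = hH.eigenvalues i := by exact_mod_cast h1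
    exact mul_left_cancel₀ hi (by rw [h2, mul_one])
  have hcard : Fintype.card {i // hH.eigenvalues i ≠ 0} = Fintype.card (Fin e.rank) := by
    rw [← hH.rank_eq_card_non_zero_eigs, Fintype.card_fin]
  let σ : {i // hH.eigenvalues i ≠ 0} ≃ Fin e.rank := Fintype.equivOfCardEq hcard
  -- The frame consists of the eigenvectors with nonzero eigenvalue; idempotency forces these
  -- eigenvalues to be `1`.
  refine ⟨U.submatrix id fun k => (σ.symm k : ι), ?_, ?_⟩
  · ext a b
    have h1 := congrFun (congrFun hU1 (σ.symm a)) (σ.symm b)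
    rw [Matrix.mul_apply] at h1 ⊢
    refine Eq.trans ?_ (h1.trans ?_)
    · rfl
    · simp only [Matrix.one_apply]
      congr 1
      rw [Subtype.coe_inj, σ.symm.injective.eq_iff]
  · ext a b
    conv_rhs => rw [hspec]
    rw [Matrix.mul_apply, Matrix.mul_apply]
    simp only [hD, Matrix.mul_diagonal, Matrix.submatrix_apply, Matrix.conjTranspose_apply, id]
    rw [← σ.sum_comp]
    simp only [Equiv.symm_apply_apply]
    rw [← Finset.sum_subtype (Finset.univ.filter fun i => hH.eigenvalues i ≠ 0) (by simp)
      (fun i => U a i * star (U b i)), Finset.sum_filter]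
    refine Finset.sum_congr rfl fun i _ => ?_
    split_ifs with h
    · rw [hev i h, Complex.ofReal_one, mul_one]
    · rw [not_not.1 h, Complex.ofReal_zero, mul_zero, zero_mul]

theorem trace_eq_rank {ι : Type*} [Fintype ι] [DecidableEq ι] {e : Matrix ι ι ℂ}
    (he : IsStarProjection e) : e.trace = (e.rank : ℂ) := by
  obtain ⟨w, h1, h2⟩ := exists_frame he rfl
  conv_lhs => rw [← h2, Matrix.trace_mul_comm, h1]
  simp

end Frame

section Corner

variable {M : Type*} [Ring M] [StarRing M] [Algebra ℂ M] [StarModule ℂ M] {P : M}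
    {hP : IsStarProjection P}

theorem mem_corner_iff {x : M} : x ∈ corner P hP ↔ P * x * P = x := Iff.rfl

theorem mem_corner_iff' {x : M} : x ∈ corner P hP ↔ P * x = x ∧ x * P = x := by
  rw [mem_corner_iff]
  have h := hP.isIdempotentElem.eq
  refine ⟨fun hx => ?_, fun ⟨h1, h2⟩ => by rw [h1, h2]⟩
  constructor
  · conv_lhs => rw [← hx]
    rw [← mul_assoc, ← mul_assoc, h, hx]
  · conv_lhs => rw [← hx]
    rw [mul_assoc, h, hx]

theorem self_mem_corner : P ∈ corner P hP := by
  rw [mem_corner_iff, hP.isIdempotentElem.eq, hP.isIdempotentElem.eq]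

theorem compress_mem_corner (x : M) : P * x * P ∈ corner P hP := by
  rw [mem_corner_iff]
  have h := hP.isIdempotentElem.eq
  simp only [← mul_assoc, h]
  rw [mul_assoc, h]

end Corner

section FunctionAlgebra

variable {X : Type*} [TopologicalSpace X] [CompactSpace X] {r : ℕ}

/-- The C*-algebra of continuous functions on `X` with values in the `r × r` matrices. -/
def MatFun (X : Type*) [TopologicalSpace X] [CompactSpace X] (r : ℕ) : Type _ :=
  C(X, Matrix (Fin r) (Fin r) ℂ)

namespace MatFun

instance : CStarAlgebra (MatFun X r) :=
  inferInstanceAs (CStarAlgebra C(X, Matrix (Fin r) (Fin r) ℂ))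

instance : FunLike (MatFun X r) X (Matrix (Fin r) (Fin r) ℂ) :=
  inferInstanceAs (FunLike C(X, Matrix (Fin r) (Fin r) ℂ) X (Matrix (Fin r) (Fin r) ℂ))

/-- The element given by a continuous function. -/
def mk (f : X → Matrix (Fin r) (Fin r) ℂ) (hf : Continuous f) : MatFun X r :=
  (⟨f, hf⟩ : C(X, Matrix (Fin r) (Fin r) ℂ))

@[simp] theorem mk_apply (f : X → Matrix (Fin r) (Fin r) ℂ) (hf : Continuous f) (x : X) :
    mk f hf x = f x := rfl

@[fun_prop]
theorem continuous (f : MatFun X r) : Continuous f := ContinuousMap.continuous f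

@[ext] theorem ext {f g : MatFun X r} (h : ∀ x, f x = g x) : f = g := DFunLike.ext _ _ h

@[simp] theorem mul_apply (f g : MatFun X r) (x : X) : (f * g) x = f x * g x := rfl
@[simp] theorem add_apply (f g : MatFun X r) (x : X) : (f + g) x = f x + g x := rfl
@[simp] theorem smul_apply (c : ℂ) (f : MatFun X r) (x : X) : (c • f) x = c • f x := rfl
@[simp] theorem star_apply (f : MatFun X r) (x : X) : (star f) x = (f x)ᴴ := rfl
@[simp] theorem zero_apply (x : X) : (0 : MatFun X r) x = 0 := rfl

/-- Evaluation at a point. -/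
def eval (x : X) : MatFun X r →⋆ₐ[ℂ] Matrix (Fin r) (Fin r) ℂ where
  toFun f := f x
  map_one' := rfl
  map_mul' _ _ := rfl
  map_zero' := rfl
  map_add' _ _ := rfl
  commutes' _ := rfl
  map_star' _ := rfl

theorem norm_apply_le (f : MatFun X r) (x : X) : ‖f x‖ ≤ ‖f‖ :=
  ContinuousMap.norm_coe_le_norm (f : C(X, Matrix (Fin r) (Fin r) ℂ)) x

theorem continuous_eval (x : X) : Continuous (eval (r := r) x) := by
  refine AddMonoidHomClass.continuous_of_bound (eval (r := r) x) 1 fun f => ?_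
  rw [one_mul]
  exact norm_apply_le f x

theorem eval_cfc (x : X) (f : ℝ → ℝ) (hf : Continuous f) {b : MatFun X r}
    (hb : IsSelfAdjoint b) : (cfc f b) x = cfc f (b x) :=
  StarAlgHomClass.map_cfc (R := ℝ) (S := ℂ) (eval (r := r) x) f b hf.continuousOn
    (continuous_eval x) hb (hb.map (eval (r := r) x))

end MatFun

instance isClosed_corner (P : MatFun X r) (hP : IsStarProjection P) :
    IsClosed (corner P hP : Set (MatFun X r)) :=
  isClosed_eq (by fun_prop) continuous_id

/-- A continuous function with positive semidefinite values in a corner has a self-adjoint square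
root in this corner. -/
theorem MatFun.exists_sqrt {P : MatFun X r} {hP : IsStarProjection P} {b : MatFun X r}
    (hb : b ∈ corner P hP) (hpos : ∀ x, (b x).PosSemidef) :
    ∃ y ∈ corner P hP, star y = y ∧ y * y = b := by
  have hbs : IsSelfAdjoint b := by
    ext1 x
    exact (hpos x).isHermitian
  -- The non-unital calculus keeps the root inside the corner. As `√0 = 0`, it agrees with the
  -- unital one, which can be evaluated pointwise.
  refine ⟨cfcₙ Real.sqrt b, cfcₙ_mem (𝕜' := ℂ) _ hb, (cfcₙ_predicate _ b : IsSelfAdjoint _).star_eq,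
    ?_⟩
  rw [cfcₙ_eq_cfc (by fun_prop) (by simp)]
  ext1 x
  rw [MatFun.mul_apply, MatFun.eval_cfc x _ Real.continuous_sqrt hbs,
    ← cfc_mul _ _ _ (by fun_prop) (by fun_prop)]
  have hs : IsSelfAdjoint (b x) := (hpos x).isHermitian
  conv_rhs => rw [← cfc_id' ℝ (b x)]
  refine cfc_congr fun t ht => Real.mul_self_sqrt ?_
  rw [(hpos x).isHermitian.spectrum_real_eq_range_eigenvalues] at ht
  obtain ⟨i, rfl⟩ := ht
  exact (hpos x).eigenvalues_nonneg i

end FunctionAlgebra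

end TracialAH

end

/-! ### Subalgebras of the form `P M_r(C(X)) P` and their complements. -/

noncomputable section

namespace TracialAH
open scoped Matrix.Norms.L2Operator

section HomogeneousSubalgebra

/-- A `*`-isomorphism of an algebra `P C(X, M_r) P`, with `P(x) ≠ 0` for all `x`, onto a
C*-subalgebra of `A`. -/
structure HomogeneousSubalgebra (A : Type*) [CStarAlgebra A] where
  X : Type
  [top : TopologicalSpace X]
  [compact : CompactSpace X]
  [t2 : T2Space X]
  r : ℕ
  P : MatFun X r
  isProj : IsStarProjection P
  hom : corner P isProj →⋆ₙₐ[ℂ] A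
  injective : Function.Injective hom
  P_ne_zero : ∀ x, P x ≠ 0

namespace HomogeneousSubalgebra

attribute [instance] HomogeneousSubalgebra.top HomogeneousSubalgebra.compact
  HomogeneousSubalgebra.t2

variable {A : Type*} [CStarAlgebra A] (H : HomogeneousSubalgebra A)

/-- The map `b ↦ hom (P b P)` on `C(X, M_r)`. -/
def toAlg : MatFun H.X H.r →ₗ[ℂ] A where
  toFun b := H.hom ⟨H.P * b * H.P, compress_mem_corner b⟩
  map_add' a b := by
    rw [← map_add]
    congr 1
    ext1
    simp [mul_add, add_mul]
  map_smul' c b := by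
    rw [RingHom.id_apply, ← map_smul]
    congr 1
    ext1
    simp

theorem toAlg_of_mem {b : MatFun H.X H.r} (hb : b ∈ corner H.P H.isProj) :
    H.toAlg b = H.hom ⟨b, hb⟩ := by
  change H.hom _ = _
  congr 1
  exact Subtype.ext hb

theorem toAlg_mul {b c : MatFun H.X H.r} (hb : b ∈ corner H.P H.isProj)
    (hc : c ∈ corner H.P H.isProj) : H.toAlg (b * c) = H.toAlg b * H.toAlg c := by
  rw [H.toAlg_of_mem hb, H.toAlg_of_mem hc, H.toAlg_of_mem (mul_mem hb hc), ← map_mul]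
  rfl

theorem toAlg_star (b : MatFun H.X H.r) : H.toAlg (star b) = star (H.toAlg b) := by
  change H.hom _ = star (H.hom _)
  rw [← map_star]
  congr 1
  ext1
  change H.P * star b * H.P = star (H.P * b * H.P)
  rw [star_mul, star_mul, H.isProj.isSelfAdjoint.star_eq, mul_assoc]

/-- The unit of the subalgebra, a projection of `A`. -/
def unit : A := H.toAlg H.P

theorem norm_toAlg {b : MatFun H.X H.r} (hb : b ∈ corner H.P H.isProj) :
    ‖H.toAlg b‖ = ‖b‖ := by
  rw [H.toAlg_of_mem hb]
  exact NonUnitalStarAlgHom.norm_map H.hom H.injective _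

theorem toAlg_injective {b : MatFun H.X H.r} (hb : b ∈ corner H.P H.isProj)
    (h : H.toAlg b = 0) : b = 0 := by
  rw [H.toAlg_of_mem hb] at h
  exact congrArg Subtype.val (H.injective (h.trans (map_zero _).symm))

/-- The range of the embedding. -/
def range : Set A := H.toAlg '' (corner H.P H.isProj : Set (MatFun H.X H.r))

theorem isClosed_range : IsClosed H.range := by
  have h1 : H.range = Set.range H.hom := by
    ext a
    constructor
    · rintro ⟨b, hb, rfl⟩
      exact ⟨⟨b, hb⟩, (H.toAlg_of_mem hb).symm⟩
    · rintro ⟨⟨b, hb⟩, rfl⟩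
      exact ⟨b, hb, H.toAlg_of_mem hb⟩
  rw [h1]
  exact (NonUnitalStarAlgHom.isometry H.hom H.injective).isClosedEmbedding.isClosed_range

theorem unit_mul {a : A} (ha : a ∈ H.range) : H.unit * a = a := by
  obtain ⟨b, hb, rfl⟩ := ha
  rw [unit, ← H.toAlg_mul self_mem_corner hb, (mem_corner_iff'.1 hb).1]

theorem mul_unit {a : A} (ha : a ∈ H.range) : a * H.unit = a := by
  obtain ⟨b, hb, rfl⟩ := ha
  rw [unit, ← H.toAlg_mul hb self_mem_corner, (mem_corner_iff'.1 hb).2]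

theorem isStarProjection : IsStarProjection H.unit where
  isIdempotentElem := by
    unfold IsIdempotentElem
    rw [unit, ← H.toAlg_mul self_mem_corner self_mem_corner, H.isProj.isIdempotentElem.eq]
  isSelfAdjoint := by
    rw [IsSelfAdjoint, unit, ← H.toAlg_star, H.isProj.isSelfAdjoint.star_eq]

/-- The C*-algebra `C ⊕ (1 - p) A (1 - p)`, where `C` is the given subalgebra with unit `p`. -/
def cut : NonUnitalStarSubalgebra ℂ A where
  carrier := {a | H.unit * a = a * H.unit ∧ H.unit * a ∈ H.range}
  add_mem' := by
    rintro a b ⟨ha, c, hc, hca⟩ ⟨hb, e, he, heb⟩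
    exact ⟨by rw [mul_add, add_mul, ha, hb], c + e, add_mem hc he, by rw [map_add, hca, heb, mul_add]⟩
  zero_mem' := ⟨by simp, 0, zero_mem _, by simp⟩
  mul_mem' := by
    rintro a b ⟨ha, c, hc, hca⟩ ⟨hb, e, he, heb⟩
    have h := H.isStarProjection.isIdempotentElem.eq
    refine ⟨by rw [← mul_assoc, ha, mul_assoc, hb, mul_assoc], c * e, mul_mem hc he, ?_⟩
    rw [H.toAlg_mul hc he, hca, heb, ha, mul_assoc, ← mul_assoc H.unit H.unit b, h, ← mul_assoc, ← ha,
      mul_assoc]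
  smul_mem' := by
    rintro t a ⟨ha, c, hc, hca⟩
    exact ⟨by rw [mul_smul_comm, smul_mul_assoc, ha], t • c, SMulMemClass.smul_mem t hc,
      by rw [map_smul, hca, mul_smul_comm]⟩
  star_mem' := by
    rintro a ⟨ha, c, hc, hca⟩
    have h := H.isStarProjection.isSelfAdjoint.star_eq
    have h2 : star a * H.unit = H.unit * star a := by
      have := congrArg star ha
      rwa [star_mul, star_mul, h] at this
    exact ⟨h2.symm, star c, star_mem hc, by rw [H.toAlg_star, hca, star_mul, h, h2]⟩

theorem mem_cut {a : A} : a ∈ H.cut ↔ H.unit * a = a * H.unit ∧ H.unit * a ∈ H.range := Iff.rfl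

theorem isClosed_cut : IsClosed (H.cut : Set A) := by
  have h1 : (H.cut : Set A) = {a | H.unit * a = a * H.unit} ∩ (fun a => H.unit * a) ⁻¹' H.range := rfl
  rw [h1]
  exact (isClosed_eq (by fun_prop) (by fun_prop)).inter (H.isClosed_range.preimage (by fun_prop))

theorem isProj_apply (x : H.X) : IsStarProjection (H.P x) :=
  ⟨congrArg (fun f : MatFun H.X H.r => f x) H.isProj.isIdempotentElem.eq,
    congrArg (fun f : MatFun H.X H.r => f x) H.isProj.isSelfAdjoint.star_eq⟩

theorem rank_pos (x : H.X) : 0 < (H.P x).rank := by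
  rw [Nat.pos_iff_ne_zero]
  intro h
  obtain ⟨w, -, hw⟩ := exists_frame (H.isProj_apply x) h
  refine H.P_ne_zero x ?_
  rw [← hw]
  ext i j
  simp [Matrix.mul_apply]

/-- If `P` has rank at least `m` somewhere, then there are `m` orthogonal nonzero elements. -/
theorem exists_orthogonal (x₀ : H.X) {m : ℕ} (hm : m ≤ (H.P x₀).rank) :
    ∃ a : Fin m → A, (∀ i, a i ≠ 0) ∧ ∀ i j, i ≠ j → star (a i) * a j = 0 := by
  obtain ⟨R, hR⟩ : ∃ R, (H.P x₀).rank = R := ⟨_, rfl⟩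
  obtain ⟨w, hw1, hw2⟩ := exists_frame (H.isProj_apply x₀) hR
  rw [hR] at hm
  -- At `x₀` the element `b` below will have the distinct eigenvalues `1, …, R` on the range of `P`.
  -- Starting at `1` keeps them apart from the kernel.
  let D : Matrix (Fin R) (Fin R) ℂ := Matrix.diagonal fun i => ((i : ℕ) : ℂ) + 1
  let c : Matrix (Fin H.r) (Fin H.r) ℂ := w * D * wᴴ
  have hDs : Dᴴ = D := by
    ext i j
    simp only [D, Matrix.conjTranspose_apply, Matrix.diagonal_apply]
    by_cases h : i = j
    · subst h; simp
    · simp [h, Ne.symm h]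
  have hc : cᴴ = c := by
    simp only [c, Matrix.conjTranspose_mul, Matrix.conjTranspose_conjTranspose, hDs,
      Matrix.mul_assoc]
  let b : MatFun H.X H.r := H.P * MatFun.mk (fun _ => c) continuous_const * H.P
  have hb : b ∈ corner H.P H.isProj := compress_mem_corner _
  have hPs := H.isProj.isSelfAdjoint.star_eq
  have hbs : IsSelfAdjoint b := by
    have : star (MatFun.mk (fun _ => c) continuous_const : MatFun H.X H.r) =
        MatFun.mk (fun _ => c) continuous_const := by
      ext1 x
      exact hc
    simp only [b, IsSelfAdjoint, star_mul, hPs, this, mul_assoc]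
  have hbx : b x₀ = c := by
    have h1 : H.P x₀ * w = w := by rw [← hw2, Matrix.mul_assoc, hw1, Matrix.mul_one]
    have h2 : wᴴ * H.P x₀ = wᴴ := by rw [← hw2, ← Matrix.mul_assoc, hw1, Matrix.one_mul]
    change H.P x₀ * c * H.P x₀ = c
    simp only [c, Matrix.mul_assoc, h2]
    rw [← Matrix.mul_assoc, h1]
  -- Bumps around `j + 1` with disjoint supports, vanishing at `0`: the elements `f_j(b)` are
  -- orthogonal and stay in the corner. They are nonzero because `j + 1` is an eigenvalue of
  -- `b(x₀)`.
  let f : ℕ → ℝ → ℝ := fun j t => max 0 (1 / 2 - |t - (j + 1)|)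
  have hf : ∀ j, Continuous (f j) := fun j => by fun_prop
  have hf0 : ∀ j, f j 0 = 0 := by
    intro j
    simp only [f]
    rw [zero_sub, abs_neg, abs_of_nonneg (by positivity)]
    exact max_eq_left (by have : (0 : ℝ) ≤ j := j.cast_nonneg; linarith)
  have hff : ∀ i j : ℕ, i ≠ j → ∀ t, f i t * f j t = 0 := by
    intro i j hij t
    by_contra h
    obtain ⟨h1, h2⟩ := mul_ne_zero_iff.1 h
    have pos : ∀ k : ℕ, f k t ≠ 0 → |t - (k + 1)| < 1 / 2 := by
      intro k hk
      by_contra h3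
      exact hk (max_eq_left (by linarith))
    have h3 := pos i h1
    have h4 := pos j h2
    have h5 : |((i : ℤ) - j : ℝ)| < 1 := by
      have : ((i : ℤ) - j : ℝ) = (t - (j + 1)) - (t - (i + 1)) := by push_cast; ring
      rw [this]
      exact (abs_sub _ _).trans_lt (by linarith)
    have h6 : |(i : ℤ) - j| < 1 := by exact_mod_cast h5
    rw [Int.abs_lt_one_iff] at h6
    omega
  have hmem : ∀ j, cfc (f j) b ∈ corner H.P H.isProj := by
    intro j
    rw [← cfcₙ_eq_cfc (hf j).continuousOn (hf0 j)]
    exact cfcₙ_mem (𝕜' := ℂ) _ hb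
  refine ⟨fun i => H.toAlg (cfc (f i) b), fun i h => ?_, fun i j hij => ?_⟩
  · have h1 := congrArg (fun g : MatFun H.X H.r => g x₀) (H.toAlg_injective (hmem i) h)
    simp only [MatFun.zero_apply] at h1
    rw [MatFun.eval_cfc x₀ _ (hf i) hbs, hbx] at h1
    have hspec : ((i : ℝ) + 1) ∈ spectrum ℝ c := by
      rw [spectrum.mem_iff]
      intro hu
      -- A basis vector written as a column; `w e` is an eigenvector of `c` for the eigenvalue `i +
      -- 1`.
      let e : Matrix (Fin R) (Fin 1) ℂ := Matrix.of fun k _ => if (k : ℕ) = i then 1 else 0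
      have h2 : (algebraMap ℝ (Matrix (Fin H.r) (Fin H.r) ℂ) ((i : ℝ) + 1) - c) * (w * e) = 0 := by
        have h3 : c * (w * e) = w * (D * e) := by
          simp only [c]
          calc _ = w * D * (wᴴ * w) * e := by simp only [Matrix.mul_assoc]
            _ = _ := by rw [hw1, Matrix.mul_one, Matrix.mul_assoc]
        have h4 : D * e = ((i : ℝ) + 1) • e := by
          ext k l
          simp only [D, e, Matrix.diagonal_mul, Matrix.of_apply, Matrix.smul_apply]
          split_ifs with h5
          · rw [h5, Complex.real_smul]; push_cast; ring
          · simp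
        rw [Matrix.sub_mul, h3, h4, Algebra.algebraMap_eq_smul_one, Matrix.smul_mul, Matrix.one_mul,
          Matrix.mul_smul, sub_self]
      obtain ⟨u, hu⟩ := hu
      rw [← hu] at h2
      have h5 : w * e = 0 := by
        have := congrArg (fun z => (↑u⁻¹ : Matrix (Fin H.r) (Fin H.r) ℂ) * z) h2
        simpa [← Matrix.mul_assoc] using this
      have h6 : e = 0 := by
        have h7 := congrArg (fun z => wᴴ * z) h5
        simp only [← Matrix.mul_assoc] at h7
        rwa [hw1, Matrix.one_mul, Matrix.mul_zero] at h7
      have h7 := congrFun (congrFun h6 ⟨i, i.2.trans_le hm⟩) 0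
      simp [e] at h7
    have h8 := cfc_map_spectrum (R := ℝ) (f i) c (hc : IsSelfAdjoint c) (hf i).continuousOn
    rw [h1] at h8
    have h9 : f i ((i : ℝ) + 1) ∈ spectrum ℝ (0 : Matrix (Fin H.r) (Fin H.r) ℂ) := by
      rw [h8]
      exact ⟨_, hspec, rfl⟩
    rcases subsingleton_or_nontrivial (Matrix (Fin H.r) (Fin H.r) ℂ) with hn | hn
    · rw [spectrum.of_subsingleton] at h9
      exact h9
    · rw [spectrum.zero_eq] at h9
      simp [f] at h9
  · have h1 : star (cfc (f i) b) = cfc (f i) b := (cfc_predicate _ b : IsSelfAdjoint _).star_eq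
    simp only
    rw [← H.toAlg_star, h1, ← H.toAlg_mul (hmem i) (hmem j), ← cfc_mul _ _ _ (hf _).continuousOn
      (hf _).continuousOn]
    have : (fun t => f i t * f j t) = fun _ => 0 := by
      ext t
      exact hff i j (fun h => hij (Fin.ext h)) t
    rw [this, cfc_const_zero, map_zero]

end HomogeneousSubalgebra

end HomogeneousSubalgebra

end TracialAH

end

/-! ### The class `𝓒₁` in usable form. -/

noncomputable section

namespace TracialAH
open scoped Matrix.Norms.L2Operator

section Conversion

variable {X : Type*} [TopologicalSpace X] [CompactSpace X] {r : ℕ}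

/-- The identification of matrix-valued functions with matrices of functions. -/
def MatFun.toMatrix : MatFun X r →⋆ₙₐ[ℂ] Matrix (Fin r) (Fin r) C(X, ℂ) where
  toFun b := Matrix.of fun i j => ⟨fun x => b x i j, by fun_prop⟩
  map_smul' c b := rfl
  map_zero' := rfl
  map_add' a b := rfl
  map_mul' a b := by
    ext i j x
    simp [Matrix.mul_apply]
  map_star' a := rfl

/-- A matrix of functions as a matrix-valued function. -/
def MatFun.ofMatrix (m : Matrix (Fin r) (Fin r) C(X, ℂ)) : MatFun X r :=
  MatFun.mk (fun x => m.map fun f => f x) (by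
    refine continuous_matrix fun i j => ?_
    exact (m i j).continuous)

theorem MatFun.toMatrix_ofMatrix (m : Matrix (Fin r) (Fin r) C(X, ℂ)) :
    MatFun.toMatrix (MatFun.ofMatrix m) = m := rfl

theorem MatFun.toMatrix_injective :
    Function.Injective (MatFun.toMatrix : MatFun X r →⋆ₙₐ[ℂ] Matrix (Fin r) (Fin r) C(X, ℂ)) := by
  intro a b h
  ext x i j
  exact congrArg (fun m : Matrix (Fin r) (Fin r) C(X, ℂ) => m i j x) h

end Conversion

variable {A : Type*} [CStarAlgebra A]

/-- A C*-subalgebra in the class `𝓘_d`. -/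
theorem HomogeneousData.exists_homogeneousSubalgebra {d : ℕ} (D : HomogeneousData d)
    {C : NonUnitalStarSubalgebra ℂ A} (Φ : C ≃⋆ₐ[ℂ] D.algebra) (hD : ∀ x : D.X, 0 < D.rankAt x) :
    ∃ H : HomogeneousSubalgebra A, H.range = C ∧
      ∀ x : D.X, ∃ y : H.X, (H.P y).rank = D.rankAt x := by
  have : CompactSpace D.X := isCompact_iff_compactSpace.1 D.compact_X
  have hP : IsStarProjection (MatFun.ofMatrix D.P) := by
    constructor
    · apply MatFun.toMatrix_injective
      rw [map_mul, MatFun.toMatrix_ofMatrix, D.isStarProjection_P.isIdempotentElem.eq]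
    · apply MatFun.toMatrix_injective
      rw [map_star, MatFun.toMatrix_ofMatrix, D.isStarProjection_P.isSelfAdjoint.star_eq]
  have hmem : ∀ b : MatFun D.X D.r, b ∈ corner _ hP ↔ MatFun.toMatrix b ∈ D.algebra := by
    intro b
    change _ * b * _ = b ↔ D.P * _ * D.P = _
    rw [← MatFun.toMatrix_ofMatrix D.P, ← map_mul, ← map_mul, MatFun.toMatrix_ofMatrix]
    exact MatFun.toMatrix_injective.eq_iff.symm
  let κ : corner _ hP →⋆ₙₐ[ℂ] D.algebra :=
    { toFun := fun b => ⟨MatFun.toMatrix b.1, (hmem b.1).1 b.2⟩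
      map_smul' := fun c b => Subtype.ext (map_smul MatFun.toMatrix c b.1)
      map_zero' := rfl
      map_add' := fun a b => rfl
      map_mul' := fun a b => Subtype.ext (map_mul MatFun.toMatrix a.1 b.1)
      map_star' := fun a => rfl }
  have hκ : Function.Injective κ := fun a b h =>
    Subtype.ext (MatFun.toMatrix_injective (congrArg Subtype.val h))
  let ψ : D.algebra →⋆ₙₐ[ℂ] A :=
    { toFun := fun b => (Φ.symm b : A)
      map_smul' := fun c b => by rw [map_smul]; rfl
      map_zero' := by rw [map_zero]; rfl
      map_add' := fun a b => by rw [map_add]; rfl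
      map_mul' := fun a b => by rw [map_mul]; rfl
      map_star' := fun a => by rw [map_star]; rfl }
  have hψ : Function.Injective ψ := fun a b h => Φ.symm.injective (Subtype.ext h)
  let H : HomogeneousSubalgebra A :=
    { X := D.X
      r := D.r
      P := MatFun.ofMatrix D.P
      isProj := hP
      hom := ψ.comp κ
      injective := hψ.comp hκ
      P_ne_zero := fun x h => by
        have h1 := hD x
        change 0 < (MatFun.ofMatrix D.P x).rank at h1
        rw [h, Matrix.rank_zero] at h1
        exact lt_irrefl _ h1 }
  refine ⟨H, ?_, fun x => ⟨x, rfl⟩⟩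
  ext a
  constructor
  · rintro ⟨b, hb, rfl⟩
    rw [H.toAlg_of_mem hb]
    exact (Φ.symm _).2
  · intro ha
    have h1 : MatFun.ofMatrix ((Φ ⟨a, ha⟩ : D.algebra) : Matrix (Fin D.r) (Fin D.r) C(D.X, ℂ)) ∈
        corner _ hP := by
      rw [hmem, MatFun.toMatrix_ofMatrix]
      exact (Φ ⟨a, ha⟩).2
    refine ⟨_, h1, ?_⟩
    rw [H.toAlg_of_mem h1]
    change ((Φ.symm (Φ ⟨a, ha⟩) : C) : A) = a
    rw [Φ.symm_apply_apply]

/-- In a simple C*-algebra `a A b ≠ 0` for nonzero `a`, `b`. -/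
theorem IsSimpleCStar.exists_mul_mul_ne_zero (hA : IsSimpleCStar A) {a b : A} (ha : a ≠ 0)
    (hb : b ≠ 0) : ∃ y, a * y * b ≠ 0 := by
  by_contra! h
  -- The annihilator of `A b` is a closed two-sided ideal. It omits `1` because `b ≠ 0`, so by
  -- simplicity it is zero, and it would contain `a`.
  let I : TwoSidedIdeal A := TwoSidedIdeal.mk' {x | ∀ y, x * y * b = 0} (by simp)
    (fun hx hy z => by rw [add_mul, add_mul, hx, hy, add_zero])
    (fun hx z => by rw [neg_mul, neg_mul, hx, neg_zero])
    (fun {x y} hy z => by rw [mul_assoc x, mul_assoc, hy, mul_zero])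
    (fun {x y} hx z => by rw [mul_assoc x, hx])
  have hI : ∀ x, x ∈ I ↔ ∀ y, x * y * b = 0 := fun x => TwoSidedIdeal.mem_mk' ..
  have hcl : IsClosed (I : Set A) := by
    have : (I : Set A) = ⋂ y, {x | x * y * b = 0} := by
      ext x
      simp only [Set.mem_iInter]
      exact hI x
    rw [this]
    exact isClosed_iInter fun y => isClosed_eq (by fun_prop) continuous_const
  rcases hA.2 I hcl with h1 | h1
  · exact ha (by
      have := (hI a).2 h
      rw [h1] at this
      exact (TwoSidedIdeal.mem_bot A).1 this)
  · have h2 : (1 : A) ∈ I := by rw [h1]; trivial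
    exact hb (by simpa using (hI 1).1 h2 1)

/-- By simplicity a nonzero product can always be prolonged: from `w ≠ 0` and `a i ≠ 0` one gets
some `w y (a i) ≠ 0`, which still contains all the earlier factors. -/
theorem IsSimpleCStar.exists_common_factor (hA : IsSimpleCStar A) {ι : Type*} (s : Finset ι)
    (a : ι → A) (ha : ∀ i, a i ≠ 0) : ∃ w : A, w ≠ 0 ∧ ∀ i ∈ s, ∃ l t, w = l * a i * t := by
  classical
  have := hA.1
  induction s using Finset.induction_on with
  | empty => exact ⟨1, one_ne_zero, by simp⟩
  | insert i s hi ih =>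
    obtain ⟨w, hw, h⟩ := ih
    obtain ⟨y, hy⟩ := hA.exists_mul_mul_ne_zero hw (ha i)
    refine ⟨_, hy, fun j hj => ?_⟩
    rcases Finset.mem_insert.1 hj with rfl | hj
    · exact ⟨w * y, 1, by rw [mul_one]⟩
    · obtain ⟨l, t, e⟩ := h j hj
      exact ⟨l, t * y * a i, by rw [e]; simp only [mul_assoc]⟩

/-- If a projection `e` is Cuntz subequivalent to `w* w`, then it is equivalent to a projection in
the hereditary subalgebra generated by each factor of `w`. -/
theorem exists_star_mul_self_eq_of_cuntzLE {e w : A} (he : IsStarProjection e)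
    (h : CuntzLE e (star w * w)) {l a t : A} (hw : w = l * a * t) :
    ∃ v, star v * v = e ∧ ∀ y, y * a = 0 → y * v = 0 := by
  let _ := CStarAlgebra.spectralOrder A
  have _ := CStarAlgebra.spectralOrderedRing A
  obtain ⟨x, hx⟩ := h
  obtain ⟨n, hn⟩ := ((tendsto_order.1 hx).2 (1 / 2) (by norm_num)).exists
  have hes := he.isSelfAdjoint.star_eq
  have hee := he.isIdempotentElem.eq
  set z := star (x n) * (star w * w) * x n with hz
  have hzs : IsSelfAdjoint z := by
    rw [IsSelfAdjoint, hz]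
    simp only [star_mul, star_star, mul_assoc]
  -- An approximation within `1/2` suffices: after compression by `e` it reads `e ≤ 2 e z e`, with
  -- no further limit in `n`.
  have h1 : e - z ≤ (1 / 2 : ℝ) • (1 : A) := by
    have h2 := IsSelfAdjoint.le_algebraMap_norm_self (he.isSelfAdjoint.sub hzs)
    refine h2.trans ?_
    rw [Algebra.algebraMap_eq_smul_one, norm_sub_rev]
    exact smul_le_smul_of_nonneg_right hn.le zero_le_one
  have h2 : e - e * z * e ≤ (1 / 2 : ℝ) • e := by
    have h3 := star_left_conjugate_le_conjugate h1 e
    rwa [hes, mul_sub, sub_mul, hee, hee, mul_smul_comm, mul_one, smul_mul_assoc, hee] at h3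
  -- With `a` as leftmost factor, whatever kills `a` kills `T`. The factor `l` is absorbed into the
  -- constant of `e ≤ 2 ‖l‖² T* T`, to which polar decomposition applies.
  set T := a * (t * x n * e) with hT
  have h4 : e * z * e = star (l * T) * (l * T) := by
    rw [hz, hT, hw]
    simp only [star_mul, hes, mul_assoc]
  have h5 : star (l * T) * (l * T) ≤ ‖l‖ ^ 2 • (star T * T) := by
    have h6 := star_left_conjugate_le_conjugate (CStarAlgebra.star_mul_le_algebraMap_norm_sq (a := l)) T
    rw [Algebra.algebraMap_eq_smul_one, mul_smul_comm, mul_one, smul_mul_assoc] at h6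
    refine le_trans (le_of_eq ?_) h6
    simp only [star_mul, mul_assoc]
  have h6 : e * star e ≤ (2 * ‖l‖ ^ 2) • (star T * T) := by
    rw [hes, hee, mul_smul]
    have h7 : (1 / 2 : ℝ) • e ≤ ‖l‖ ^ 2 • (star T * T) := by
      refine le_trans ?_ h5
      rw [← h4]
      have e1 : e = (1 / 2 : ℝ) • e + (1 / 2 : ℝ) • e := by rw [← add_smul]; norm_num
      rw [sub_le_iff_le_add] at h2
      conv_lhs at h2 => rw [e1]
      exact (add_le_add_iff_left _).1 h2
    have h8 := smul_le_smul_of_nonneg_left h7 (zero_le_two : (0 : ℝ) ≤ 2)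
    rwa [smul_smul, mul_one_div_cancel two_ne_zero, one_smul] at h8
  obtain ⟨v, hv1, hv2⟩ := exists_star_mul_self_eq_of_le (by positivity) h6
  refine ⟨v, by rw [hv1, hes, hee], fun y hy => hv2 y ?_⟩
  rw [hT, ← mul_assoc, hy, zero_mul]

/-- The form in which the definition of the class `𝓒₁` is used. -/
theorem InClassC1.exists_approximation (hA : IsSimpleCStar A) (hC : InClassC1 A) (F : Finset A)
    {ε : ℝ} (hε : 0 < ε) (m : ℕ) :
    ∃ (H : HomogeneousSubalgebra A) (v : Fin m → A),
      (∀ i, star (v i) * v i = 1 - H.unit) ∧ (∀ i j, i ≠ j → star (v i) * v j = 0) ∧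
      ∀ x ∈ F, ∃ y ∈ H.cut, ‖x - y‖ < ε := by
  have := hA.1
  -- For `g = 1` and `η = 2/(m+1)` the rank condition becomes `(d+1)(m+1) < R`.
  have hrank : ∀ {d R : ℕ}, ((d : ℝ) + 1) / R < 2 / ((m : ℝ) + 1) / (((1 : ℕ) : ℝ) + 1) → 0 < R →
      m ≤ R := by
    intro d R h hR
    have hR' : (0 : ℝ) < R := by exact_mod_cast hR
    have hm : (0 : ℝ) < (m : ℝ) + 1 := by positivity
    rw [div_div, div_lt_div_iff₀ hR' (by positivity)] at h
    push_cast at h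
    have hd : (0 : ℝ) ≤ d := d.cast_nonneg
    have h2 : (m : ℝ) ≤ R := by nlinarith
    exact_mod_cast h2
  -- The first use of the hypothesis asks for no approximation; it only produces a subalgebra of
  -- rank at least `m`, hence `m` orthogonal nonzero elements.
  obtain ⟨p₀, C₀, d₀, D₀, -, -, ⟨Φ₀⟩, -, -, -, hr₀, -⟩ := hC ∅ 1 (2 / ((m : ℝ) + 1)) one_pos
    (by positivity) 1 ⟨1, by simp⟩ one_ne_zero
  obtain ⟨H₀, -, hH₀⟩ := D₀.exists_homogeneousSubalgebra Φ₀ fun x => (hr₀ x).1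
  obtain ⟨x₀, hx₀⟩ := D₀.nonempty_X
  obtain ⟨y₀, hy₀⟩ := hH₀ ⟨x₀, hx₀⟩
  obtain ⟨a, ha1, ha2⟩ := H₀.exists_orthogonal y₀ (m := m) (by
    rw [hy₀]
    exact hrank (hr₀ _).2 (hr₀ _).1)
  obtain ⟨w, hw, hwa⟩ := hA.exists_common_factor Finset.univ a ha1
  -- The second use approximates, with `1 - p` small against the common factor `w` of the orthogonal
  -- elements. Three error terms of size `ε/4` occur below.
  obtain ⟨p, C, d, D, hp, hCc, ⟨Φ⟩, ⟨hpC, hpc⟩, hF1, hF2, hr, hcuntz⟩ := hC F (ε / 4) 1 (by positivity)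
    one_pos (star w * w) ⟨w, rfl⟩ (fun h => hw (CStarRing.star_mul_self_eq_zero_iff w |>.1 h))
  obtain ⟨H, hHC, -⟩ := D.exists_homogeneousSubalgebra Φ fun x => (hr x).1
  have hunit : H.unit = p := by
    have h1 : H.unit ∈ H.range := ⟨H.P, self_mem_corner, rfl⟩
    have h2 : p ∈ H.range := by rw [hHC]; exact hpC
    rw [← H.mul_unit h2]
    exact ((hpc _ (by rw [hHC] at h1; exact h1)).1).symm
  have hv : ∀ i, ∃ v, star v * v = 1 - p ∧ ∀ y, y * a i = 0 → y * v = 0 := by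
    intro i
    obtain ⟨l, t, e⟩ := hwa i (Finset.mem_univ i)
    exact exists_star_mul_self_eq_of_cuntzLE hp.one_sub hcuntz e
  choose v hv1 hv2 using hv
  refine ⟨H, v, fun i => by rw [hunit, hv1], fun i j hij => ?_, fun x hx => ?_⟩
  · have h1 : star (a i) * v j = 0 := hv2 j _ (ha2 i j hij)
    have h2 : star (v j) * a i = 0 := by
      rw [← star_star (a i), ← star_mul, h1, star_zero]
    have h3 : star (v j) * v i = 0 := hv2 i _ h2
    rw [← star_star (v j), ← star_mul, h3, star_zero]
  · have hne : (C : Set A).Nonempty := ⟨p, hpC⟩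
    obtain ⟨c, hc, hcx⟩ := (Metric.infDist_lt_iff hne).1 (hF2 x hx)
    rw [dist_eq_norm] at hcx
    have hpp := hp.isIdempotentElem.eq
    refine ⟨c + (1 - p) * x * (1 - p), ⟨?_, ?_⟩, ?_⟩
    · rw [hunit, mul_add, add_mul, (hpc c hc).1, (hpc c hc).2]
      simp only [← mul_assoc, mul_sub, sub_mul, hpp, one_mul, mul_one]
      simp only [mul_assoc, hpp]
      abel
    · rw [hunit, mul_add, (hpc c hc).1, hHC]
      have : p * ((1 - p) * x * (1 - p)) = 0 := by
        simp only [← mul_assoc, mul_sub, sub_mul, hpp, one_mul, mul_one]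
        abel
      rw [this, add_zero]
      exact hc
    · have e1 : x - (c + (1 - p) * x * (1 - p)) =
          (p * x * p - c) + ((p * x - x * p) * (1 - p) - (1 - p) * (p * x - x * p)) := by
        have hpp' : ∀ z, p * (p * z) = p * z := fun z => by rw [← mul_assoc, hpp]
        simp only [mul_sub, sub_mul, one_mul, mul_one, mul_assoc, hpp, hpp']
        abel
      have hn1 : ‖1 - p‖ ≤ 1 := hp.one_sub.norm_le
      have h1 : ‖(p * x - x * p) * (1 - p)‖ ≤ ε / 4 :=
        (norm_mul_le _ _).trans (by nlinarith [hF1 x hx, norm_nonneg (p * x - x * p)])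
      have h2 : ‖(1 - p) * (p * x - x * p)‖ ≤ ε / 4 :=
        (norm_mul_le _ _).trans (by nlinarith [hF1 x hx, norm_nonneg (p * x - x * p)])
      rw [e1]
      calc _ ≤ ‖p * x * p - c‖ + (‖(p * x - x * p) * (1 - p)‖ + ‖(1 - p) * (p * x - x * p)‖) :=
            (norm_add_le _ _).trans (by gcongr; exact norm_sub_le _ _)
        _ < ε := by linarith

end TracialAH

end

/-! ### Local frames, and quasitraces on elements supported in a frame. -/

noncomputable section

namespace TracialAH
open scoped Matrix.Norms.L2Operator

section PosSemidef

variable {n : Type*} [Fintype n] [DecidableEq n]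

theorem posSemidef_smul_one_sub {d : Matrix n n ℂ} (hd : dᴴ = d) {ε : ℝ} (h : ‖d‖ ≤ ε) :
    ((ε : ℂ) • (1 : Matrix n n ℂ) - d).PosSemidef := by
  let _ := CStarAlgebra.spectralOrder (Matrix n n ℂ)
  have _ := CStarAlgebra.spectralOrderedRing (Matrix n n ℂ)
  have h1 : d ≤ ε • (1 : Matrix n n ℂ) := by
    refine (IsSelfAdjoint.le_algebraMap_norm_self (a := d) hd).trans ?_
    rw [Algebra.algebraMap_eq_smul_one]
    exact smul_le_smul_of_nonneg_right h zero_le_one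
  obtain ⟨y, hy⟩ := CStarAlgebra.nonneg_iff_eq_star_mul_self.1 (sub_nonneg.2 h1)
  rw [Complex.coe_smul, hy]
  exact Matrix.posSemidef_conjTranspose_mul_self y

theorem spectrum_subset_of_norm_sub_one_le {G : Matrix n n ℂ} {δ : ℝ} (h : ‖G - 1‖ ≤ δ) {t : ℝ}
    (ht : t ∈ spectrum ℝ G) : 1 - δ ≤ t := by
  have h1 : t - 1 ∈ spectrum ℝ (G - 1) := by
    have h0 := spectrum.sub_singleton_eq (R := ℝ) G 1
    rw [map_one] at h0
    rw [← h0]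
    exact Set.sub_mem_sub ht rfl
  have h2 : ‖t - 1‖ ≤ ‖G - 1‖ * ‖(1 : Matrix n n ℂ)‖ := spectrum.norm_le_norm_mul_of_mem h1
  have h3 : ‖(1 : Matrix n n ℂ)‖ ≤ 1 := by
    rcases subsingleton_or_nontrivial (Matrix n n ℂ) with hn | hn
    · simp [Subsingleton.elim (1 : Matrix n n ℂ) 0]
    · exact CStarRing.norm_one.le
  have h4 : |t - 1| ≤ δ := by
    rw [Real.norm_eq_abs] at h2
    nlinarith [norm_nonneg (G - 1)]
  linarith [(abs_le.1 h4).1]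

end PosSemidef

section LocalFrame

variable {X : Type*} [TopologicalSpace X] [CompactSpace X] {r : ℕ}

/-- The range of `P` has an orthonormal frame `u` near each point. -/
theorem MatFun.exists_localFrame {P : MatFun X r} (hP : IsStarProjection P) (x₀ : X) {R : ℕ}
    (hR : (P x₀).rank = R) :
    ∃ (u : X → Matrix (Fin r) (Fin R) ℂ) (U : Set X), Continuous u ∧ IsOpen U ∧ x₀ ∈ U ∧
      (∀ x ∈ U, (u x)ᴴ * u x = 1) ∧ (∀ x, P x * u x = u x) ∧ u x₀ * (u x₀)ᴴ = P x₀ := by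
  have hPx : ∀ x, IsStarProjection (P x) := fun x =>
    ⟨congrArg (fun f : MatFun X r => f x) hP.isIdempotentElem.eq,
      congrArg (fun f : MatFun X r => f x) hP.isSelfAdjoint.star_eq⟩
  have hPP : ∀ x, P x * P x = P x := fun x => (hPx x).isIdempotentElem.eq
  have hPs : ∀ x, (P x)ᴴ = P x := fun x => (hPx x).isSelfAdjoint.star_eq
  obtain ⟨w, hw1, hw2⟩ := exists_frame (hPx x₀) hR
  -- The Gram matrix of the frame `P(x) w` transported from `x₀`; it is `1` at `x₀`. The frame
  -- sought is `P w G^(-1/2)`, where `G` is close to `1`.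
  let G : MatFun X R := MatFun.mk (fun x => wᴴ * P x * w) (by fun_prop)
  have hG : IsSelfAdjoint G := by
    ext1 x
    change (wᴴ * P x * w)ᴴ = wᴴ * P x * w
    simp only [Matrix.conjTranspose_mul, Matrix.conjTranspose_conjTranspose, hPs, Matrix.mul_assoc]
  -- The inverse square root, cut off at `1/2` to make it continuous everywhere. The cut-off is
  -- inactive on the spectrum of `G x` when `‖G x - 1‖ < 1/2`.
  let φ : ℝ → ℝ := fun t => (Real.sqrt (max t (1 / 2)))⁻¹
  have hmax : ∀ t : ℝ, 0 < max t (1 / 2) := fun t => lt_max_of_lt_right (by norm_num)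
  have hφ : Continuous φ := by
    refine Continuous.inv₀ (by fun_prop) fun t => (Real.sqrt_pos.2 (hmax t)).ne'
  let k : MatFun X R := cfc φ G
  have hk : ∀ x, k x = cfc φ (G x) := fun x => MatFun.eval_cfc x φ hφ hG
  have hGx : ∀ x, IsSelfAdjoint (G x) := fun x => congrArg (fun f : MatFun X R => f x) hG
  have hks : ∀ x, (k x)ᴴ = k x := fun x => by
    rw [hk]
    exact (cfc_predicate φ (G x) : IsSelfAdjoint _).star_eq
  have hG0 : G x₀ = 1 := by
    change wᴴ * P x₀ * w = 1
    rw [← hw2, Matrix.mul_assoc, Matrix.mul_assoc, hw1, Matrix.mul_one, hw1]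
  have hk0 : k x₀ = 1 := by
    rw [hk, hG0]
    have h1 : cfc φ (1 : Matrix (Fin R) (Fin R) ℂ) = algebraMap ℝ _ (φ 1) := by
      have := cfc_algebraMap (A := Matrix (Fin R) (Fin R) ℂ) (1 : ℝ) φ
      rwa [map_one] at this
    rw [h1]
    simp [φ, max_eq_left (show (2 : ℝ)⁻¹ ≤ 1 by norm_num)]
  have hu0 : P x₀ * w * k x₀ = w := by
    have h1 : (w * wᴴ) * w = w := by rw [Matrix.mul_assoc, hw1, Matrix.mul_one]
    rw [hk0, Matrix.mul_one]
    rwa [hw2] at h1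
  refine ⟨fun x => P x * w * k x, {x | ‖G x - 1‖ < 1 / 2}, by fun_prop,
    isOpen_lt (by fun_prop) continuous_const, ?_, fun x hx => ?_, fun x => ?_, ?_⟩
  · simp [hG0]
  · have e1 : (P x * w * k x)ᴴ * (P x * w * k x) = k x * G x * k x := by
      simp only [Matrix.conjTranspose_mul, hks, hPs]
      change _ = k x * (wᴴ * P x * w) * k x
      simp only [Matrix.mul_assoc]
      rw [← Matrix.mul_assoc (P x) (P x), hPP]
    rw [e1, hk, show cfc φ (G x) * G x * cfc φ (G x) =
      cfc φ (G x) * cfc (fun t => t) (G x) * cfc φ (G x) by rw [cfc_id' ℝ (G x) (hGx x)],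
      ← cfc_mul φ (fun t => t) _ hφ.continuousOn continuousOn_id,
      ← cfc_mul (fun t => φ t * t) φ _ (hφ.mul continuous_id).continuousOn hφ.continuousOn,
      ← cfc_one ℝ (G x) (hGx x)]
    refine cfc_congr fun t ht => ?_
    have h1 : 1 / 2 ≤ t := by
      have := spectrum_subset_of_norm_sub_one_le (le_of_lt hx) ht
      linarith
    simp only [φ, max_eq_left h1, Pi.one_apply]
    have h2 : 0 < t := by linarith
    have h3 := Real.mul_self_sqrt h2.le
    have h4 := (Real.sqrt_pos.2 h2).ne'
    field_simp
    rw [sq, h3]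
  · simp only [← Matrix.mul_assoc, hPP]
  · simp only [hu0, hw2]

end LocalFrame

section

variable {A : Type*} [CStarAlgebra A]

namespace HomogeneousSubalgebra

variable (H : HomogeneousSubalgebra A)

/-- Multiplication by a scalar function. -/
def scal (h : C(H.X, ℝ)) (b : MatFun H.X H.r) : MatFun H.X H.r :=
  MatFun.mk (fun x => (h x : ℂ) • b x) (by fun_prop)

@[simp] theorem scal_apply (h : C(H.X, ℝ)) (b : MatFun H.X H.r) (x : H.X) :
    H.scal h b x = (h x : ℂ) • b x := rfl

theorem scal_mem (h : C(H.X, ℝ)) {b : MatFun H.X H.r} (hb : b ∈ corner H.P H.isProj) :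
    H.scal h b ∈ corner H.P H.isProj := by
  rw [mem_corner_iff] at hb ⊢
  ext1 x
  have := congrArg (fun f : MatFun H.X H.r => f x) hb
  simp only [MatFun.mul_apply] at this
  simp [this]

theorem mem_corner_apply {b : MatFun H.X H.r} :
    b ∈ corner H.P H.isProj ↔ ∀ x, H.P x * b x * H.P x = b x :=
  ⟨fun h x => congrArg (fun f : MatFun H.X H.r => f x) h, fun h => MatFun.ext h⟩

/-- The element `h u W u*` given by a frame `u`. -/
def frameElt (h : C(H.X, ℝ)) {R : ℕ} {u : H.X → Matrix (Fin H.r) (Fin R) ℂ} (hu : Continuous u)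
    (W : Matrix (Fin R) (Fin R) ℂ) : MatFun H.X H.r :=
  MatFun.mk (fun x => (h x : ℂ) • (u x * W * (u x)ᴴ)) (by fun_prop)

theorem frameElt_mem (h : C(H.X, ℝ)) {R : ℕ} {u : H.X → Matrix (Fin H.r) (Fin R) ℂ}
    (hu : Continuous u) (hPu : ∀ x, H.P x * u x = u x) (W : Matrix (Fin R) (Fin R) ℂ) :
    H.frameElt h hu W ∈ corner H.P H.isProj := by
  rw [mem_corner_apply]
  intro x
  have h1 : (u x)ᴴ * H.P x = (u x)ᴴ := by
    have := congrArg Matrix.conjTranspose (hPu x)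
    have h2 : (H.P x)ᴴ = H.P x := (H.isProj_apply x).isSelfAdjoint.star_eq
    rwa [Matrix.conjTranspose_mul, h2] at this
  simp only [frameElt, MatFun.mk_apply, Matrix.mul_smul, Matrix.smul_mul]
  simp only [Matrix.mul_assoc, h1]
  rw [← Matrix.mul_assoc (H.P x), hPu]

theorem frameElt_posSemidef {h : C(H.X, ℝ)} (hh : ∀ x, 0 ≤ h x) {R : ℕ}
    {u : H.X → Matrix (Fin H.r) (Fin R) ℂ} (hu : Continuous u) {W : Matrix (Fin R) (Fin R) ℂ}
    (hW : W.PosSemidef) (x : H.X) : (H.frameElt h hu W x).PosSemidef :=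
  (hW.mul_mul_conjTranspose_same (u x)).smul (by exact_mod_cast hh x)

/-- The frame is isometric only on `U`; outside `U` both sides vanish because `h` does. So the frame
embeds a matrix algebra with scalar coefficient functions. -/
theorem frameElt_mul {h k l : C(H.X, ℝ)} {R : ℕ} {u : H.X → Matrix (Fin H.r) (Fin R) ℂ}
    (hu : Continuous u) {U : Set H.X} (huU : ∀ x ∈ U, (u x)ᴴ * u x = 1)
    (hU : ∀ x ∉ U, h x = 0) (hl : ∀ x, h x * k x = l x) (W Z : Matrix (Fin R) (Fin R) ℂ) :
    H.frameElt h hu W * H.frameElt k hu Z = H.frameElt l hu (W * Z) := by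
  ext1 x
  simp only [frameElt, MatFun.mul_apply, MatFun.mk_apply, Matrix.mul_smul, Matrix.smul_mul,
    smul_smul]
  rw [← hl x]
  by_cases hx : x ∈ U
  · push_cast
    rw [mul_comm (h x : ℂ)]
    congr 1
    calc _ = u x * W * ((u x)ᴴ * u x) * Z * (u x)ᴴ := by simp only [Matrix.mul_assoc]
      _ = _ := by rw [huU x hx, Matrix.mul_one]; simp only [Matrix.mul_assoc]
  · simp [hU x hx]

theorem frameElt_star (h : C(H.X, ℝ)) {R : ℕ} {u : H.X → Matrix (Fin H.r) (Fin R) ℂ}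
    (hu : Continuous u) (W : Matrix (Fin R) (Fin R) ℂ) :
    star (H.frameElt h hu W) = H.frameElt h hu Wᴴ := by
  ext1 x
  simp only [frameElt, MatFun.star_apply, MatFun.mk_apply, Matrix.conjTranspose_smul,
    Matrix.conjTranspose_mul, Matrix.conjTranspose_conjTranspose, Matrix.mul_assoc]
  simp

theorem frameElt_sum (h : C(H.X, ℝ)) {R : ℕ} {u : H.X → Matrix (Fin H.r) (Fin R) ℂ}
    (hu : Continuous u) {ι : Type*} (s : Finset ι) (W : ι → Matrix (Fin R) (Fin R) ℂ) :
    H.frameElt h hu (∑ i ∈ s, W i) = ∑ i ∈ s, H.frameElt h hu (W i) := by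
  let f : Matrix (Fin R) (Fin R) ℂ →+ MatFun H.X H.r :=
    { toFun := H.frameElt h hu
      map_zero' := by ext1 x; simp [frameElt]
      map_add' := fun a b => by ext1 x; simp [frameElt, Matrix.mul_add, Matrix.add_mul] }
  exact map_sum f W s

theorem frameElt_smul (h : C(H.X, ℝ)) {R : ℕ} {u : H.X → Matrix (Fin H.r) (Fin R) ℂ}
    (hu : Continuous u) (c : ℝ) (W : Matrix (Fin R) (Fin R) ℂ) :
    H.frameElt h hu (c • W) = (c : ℂ) • H.frameElt h hu W := by
  ext1 x
  simp only [frameElt, MatFun.smul_apply, MatFun.mk_apply, Matrix.mul_smul, Matrix.smul_mul]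
  rw [smul_comm]
  rfl

end HomogeneousSubalgebra

end

section Quasitrace

variable {A : Type*} [CStarAlgebra A] [PartialOrder A] [StarOrderedRing A]

namespace HomogeneousSubalgebra

variable (H : HomogeneousSubalgebra A)

theorem toAlg_nonneg {b : MatFun H.X H.r} (hb : b ∈ corner H.P H.isProj)
    (hpos : ∀ x, (b x).PosSemidef) : 0 ≤ H.toAlg b := by
  obtain ⟨y, hy, hys, rfl⟩ := MatFun.exists_sqrt hb hpos
  rw [H.toAlg_mul hy hy]
  nth_rewrite 1 [← hys]
  rw [H.toAlg_star]
  exact star_mul_self_nonneg _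

theorem toAlg_mono {b c : MatFun H.X H.r} (hb : b ∈ corner H.P H.isProj)
    (hc : c ∈ corner H.P H.isProj) (h : ∀ x, (c x - b x).PosSemidef) :
    H.toAlg b ≤ H.toAlg c := by
  rw [← sub_nonneg, ← map_sub]
  exact H.toAlg_nonneg (sub_mem hc hb) h

/-- On the elements `h u W u*` a quasitrace is a multiple of the trace of `W`. -/
theorem posExt_frameElt {τ : posCone A → ℝ} (hτ : IsOneQuasitrace τ) {h : C(H.X, ℝ)}
    (hh : ∀ x, 0 ≤ h x) {R : ℕ} [NeZero R] {u : H.X → Matrix (Fin H.r) (Fin R) ℂ}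
    (hu : Continuous u) (hPu : ∀ x, H.P x * u x = u x) {U : Set H.X}
    (huU : ∀ x ∈ U, (u x)ᴴ * u x = 1) (hU : ∀ x ∉ U, h x = 0) {W : Matrix (Fin R) (Fin R) ℂ}
    (hW : W.PosSemidef) :
    posExt τ (H.toAlg (H.frameElt h hu W)) =
      posExt τ (H.toAlg (H.frameElt h hu (Matrix.single 0 0 1))) * W.trace.re := by
  have hH := hW.isHermitian
  set V : Matrix (Fin R) (Fin R) ℂ := (hH.eigenvectorUnitary : Matrix (Fin R) (Fin R) ℂ) with hV
  have hV1 : Vᴴ * V = 1 := Unitary.coe_star_mul_self hH.eigenvectorUnitary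
  let E : Fin R → Matrix (Fin R) (Fin R) ℂ := fun i => V * Matrix.single i i 1 * Vᴴ
  have hspec : W = ∑ i, hH.eigenvalues i • E i := by
    have h1 : W = V * Matrix.diagonal (fun i => (hH.eigenvalues i : ℂ)) * Vᴴ := hH.spectral_theorem
    have h2 : Matrix.diagonal (fun i => (hH.eigenvalues i : ℂ)) =
        ∑ i, hH.eigenvalues i • Matrix.single i i (1 : ℂ) := by
      ext a b
      rw [Matrix.sum_apply, Matrix.diagonal_apply]
      simp only [Matrix.smul_apply, Matrix.single_apply]
      by_cases hab : a = b
      · subst hab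
        simp
      · rw [if_neg hab, Finset.sum_eq_zero]
        intro i _
        rw [if_neg (fun h => hab (h.1.symm.trans h.2)), smul_zero]
    conv_lhs => rw [h1, h2]
    simp only [Matrix.mul_sum, Matrix.sum_mul, E, Matrix.mul_smul, Matrix.smul_mul]
  -- The square root makes `y* y` and `y y*` carry the coefficient `h`, when `y` is the frame
  -- element of `g` and a matrix.
  let g : C(H.X, ℝ) := ⟨fun x => Real.sqrt (h x), by fun_prop⟩
  have hg : ∀ x, g x * g x = h x := fun x => Real.mul_self_sqrt (hh x)
  have hgU : ∀ x ∉ U, g x = 0 := fun x hx => by simp [g, hU x hx]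
  let h2 : C(H.X, ℝ) := h * h
  have hEE : ∀ i j, E i * E j = V * (Matrix.single i i 1 * Matrix.single j j 1) * Vᴴ := by
    intro i j
    calc E i * E j = V * Matrix.single i i 1 * (Vᴴ * V) * Matrix.single j j 1 * Vᴴ := by
          simp only [E, Matrix.mul_assoc]
      _ = _ := by rw [hV1, Matrix.mul_one]; simp only [Matrix.mul_assoc]
  have hsingle : ∀ i, (Matrix.single i i (1 : ℂ) : Matrix (Fin R) (Fin R) ℂ).PosSemidef := by
    intro i
    have := Matrix.posSemidef_conjTranspose_mul_self
      (Matrix.single i i (1 : ℂ) : Matrix (Fin R) (Fin R) ℂ)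
    simpa using this
  have hE : ∀ i, (E i).PosSemidef := fun i => (hsingle i).mul_mul_conjTranspose_same V
  have hmem : ∀ (k : C(H.X, ℝ)) (Z : Matrix (Fin R) (Fin R) ℂ),
    H.frameElt k hu Z ∈ corner H.P H.isProj := fun k Z => H.frameElt_mem k hu hPu Z
  -- Any two rank-one projections are `z* z` and `z z*` for a single matrix `z`, so `τ` takes the
  -- same value on both. With the spectral decomposition of `W`, whose terms are orthogonal, this
  -- leaves only the trace of `W`.
  have hval : ∀ i, posExt τ (H.toAlg (H.frameElt h hu (E i))) =
      posExt τ (H.toAlg (H.frameElt h hu (Matrix.single 0 0 1))) := by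
    intro i
    have h3 := hτ.posExt_star_mul (H.toAlg (H.frameElt g hu (Matrix.single 0 i 1 * Vᴴ)))
    rw [← H.toAlg_star, ← H.toAlg_mul (star_mem (hmem _ _)) (hmem _ _),
      ← H.toAlg_mul (hmem _ _) (star_mem (hmem _ _)), H.frameElt_star,
      H.frameElt_mul hu huU hgU hg, H.frameElt_mul hu huU hgU hg] at h3
    have e1 : (Matrix.single 0 i 1 * Vᴴ)ᴴ * (Matrix.single 0 i 1 * Vᴴ) = E i := by
      rw [Matrix.conjTranspose_mul, Matrix.conjTranspose_conjTranspose,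
        Matrix.conjTranspose_single]
      calc _ = V * (Matrix.single i 0 (star 1) * Matrix.single 0 i 1) * Vᴴ := by
            simp only [Matrix.mul_assoc]
        _ = _ := by simp [E]
    have e2 : (Matrix.single 0 i 1 * Vᴴ) * (Matrix.single 0 i 1 * Vᴴ)ᴴ =
        (Matrix.single 0 0 1 : Matrix (Fin R) (Fin R) ℂ) := by
      rw [Matrix.conjTranspose_mul, Matrix.conjTranspose_conjTranspose,
        Matrix.conjTranspose_single]
      calc _ = Matrix.single 0 i 1 * (Vᴴ * V) * Matrix.single i 0 (star 1) := by
            simp only [Matrix.mul_assoc]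
        _ = _ := by simp [hV1]
    rwa [e1, e2] at h3
  have hnn : ∀ i, 0 ≤ H.toAlg (H.frameElt h hu (E i)) := fun i =>
    H.toAlg_nonneg (hmem _ _) fun x => H.frameElt_posSemidef hh hu (hE i) x
  conv_lhs => rw [hspec]
  have h5 : ∀ i, H.toAlg (H.frameElt h hu (hH.eigenvalues i • E i)) =
      hH.eigenvalues i • H.toAlg (H.frameElt h hu (E i)) := fun i => by
    rw [frameElt_smul, map_smul, Complex.coe_smul]
  rw [frameElt_sum, map_sum, Finset.sum_congr rfl fun i _ => h5 i, hτ.posExt_sum]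
  · have h4 : ∀ i, posExt τ (hH.eigenvalues i • H.toAlg (H.frameElt h hu (E i))) =
        hH.eigenvalues i * posExt τ (H.toAlg (H.frameElt h hu (Matrix.single 0 0 1))) := by
      intro i
      rw [hτ.posExt_smul (hW.eigenvalues_nonneg i) (hnn i), hval]
    rw [Finset.sum_congr rfl fun i _ => h4 i, ← Finset.sum_mul, mul_comm,
      hH.trace_eq_sum_eigenvalues]
    simp
  · exact fun i _ => smul_nonneg (hW.eigenvalues_nonneg i) (hnn i)
  · intro i _ j _ hij
    refine (Commute.smul_left ?_ _).smul_right _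
    have key : ∀ i j, i ≠ j → H.toAlg (H.frameElt h hu (E i)) * H.toAlg (H.frameElt h hu (E j)) = 0 := by
      intro i j hij
      rw [← H.toAlg_mul (hmem _ _) (hmem _ _), H.frameElt_mul (l := h2) hu huU hU (fun x => rfl),
        hEE, Matrix.single_mul_single_of_ne _ _ _ _ hij]
      have : H.frameElt h2 hu (V * 0 * Vᴴ) = 0 := by
        ext1 x
        simp [frameElt]
      rw [this, map_zero]
    rw [commute_iff_eq, key i j hij, key j i hij.symm]

end HomogeneousSubalgebra

end Quasitrace

end TracialAH

end

/-! ### A quasitrace is additive on `P M_r(C(X)) P`. -/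

noncomputable section

namespace TracialAH
open scoped Matrix.Norms.L2Operator

/-- The indices are points of `X`, so that data chosen at each point can be carried along with the
partition. -/
theorem exists_finite_partition {X : Type*} [TopologicalSpace X] [CompactSpace X] [T2Space X]
    (V : X → Set X) (hV : ∀ x, IsOpen (V x)) (hx : ∀ x, x ∈ V x) :
    ∃ (t : Finset X) (h : t → C(X, ℝ)), (∀ i x, 0 ≤ h i x) ∧ (∀ x, ∑ i, h i x = 1) ∧
      ∀ (i : t), ∀ x ∉ V i, h i x = 0 := by
  obtain ⟨t, ht⟩ := isCompact_univ.elim_finite_subcover V hV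
    fun x _ => Set.mem_iUnion.2 ⟨x, hx x⟩
  obtain ⟨f, hf⟩ := PartitionOfUnity.exists_isSubordinate isClosed_univ (fun i : t => V i)
    (fun i => hV i) (by
      intro x hx
      obtain ⟨i, hi, hxi⟩ := Set.mem_iUnion₂.1 (ht hx)
      exact Set.mem_iUnion.2 ⟨⟨i, hi⟩, hxi⟩)
  refine ⟨t, fun i => f i, fun i x => f.nonneg i x, fun x => ?_, fun i x hxV => ?_⟩
  · rw [← finsum_eq_sum_of_fintype]
    exact f.sum_eq_one (Set.mem_univ x)
  · by_contra h
    exact hxV (hf i (subset_tsupport _ h))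

namespace HomogeneousSubalgebra

variable {A : Type*} [CStarAlgebra A] (H : HomogeneousSubalgebra A)

theorem toAlg_commute_scal (h k : C(H.X, ℝ)) {b : MatFun H.X H.r}
    (hb : b ∈ corner H.P H.isProj) :
    Commute (H.toAlg (H.scal h b)) (H.toAlg (H.scal k b)) := by
  rw [commute_iff_eq, ← H.toAlg_mul (H.scal_mem h hb) (H.scal_mem k hb),
    ← H.toAlg_mul (H.scal_mem k hb) (H.scal_mem h hb)]
  congr 1
  ext1 x
  simp only [MatFun.mul_apply, scal_apply, Matrix.smul_mul, Matrix.mul_smul]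
  rw [smul_comm]

theorem toAlg_commute_scal_unit (h k : C(H.X, ℝ)) {b : MatFun H.X H.r}
    (hb : b ∈ corner H.P H.isProj) :
    Commute (H.toAlg (H.scal h b)) (H.toAlg (H.scal k H.P)) := by
  rw [commute_iff_eq, ← H.toAlg_mul (H.scal_mem h hb) (H.scal_mem k self_mem_corner),
    ← H.toAlg_mul (H.scal_mem k self_mem_corner) (H.scal_mem h hb)]
  congr 1
  ext1 x
  have h1 : b x * H.P x = b x := congrArg (fun f : MatFun H.X H.r => f x) (mem_corner_iff'.1 hb).2
  have h2 : H.P x * b x = b x := congrArg (fun f : MatFun H.X H.r => f x) (mem_corner_iff'.1 hb).1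
  simp only [MatFun.mul_apply, scal_apply, Matrix.smul_mul, Matrix.mul_smul, h1, h2]
  rw [smul_comm]

theorem P_posSemidef (x : H.X) : (H.P x).PosSemidef := by
  have h := Matrix.posSemidef_conjTranspose_mul_self (H.P x)
  have h1 : (H.P x)ᴴ = H.P x := (H.isProj_apply x).isSelfAdjoint.star_eq
  rwa [h1, (H.isProj_apply x).isIdempotentElem.eq] at h

theorem scal_one (b : MatFun H.X H.r) : H.scal 1 b = b := by
  ext1 x
  simp

theorem scal_posSemidef {h : C(H.X, ℝ)} (hh : ∀ x, 0 ≤ h x) {b : MatFun H.X H.r}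
    (hpos : ∀ x, (b x).PosSemidef) (x : H.X) : (H.scal h b x).PosSemidef :=
  (hpos x).smul (by exact_mod_cast hh x)

variable [PartialOrder A] [StarOrderedRing A] {τ : posCone A → ℝ} (hτ : IsOneQuasitrace τ)

include hτ in
-- Multiples of one element by scalar functions commute with one another, so the quasitrace is
-- additive on the pieces.
theorem posExt_eq_sum_scal {ι : Type*} [Fintype ι] {h : ι → C(H.X, ℝ)} (hh : ∀ i x, 0 ≤ h i x)
    (hsum : ∀ x, ∑ i, h i x = 1) {b : MatFun H.X H.r} (hb : b ∈ corner H.P H.isProj)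
    (hpos : ∀ x, (b x).PosSemidef) :
    posExt τ (H.toAlg b) = ∑ i, posExt τ (H.toAlg (H.scal (h i) b)) := by
  rw [← hτ.posExt_sum]
  · rw [← map_sum]
    congr 2
    ext1 x
    have h1 : (∑ i, H.scal (h i) b) x = ∑ i, H.scal (h i) b x :=
      map_sum (MatFun.eval x) _ _
    rw [h1]
    simp only [scal_apply]
    rw [← Finset.sum_smul, ← Complex.ofReal_sum, hsum]
    simp
  · exact fun i _ => H.toAlg_nonneg (H.scal_mem _ hb) (H.scal_posSemidef (hh i) hpos)
  · exact fun i _ j _ _ => H.toAlg_commute_scal _ _ hb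

include hτ in
-- The error term `h P` is central in the subalgebra, so after monotonicity the quasitrace splits.
-- Since the error is weighted by `h`, summing over a partition of unity gives only `ε τ(p)`,
-- however many pieces there are.
theorem posExt_le_of_sub_le {b c : MatFun H.X H.r} (hb : b ∈ corner H.P H.isProj)
    (hc : c ∈ corner H.P H.isProj) (hbp : ∀ x, (b x).PosSemidef) (hcp : ∀ x, (c x).PosSemidef)
    {h : C(H.X, ℝ)} (hh : ∀ x, 0 ≤ h x) {ε : ℝ} (hε : 0 ≤ ε)
    (hbc : ∀ x, (c x + (h x : ℂ) • (ε : ℂ) • H.P x - b x).PosSemidef) :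
    posExt τ (H.toAlg b) ≤ posExt τ (H.toAlg c) + ε * posExt τ (H.toAlg (H.scal h H.P)) := by
  have hP0 : 0 ≤ H.toAlg (H.scal h H.P) :=
    H.toAlg_nonneg (H.scal_mem _ self_mem_corner) (H.scal_posSemidef hh H.P_posSemidef)
  have h1 : H.toAlg b ≤ H.toAlg c + ε • H.toAlg (H.scal h H.P) := by
    rw [← Complex.coe_smul, ← map_smul, ← map_add]
    refine H.toAlg_mono hb (add_mem hc (SMulMemClass.smul_mem _ (H.scal_mem _ self_mem_corner)))
      fun x => ?_
    have := hbc x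
    rwa [smul_comm] at this
  have hcomm : Commute (H.toAlg c) (ε • H.toAlg (H.scal h H.P)) := by
    have := H.toAlg_commute_scal_unit 1 h hc
    rw [H.scal_one] at this
    exact this.smul_right ε
  refine (hτ.posExt_mono (H.toAlg_nonneg hb hbp) h1).trans ?_
  rw [hτ.posExt_add (H.toAlg_nonneg hc hcp) (smul_nonneg hε hP0) hcomm, hτ.posExt_smul hε hP0]

include hτ in
/-- On finitely many positive elements of `P M_r(C(X)) P` a quasitrace is almost equal to an
additive function. -/
theorem exists_additive_approx (F : Finset (MatFun H.X H.r))
    (hF : ∀ c ∈ F, c ∈ corner H.P H.isProj ∧ ∀ x, (c x).PosSemidef) {ε : ℝ} (hε : 0 < ε) :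
    ∃ L : MatFun H.X H.r →+ ℝ, ∀ c ∈ F,
      |posExt τ (H.toAlg c) - L c| ≤ ε * posExt τ H.unit := by
  have hfr := fun x₀ : H.X => MatFun.exists_localFrame H.isProj x₀ rfl
  choose u U hu hUo hxU huU hPu huP using hfr
  -- Near `x₀` every `c ∈ F` is within `ε` of the frame element with the constant matrix `u(x₀)*
  -- c(x₀) u(x₀)`.
  let V : H.X → Set H.X := fun x₀ => U x₀ ∩ ⋂ c ∈ F,
    {x | ‖c x - u x₀ x * ((u x₀ x₀)ᴴ * c x₀ * u x₀ x₀) * (u x₀ x)ᴴ‖ < ε}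
  have hV : ∀ x, IsOpen (V x) := by
    intro x₀
    refine (hUo x₀).inter (isOpen_biInter_finset fun c _ => ?_)
    have hu0 := hu x₀
    exact isOpen_lt (by fun_prop) continuous_const
  have hxV : ∀ x, x ∈ V x := by
    intro x
    refine ⟨hxU x, Set.mem_iInter₂.2 fun c hc => ?_⟩
    have h1 : u x x * ((u x x)ᴴ * c x * u x x) * (u x x)ᴴ = c x := by
      calc _ = (u x x * (u x x)ᴴ) * c x * (u x x * (u x x)ᴴ) := by simp only [Matrix.mul_assoc]
        _ = c x := by rw [huP]; exact H.mem_corner_apply.1 (hF c hc).1 x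
    simp only [Set.mem_ofPred_eq, h1, sub_self, norm_zero]
    exact hε
  obtain ⟨t, h, hh, hsum, hsupp⟩ := exists_finite_partition V hV hxV
  have hne : ∀ x, NeZero (H.P x).rank := fun x => ⟨(H.rank_pos x).ne'⟩
  let κ : t → ℝ := fun i => posExt τ (H.toAlg (H.frameElt (h i) (hu i)
    (Matrix.single ⟨0, H.rank_pos i⟩ ⟨0, H.rank_pos i⟩ 1)))
  -- On each frame element `τ` is `κ i` times a trace, which is additive in `c`; this is where
  -- additivity comes from.
  let L : MatFun H.X H.r →+ ℝ :=
    { toFun := fun c => ∑ i : t, κ i * (Matrix.trace ((u i i)ᴴ * c i * u i i)).re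
      map_zero' := by simp
      map_add' := fun a b => by
        simp [Matrix.mul_add, Matrix.add_mul, mul_add, Finset.sum_add_distrib] }
  refine ⟨L, fun c hc => ?_⟩
  obtain ⟨hcm, hcp⟩ := hF c hc
  have hunit : posExt τ H.unit = ∑ i, posExt τ (H.toAlg (H.scal (h i) H.P)) :=
    H.posExt_eq_sum_scal hτ hh hsum self_mem_corner H.P_posSemidef
  have key : ∀ i : t, |posExt τ (H.toAlg (H.scal (h i) c)) -
      κ i * (Matrix.trace ((u i i)ᴴ * c i * u i i)).re| ≤
      ε * posExt τ (H.toAlg (H.scal (h i) H.P)) := by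
    intro i
    have hW : ((u i i)ᴴ * c i * u i i).PosSemidef := (hcp i).conjTranspose_mul_mul_same (u i i)
    have hU : ∀ x ∉ U i, h i x = 0 := fun x hx => hsupp i x fun hxV => hx hxV.1
    have h1 := H.posExt_frameElt hτ (hh i) (hu i) (hPu i) (huU i) hU hW
    have h2 : posExt τ (H.toAlg (H.frameElt (h i) (hu i) ((u i i)ᴴ * c i * u i i))) =
      κ i * (Matrix.trace ((u i i)ᴴ * c i * u i i)).re := h1
    rw [← h2]
    have hfm := H.frameElt_mem (h i) (hu i) (hPu i) ((u i i)ᴴ * c i * u i i)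
    have hfp := H.frameElt_posSemidef (hh i) (hu i) hW
    have hPs : ∀ x, (H.P x)ᴴ = H.P x := fun x => (H.isProj_apply x).isSelfAdjoint.star_eq
    -- Inside the corner a norm bound `‖d‖ ≤ ε` improves to `d ≤ ε P` instead of `d ≤ ε 1`.
    have hest : ∀ (x : H.X) (d : Matrix (Fin H.r) (Fin H.r) ℂ), dᴴ = d → ‖d‖ ≤ ε →
        H.P x * d * H.P x = d → ((ε : ℂ) • H.P x - d).PosSemidef := by
      intro x d hd hn hPd
      have := (posSemidef_smul_one_sub hd hn).mul_mul_conjTranspose_same (H.P x)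
      rwa [hPs, Matrix.mul_sub, Matrix.sub_mul, hPd, Matrix.mul_smul, Matrix.smul_mul,
        Matrix.mul_one, (H.isProj_apply x).isIdempotentElem.eq] at this
    have hd0 : ∀ x, h i x ≠ 0 →
        ‖c x - u i x * ((u i i)ᴴ * c i * u i i) * (u i x)ᴴ‖ ≤ ε := by
      intro x hx
      have hxV : x ∈ V i := by
        by_contra hxV
        exact hx (hsupp i x hxV)
      exact (Set.mem_iInter₂.1 hxV.2 c hc).le
    have hdP : ∀ x, H.P x * (c x - u i x * ((u i i)ᴴ * c i * u i i) * (u i x)ᴴ) * H.P x =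
        c x - u i x * ((u i i)ᴴ * c i * u i i) * (u i x)ᴴ := by
      intro x
      have h3 := H.mem_corner_apply.1 (H.frameElt_mem 1 (hu i) (hPu i) ((u i i)ᴴ * c i * u i i)) x
      simp only [frameElt, MatFun.mk_apply, ContinuousMap.one_apply, Complex.ofReal_one,
        one_smul] at h3
      rw [Matrix.mul_sub, Matrix.sub_mul, h3, H.mem_corner_apply.1 hcm x]
    have hds : ∀ x, (c x - u i x * ((u i i)ᴴ * c i * u i i) * (u i x)ᴴ)ᴴ =
        c x - u i x * ((u i i)ᴴ * c i * u i i) * (u i x)ᴴ := by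
      intro x
      rw [Matrix.conjTranspose_sub, (hcp x).1, (hW.mul_mul_conjTranspose_same (u i x)).1]
    rw [abs_sub_le_iff]
    constructor
    · rw [sub_le_iff_le_add']
      refine H.posExt_le_of_sub_le hτ (H.scal_mem _ hcm) hfm (H.scal_posSemidef (hh i) hcp) hfp
        (hh i) hε.le fun x => ?_
      by_cases hx : h i x = 0
      · simpa [frameElt, hx] using Matrix.PosSemidef.zero
      · have h4 := (hest x _ (hds x) (hd0 x hx) (hdP x)).smul
          (show (0 : ℂ) ≤ (h i x : ℂ) by exact_mod_cast hh i x)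
        convert h4 using 1
        simp only [frameElt, MatFun.mk_apply, scal_apply, smul_sub]
        abel
    · rw [sub_le_iff_le_add']
      refine H.posExt_le_of_sub_le hτ hfm (H.scal_mem _ hcm) hfp (H.scal_posSemidef (hh i) hcp)
        (hh i) hε.le fun x => ?_
      by_cases hx : h i x = 0
      · simpa [frameElt, hx] using Matrix.PosSemidef.zero
      · have h4 := (hest x (-(c x - u i x * ((u i i)ᴴ * c i * u i i) * (u i x)ᴴ))
          (by rw [Matrix.conjTranspose_neg, hds]) (by rw [norm_neg]; exact hd0 x hx)
          (by rw [Matrix.mul_neg, Matrix.neg_mul, hdP])).smul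
          (show (0 : ℂ) ≤ (h i x : ℂ) by exact_mod_cast hh i x)
        convert h4 using 1
        simp only [frameElt, MatFun.mk_apply, scal_apply, smul_sub, smul_neg]
        abel
  rw [H.posExt_eq_sum_scal hτ hh hsum hcm hcp, hunit, Finset.mul_sum]
  change |_ - ∑ i : t, κ i * (Matrix.trace ((u i i)ᴴ * c i * u i i)).re| ≤ _
  rw [← Finset.sum_sub_distrib]
  exact (Finset.abs_sum_le_sum_abs _ _).trans (Finset.sum_le_sum fun i _ => key i)

include hτ in
/-- A quasitrace is additive on `P M_r(C(X)) P`. -/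
theorem posExt_toAlg_add {a b : MatFun H.X H.r} (ha : a ∈ corner H.P H.isProj)
    (hb : b ∈ corner H.P H.isProj) (hap : ∀ x, (a x).PosSemidef)
    (hbp : ∀ x, (b x).PosSemidef) :
    posExt τ (H.toAlg (a + b)) = posExt τ (H.toAlg a) + posExt τ (H.toAlg b) := by
  classical
  have h0 := hτ.posExt_nonneg H.unit
  refine eq_of_abs_sub_le_all fun δ hδ => ?_
  -- One additive function approximates `τ` at `a`, `b` and `a + b` simultaneously, with error `δ/3`
  -- each. The summand `1` in the denominator guards against `τ(p) = 0`.
  obtain ⟨L, hL⟩ := H.exists_additive_approx hτ {a, b, a + b} (by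
    intro c hc
    simp only [Finset.mem_insert, Finset.mem_singleton] at hc
    rcases hc with rfl | rfl | rfl
    exacts [⟨ha, hap⟩, ⟨hb, hbp⟩, ⟨add_mem ha hb, fun x => (hap x).add (hbp x)⟩])
    (show 0 < δ / (3 * (posExt τ H.unit + 1)) by positivity)
  have h1 := abs_le.1 (hL a (by simp))
  have h2 := abs_le.1 (hL b (by simp))
  have h3 := abs_le.1 (hL (a + b) (by simp))
  rw [map_add L] at h3
  have h4 : δ / (3 * (posExt τ H.unit + 1)) * posExt τ H.unit ≤ δ / 3 := by
    rw [div_mul_eq_mul_div, div_le_div_iff₀ (by positivity) (by norm_num)]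
    nlinarith
  rw [abs_le]
  constructor <;> linarith [h1.1, h1.2, h2.1, h2.2, h3.1, h3.2]

end HomogeneousSubalgebra

end TracialAH

end

/-! ### A quasitrace is additive on `A`. -/

noncomputable section

namespace TracialAH
open scoped Matrix.Norms.L2Operator

theorem mul_eq_self_of_star_mul_self {A : Type*} [CStarAlgebra A] {q v : A}
    (hq : IsStarProjection q) (h : star v * v = q) : v * q = v := by
  have h1 : star (v * q - v) * (v * q - v) = 0 := by
    rw [star_sub, star_mul, hq.isSelfAdjoint.star_eq, sub_mul, mul_sub, mul_sub]
    have e1 : q * star v * (v * q) = q * (star v * v) * q := by simp only [mul_assoc]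
    have e2 : q * star v * v = q * (star v * v) := by simp only [mul_assoc]
    have e3 : star v * (v * q) = (star v * v) * q := by simp only [mul_assoc]
    rw [e1, e2, e3, h, hq.isIdempotentElem.eq, hq.isIdempotentElem.eq]
    simp
  exact sub_eq_zero.1 (CStarRing.star_mul_self_eq_zero_iff _ |>.1 h1)

theorem isStarProjection_mul_star {A : Type*} [CStarAlgebra A] {q v : A}
    (hq : IsStarProjection q) (h : star v * v = q) : IsStarProjection (v * star v) where
  isIdempotentElem := by
    unfold IsIdempotentElem
    calc v * star v * (v * star v) = v * (star v * v) * star v := by simp only [mul_assoc]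
      _ = _ := by rw [h, mul_eq_self_of_star_mul_self hq h]
  isSelfAdjoint := IsSelfAdjoint.mul_star_self v

theorem mul_star_mul_mul_star_eq_zero {A : Type*} [Ring A] [StarRing A] {v w : A} (h : star v * w = 0) :
    v * star v * (w * star w) = 0 := by
  calc v * star v * (w * star w) = v * (star v * w) * star w := by simp only [mul_assoc]
    _ = 0 := by rw [h]; simp

theorem isStarProjection_sum {A : Type*} [Ring A] [StarRing A] {ι : Type*} (s : Finset ι) {f : ι → A}
    (hf : ∀ i ∈ s, IsStarProjection (f i)) (h : ∀ i ∈ s, ∀ j ∈ s, i ≠ j → f i * f j = 0) :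
    IsStarProjection (∑ i ∈ s, f i) := by
  classical
  induction s using Finset.induction_on with
  | empty => simp
  | insert i s hi ih =>
    rw [Finset.sum_insert hi]
    refine (hf i (by simp)).add (ih (fun j hj => hf j (by simp [hj])) fun j hj k hk =>
      h j (by simp [hj]) k (by simp [hk])) ?_
    rw [Finset.mul_sum, Finset.sum_eq_zero]
    exact fun j hj => h i (by simp) j (by simp [hj]) (by rintro rfl; exact hi hj)

/-- Because `p` commutes with `x`, the element `p x* x` is `(p x)* (p x)`. Thus it comes from some
`c* c`, which is pointwise positive. -/
theorem HomogeneousSubalgebra.exists_of_star_mul_self_cut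
    {A : Type*} [CStarAlgebra A]
    (H : HomogeneousSubalgebra A) {x : A} (hx : x ∈ H.cut) :
    ∃ b ∈ corner H.P H.isProj, (∀ ξ, (b ξ).PosSemidef) ∧ H.toAlg b = H.unit * (star x * x) := by
  obtain ⟨hx1, c, hc, hcx⟩ := hx
  have hu := H.isStarProjection
  refine ⟨star c * c, mul_mem (star_mem hc) hc,
    fun ξ => Matrix.posSemidef_conjTranspose_mul_self (c ξ), ?_⟩
  rw [H.toAlg_mul (star_mem hc) hc, H.toAlg_star, hcx, StarMul.star_mul, hu.isSelfAdjoint.star_eq]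
  have h1 : star x * H.unit = H.unit * star x := by
    have := congrArg star hx1
    rwa [StarMul.star_mul, StarMul.star_mul, hu.isSelfAdjoint.star_eq] at this
  calc star x * H.unit * (H.unit * x) = star x * (H.unit * H.unit) * x := by simp only [mul_assoc]
    _ = _ := by rw [hu.isIdempotentElem.eq, h1, mul_assoc]

namespace IsOneQuasitrace

variable {A : Type*} [CStarAlgebra A] [PartialOrder A] [StarOrderedRing A]
  {τ : posCone A → ℝ} (hτ : IsOneQuasitrace τ)

include hτ

/-- The projections `v i (v i)*` are orthogonal, all have the value `τ(q)`, and add up to a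
projection below `1`. -/
theorem nsmul_posExt_le {q : A} (hq : IsStarProjection q) {m : ℕ} {v : Fin m → A}
    (hv : ∀ i, star (v i) * v i = q) (hvv : ∀ i j, i ≠ j → star (v i) * v j = 0) :
    m * posExt τ q ≤ posExt τ (1 : A) := by
  have h0 : ∀ i j, i ≠ j → v i * star (v i) * (v j * star (v j)) = 0 := fun i j hij =>
    mul_star_mul_mul_star_eq_zero (hvv i j hij)
  have h1 : posExt τ (∑ i, v i * star (v i)) = m * posExt τ q := by
    rw [hτ.posExt_sum _ _ (fun i _ => mul_star_self_nonneg _)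
      (fun i _ j _ hij => by rw [commute_iff_eq, h0 i j hij, h0 j i hij.symm])]
    simp_rw [← hτ.posExt_star_mul, hv]
    simp
  rw [← h1]
  have h2 : IsStarProjection (∑ i, v i * star (v i)) :=
    isStarProjection_sum _ (fun i _ => isStarProjection_mul_star hq (hv i))
      fun i _ j _ hij => h0 i j hij
  exact hτ.posExt_mono h2.nonneg (by simpa using h2.one_sub.nonneg)

/-- The summands in `d = p d + (1-p) d` commute, and `(1-p) d ≤ ‖d‖ (1-p)`. -/
theorem abs_posExt_sub_le {p d : A} (hp : IsStarProjection p) (hd : 0 ≤ d) (h : p * d = d * p) :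
    |posExt τ d - posExt τ (p * d)| ≤ ‖d‖ * posExt τ (1 - p) := by
  have hpd : ∀ q : A, IsStarProjection q → q * d = d * q → q * d = star q * d * q := by
    intro q hq h
    rw [hq.isSelfAdjoint.star_eq, h, mul_assoc, hq.isIdempotentElem.eq]
  have h1 : 0 ≤ p * d := by
    rw [hpd p hp h]
    exact star_left_conjugate_nonneg hd p
  have hq := hp.one_sub
  have hqd : (1 - p) * d = d * (1 - p) := by rw [sub_mul, mul_sub, h, one_mul, mul_one]
  have h2 : 0 ≤ (1 - p) * d := by
    rw [hpd _ hq hqd]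
    exact star_left_conjugate_nonneg hd _
  have h3 : (1 - p) * d ≤ ‖d‖ • (1 - p) := by
    have h4 : d ≤ ‖d‖ • (1 : A) := by
      rw [← Algebra.algebraMap_eq_smul_one]
      exact IsSelfAdjoint.le_algebraMap_norm_self
    have h5 := star_left_conjugate_le_conjugate h4 (1 - p)
    rw [hpd _ hq hqd]
    refine h5.trans_eq ?_
    rw [hq.isSelfAdjoint.star_eq, mul_smul_comm, smul_mul_assoc, mul_one, hq.isIdempotentElem.eq]
  have h6 : posExt τ d = posExt τ (p * d) + posExt τ ((1 - p) * d) := by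
    rw [← hτ.posExt_add h1 h2, ← add_mul, add_sub_cancel, one_mul]
    have c1 : Commute p d := h
    have c2 : Commute p (1 - p) := (Commute.one_right p).sub_right (Commute.refl p)
    have c3 : Commute (1 - p) d := hqd
    exact (c2.mul_right c1).mul_left (c3.symm.mul_right (Commute.refl d))
  rw [h6, add_sub_cancel_left, abs_of_nonneg (hτ.posExt_nonneg _)]
  exact (hτ.posExt_mono h2 h3).trans_eq (hτ.posExt_smul (norm_nonneg d) hq.nonneg)

/-- A quasitrace on a simple algebra in `𝓒₁` is additive. -/
theorem posExt_add_of_inClassC1 (hA : IsSimpleCStar A) (hC : InClassC1 A) {a b : A}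
    (ha : 0 ≤ a) (hb : 0 ≤ b) : posExt τ (a + b) = posExt τ a + posExt τ b := by
  classical
  obtain ⟨x, rfl⟩ := CStarAlgebra.nonneg_iff_eq_star_mul_self.1 ha
  obtain ⟨y, rfl⟩ := CStarAlgebra.nonneg_iff_eq_star_mul_self.1 hb
  have hT := hτ.posExt_nonneg (1 : A)
  set T := posExt τ (1 : A)
  -- The square roots `x`, `y` are approximated rather than `a`, `b`, so that the approximants `x'*
  -- x'`, `y'* y'` are positive.
  have hcont : ∀ z : A, ∀ δ > 0, ∃ ε > 0, ∀ z', ‖z - z'‖ < ε →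
      ‖star z * z - star z' * z'‖ < δ := by
    intro z δ hδ
    have hc : Continuous fun z' : A => star z * z - star z' * z' := by fun_prop
    obtain ⟨ε, hε, h⟩ := Metric.continuous_iff.1 hc z δ hδ
    refine ⟨ε, hε, fun z' hz' => ?_⟩
    have := h z' (by rwa [dist_comm, dist_eq_norm])
    simpa [dist_eq_norm] using this
  refine eq_of_abs_sub_le_all fun δ₀ hδ₀ => ?_
  -- Three comparisons follow, for `a`, `b` and `a + b`, each with error `3 δ T`.
  obtain ⟨δ, hδ, hδ1, hδ2⟩ : ∃ δ > 0, δ ≤ 1 ∧ 9 * δ * (T + 1) ≤ δ₀ := by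
    refine ⟨min 1 (δ₀ / (9 * (T + 1))), by positivity, min_le_left _ _, ?_⟩
    have := min_le_right 1 (δ₀ / (9 * (T + 1)))
    rw [le_div_iff₀ (by positivity)] at this
    linarith
  obtain ⟨ε₁, hε₁, h1⟩ := hcont x δ hδ
  obtain ⟨ε₂, hε₂, h2⟩ := hcont y δ hδ
  set K := ‖star x * x‖ + ‖star y * y‖ + 2
  -- As `m τ(1-p) ≤ T`, this gives `K τ(1-p) ≤ δ T`, where `K` bounds the norms of all approximants.
  obtain ⟨m, hm⟩ := exists_nat_gt (K / δ)
  obtain ⟨H, v, hv, hvv, hF⟩ := hC.exists_approximation hA {x, y} (lt_min hε₁ hε₂) m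
  obtain ⟨x', hx', hxx⟩ := hF x (by simp)
  obtain ⟨y', hy', hyy⟩ := hF y (by simp)
  replace hxx := h1 x' (hxx.trans_le (min_le_left _ _))
  replace hyy := h2 y' (hyy.trans_le (min_le_right _ _))
  have hu := H.isStarProjection
  have hK : 0 < K := by positivity
  have hq : K * posExt τ (1 - H.unit) ≤ δ * T := by
    have h3 := hτ.nsmul_posExt_le hu.one_sub hv hvv
    rw [div_lt_iff₀ hδ] at hm
    have h4 := hτ.posExt_nonneg (1 - H.unit)
    have h5 : K * posExt τ (1 - H.unit) ≤ m * δ * posExt τ (1 - H.unit) := by gcongr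
    nlinarith
  obtain ⟨c, hc, hcp, hcx⟩ := H.exists_of_star_mul_self_cut hx'
  obtain ⟨d, hd, hdp, hdy⟩ := H.exists_of_star_mul_self_cut hy'
  have hadd := H.posExt_toAlg_add hτ hc hd hcp hdp
  rw [map_add, hcx, hdy, ← mul_add] at hadd
  have hcomm : ∀ z ∈ H.cut, H.unit * (star z * z) = star z * z * H.unit := fun z hz =>
    (H.mem_cut.1 (mul_mem (star_mem hz) hz)).1
  have nx := star_mul_self_nonneg x
  have ny := star_mul_self_nonneg y
  have nx' := star_mul_self_nonneg x'
  have ny' := star_mul_self_nonneg y'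
  -- Replacing `w` by `w'` costs `2 δ T`, and cutting `w'` down by `p` costs another `δ T`. The last
  -- hypothesis is `‖w‖ + 2δ ≤ K` in a form convenient for the three applications.
  have est : ∀ w w' : A, 0 ≤ w → 0 ≤ w' → H.unit * w' = w' * H.unit → ‖w - w'‖ ≤ 2 * δ →
      ‖w‖ + 2 ≤ K + 2 * (1 - δ) → |posExt τ w - posExt τ (H.unit * w')| ≤ 3 * δ * T := by
    intro w w' hw hw' hww h4 h5
    have e1 := hτ.posExt_le_add_norm_sub hw hw'
    have e2 := hτ.posExt_le_add_norm_sub hw' hw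
    rw [norm_sub_rev] at e2
    have e3 := abs_le.1 (hτ.abs_posExt_sub_le hu hw' hww)
    have e4 : ‖w'‖ ≤ K := by
      have := norm_sub_norm_le w' w
      rw [norm_sub_rev] at this
      linarith
    have e5 : ‖w'‖ * posExt τ (1 - H.unit) ≤ δ * T :=
      (mul_le_mul_of_nonneg_right e4 (hτ.posExt_nonneg _)).trans hq
    have e6 : ‖w - w'‖ * T ≤ 2 * δ * T := mul_le_mul_of_nonneg_right h4 hT
    change posExt τ w ≤ posExt τ w' + ‖w - w'‖ * T at e1
    change posExt τ w' ≤ posExt τ w + ‖w - w'‖ * T at e2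
    rw [abs_le]
    constructor <;> linarith [e3.1, e3.2]
  have fx := abs_le.1 (est _ _ nx nx' (hcomm x' hx') (by linarith)
    (by linarith [norm_nonneg (star y * y)]))
  have fy := abs_le.1 (est _ _ ny ny' (hcomm y' hy') (by linarith)
    (by linarith [norm_nonneg (star x * x)]))
  have fxy := abs_le.1 (est (star x * x + star y * y) (star x' * x' + star y' * y')
    (add_nonneg nx ny) (add_nonneg nx' ny')
    (by rw [mul_add, add_mul, hcomm x' hx', hcomm y' hy'])
    (by
      rw [add_sub_add_comm]
      exact (norm_add_le _ _).trans (by linarith))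
    (by linarith [norm_add_le (star x * x) (star y * y)]))
  rw [hadd] at fxy
  have hlast : 9 * δ * T ≤ δ₀ := by nlinarith
  rw [abs_le]
  constructor <;> linarith [fx.1, fx.2, fy.1, fy.2, fxy.1, fxy.2]

end IsOneQuasitrace

end TracialAH

end

/-! ### From additive quasitraces to traces. -/

noncomputable section

namespace TracialAH

section Extension

variable {A : Type*} [CStarAlgebra A]

/-- Polarization: a linear functional is determined by its values at the elements `x* x`. -/
theorem four_smul_star_mul (x y : A) :
    (4 : ℂ) • (star y * x) = star (x + y) * (x + y) - star (x - y) * (x - y) +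
      Complex.I • (star (x + Complex.I • y) * (x + Complex.I • y)) -
      Complex.I • (star (x - Complex.I • y) * (x - Complex.I • y)) := by
  simp only [star_add, star_sub, star_smul, add_mul, mul_add, sub_mul, mul_sub, smul_mul_assoc,
    mul_smul_comm, smul_add, smul_sub, smul_smul]
  simp only [RCLike.star_def, Complex.conj_I, mul_neg, Complex.I_mul_I, neg_neg, one_smul,
    neg_smul]
  module

theorem four_smul_mul_star (x y : A) :
    (4 : ℂ) • (x * star y) = (x + y) * star (x + y) - (x - y) * star (x - y) +
      Complex.I • ((x + Complex.I • y) * star (x + Complex.I • y)) -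
      Complex.I • ((x - Complex.I • y) * star (x - Complex.I • y)) := by
  simp only [star_add, star_sub, star_smul, add_mul, mul_add, sub_mul, mul_sub, smul_mul_assoc,
    mul_smul_comm, smul_add, smul_sub, smul_smul]
  simp only [RCLike.star_def, Complex.conj_I, mul_neg, Complex.I_mul_I, neg_neg, one_smul,
    neg_smul]
  module

/-- The polarizations of `y* x` and of `x y*` have the same coefficients, and their terms `z* z` and
`z z*` correspond one to one. Replacing `y` by its adjoint turns the two products into `y x` and `x
y`. -/
theorem tracial_of_star_mul_self {t : A →ₗ[ℂ] ℂ} (h : ∀ x, t (star x * x) = t (x * star x))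
    (x y : A) : t (x * y) = t (y * x) := by
  have h1 := congrArg t (four_smul_star_mul x (star y))
  have h2 := congrArg t (four_smul_mul_star x (star y))
  simp only [map_add, map_sub, map_smul, h] at h1
  simp only [map_add, map_sub, map_smul] at h2
  rw [← h2, star_star] at h1
  exact (smul_right_injective ℂ (four_ne_zero (α := ℂ)) h1).symm

theorem span_posCone_eq (t t' : A →ₗ[ℂ] ℂ) (h : ∀ x, t (star x * x) = t' (star x * x)) :
    t = t' := by
  ext x
  have h1 := congrArg t (four_smul_star_mul x 1)
  have h2 := congrArg t' (four_smul_star_mul x 1)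
  simp only [map_add, map_sub, map_smul, h] at h1
  simp only [map_add, map_sub, map_smul] at h2
  rw [← h2, star_one, one_mul] at h1
  exact smul_right_injective ℂ (four_ne_zero (α := ℂ)) h1

/-- An additive and positively homogeneous function on the positive cone extends to a linear
functional. -/
theorem exists_linear_extension [PartialOrder A] [StarOrderedRing A] {g : A → ℝ}
    (hadd : ∀ a b, 0 ≤ a → 0 ≤ b → g (a + b) = g a + g b)
    (hsmul : ∀ (c : ℝ) a, 0 ≤ c → 0 ≤ a → g (c • a) = c * g a) :
    ∃ t : A →ₗ[ℂ] ℂ, ∀ a, 0 ≤ a → t a = (g a : ℂ) := by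
  -- The decomposition `a = (a + ‖a‖) - ‖a‖` serves as a canonical choice; `key` shows that any
  -- other difference of positive elements gives the same value.
  let f : selfAdjoint A → ℝ := fun a => g (a + ‖(a : A)‖ • (1 : A)) - ‖(a : A)‖ * g 1
  have hnn : ∀ a : selfAdjoint A, 0 ≤ (a : A) + ‖(a : A)‖ • (1 : A) := by
    intro a
    have := IsSelfAdjoint.neg_algebraMap_norm_le_self (a := (a : A)) a.2
    rw [Algebra.algebraMap_eq_smul_one, neg_le_iff_add_nonneg] at this
    exact this
  have h1 : (0 : A) ≤ 1 := zero_le_one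
  have key : ∀ (a : selfAdjoint A) (b c : A), 0 ≤ b → 0 ≤ c → (a : A) = b - c →
      f a = g b - g c := by
    intro a b c hb hc habc
    have e1 := hadd _ _ (hnn a) hc
    have e2 := hadd b (‖(a : A)‖ • (1 : A)) hb (smul_nonneg (norm_nonneg _) h1)
    rw [hsmul _ _ (norm_nonneg _) h1] at e2
    have e3 : (a : A) + ‖(a : A)‖ • (1 : A) + c = b + ‖(a : A)‖ • (1 : A) := by
      rw [add_right_comm, habc, sub_add_cancel]
    rw [e3, e2] at e1
    simp only [f]
    linarith
  have hdec : ∀ a : selfAdjoint A, ∃ b c : A, 0 ≤ b ∧ 0 ≤ c ∧ (a : A) = b - c := fun a =>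
    ⟨_, ‖(a : A)‖ • (1 : A), hnn a, smul_nonneg (norm_nonneg _) h1, by simp⟩
  let fL : selfAdjoint A →ₗ[ℝ] ℝ :=
    { toFun := f
      map_add' := by
        intro a a'
        obtain ⟨b, c, hb, hc, h⟩ := hdec a
        obtain ⟨b', c', hb', hc', h'⟩ := hdec a'
        rw [key a b c hb hc h, key a' b' c' hb' hc' h',
          key (a + a') (b + b') (c + c') (add_nonneg hb hb') (add_nonneg hc hc')
            (by rw [AddSubgroup.coe_add, h, h']; abel), hadd _ _ hb hb', hadd _ _ hc hc']
        ring
      map_smul' := by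
        intro r a
        obtain ⟨b, c, hb, hc, h⟩ := hdec a
        rw [key a b c hb hc h]
        rcases le_total 0 r with hr | hr
        · rw [key (r • a) (r • b) (r • c) (smul_nonneg hr hb) (smul_nonneg hr hc)
            (by rw [selfAdjoint.val_smul, h, smul_sub]), hsmul _ _ hr hb, hsmul _ _ hr hc]
          simp [mul_sub]
        · have hr' : 0 ≤ -r := neg_nonneg.2 hr
          rw [key (r • a) ((-r) • c) ((-r) • b) (smul_nonneg hr' hc) (smul_nonneg hr' hb)
            (by rw [selfAdjoint.val_smul, h, smul_sub]; module), hsmul _ _ hr' hb,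
            hsmul _ _ hr' hc]
          simp
          ring }
  -- Complexification `x ↦ f(Re x) - i f(Re (i x))`; for self-adjoint `x` the second term vanishes.
  let t : A →ₗ[ℂ] ℂ := Module.Dual.extendRCLike (𝕜 := ℂ) (fL.comp realPart)
  refine ⟨t, fun a ha => ?_⟩
  have hsa : IsSelfAdjoint a := IsSelfAdjoint.of_nonneg ha
  have e : t a = (fL (realPart a) : ℂ) - Complex.I * (fL (realPart (Complex.I • a)) : ℂ) :=
    Module.Dual.extendRCLike_apply _ _
  rw [e, realPart_I_smul, hsa.imaginaryPart, neg_zero, map_zero]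
  have h2 : fL (realPart a) = g a - g 0 := key _ a 0 ha le_rfl (by rw [hsa.coe_realPart, sub_zero])
  have h3 := hadd 0 0 le_rfl le_rfl
  rw [add_zero] at h3
  rw [h2, show g 0 = 0 by linarith]
  simp

/-- Every `1`-quasitrace on a simple algebra in `𝓒₁` extends to a trace. -/
theorem IsOneQuasitrace.exists_trace (hA : IsSimpleCStar A) (hC : InClassC1 A)
    {τ : posCone A → ℝ} (hτ : IsOneQuasitrace τ) :
    ∃ t : A →ₗ[ℂ] ℂ, IsPositiveTrace t ∧ ∀ a : posCone A, t (a : A) = (τ a : ℂ) := by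
  let _ := CStarAlgebra.spectralOrder A
  have _ := CStarAlgebra.spectralOrderedRing A
  obtain ⟨t, ht⟩ := exists_linear_extension (g := posExt τ)
    (fun a b ha hb => hτ.posExt_add_of_inClassC1 hA hC ha hb)
    (fun c a hc ha => hτ.posExt_smul hc ha)
  refine ⟨t, ⟨fun x => ?_, tracial_of_star_mul_self fun x => ?_⟩, fun a => ?_⟩
  · rw [ht _ (star_mul_self_nonneg x)]
    exact_mod_cast hτ.posExt_nonneg _
  · rw [ht _ (star_mul_self_nonneg x), ht _ (mul_star_self_nonneg x), hτ.posExt_star_mul]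
  · rw [ht _ ((mem_posCone_iff _).1 a.2), posExt_coe]

/-- The generality in `B` serves two cases: `A` itself, and `M₂(A)` with the functional `t ⊗ Tr`,
which is the required extension of `t`. -/
theorem IsPositiveTrace.isOneQuasitrace {B : Type*} [Ring B] [StarRing B] [Module ℂ B]
    {t : B →ₗ[ℂ] ℂ} (hpos : ∀ x, 0 ≤ t (star x * x)) (htr : ∀ x y, t (x * y) = t (y * x)) :
    IsOneQuasitrace fun a : posCone B => (t a).re where
  nonneg := by
    rintro ⟨_, x, rfl⟩
    exact (Complex.le_def.1 (hpos x)).1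
  star_mul x := congrArg Complex.re (htr _ _)
  smul c a b _ h := by
    simp only [h, map_smul, smul_eq_mul, Complex.re_ofReal_mul]
  add a b c _ h := by simp only [h, map_add, Complex.add_re]

theorem IsPositiveTrace.isQuasitrace {t : A →ₗ[ℂ] ℂ} (ht : IsPositiveTrace t) :
    IsQuasitrace (restrictPos t) := by
  refine ⟨IsPositiveTrace.isOneQuasitrace ht.nonneg ht.tracial, fun a =>
    ((t.comp (Matrix.traceLinearMap (Fin 2) ℂ A)) a).re,
    IsPositiveTrace.isOneQuasitrace (fun x => ?_) fun x y => ?_, fun a b h => ?_⟩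
  · simp only [LinearMap.comp_apply, Matrix.traceLinearMap_apply, Matrix.trace, Matrix.diag_apply,
      Matrix.mul_apply, map_sum]
    exact Finset.sum_nonneg fun i _ => Finset.sum_nonneg fun j _ => ht.nonneg (x j i)
  · simp only [LinearMap.comp_apply, Matrix.traceLinearMap_apply, Matrix.trace, Matrix.diag_apply,
      Matrix.mul_apply, map_sum]
    rw [Finset.sum_comm]
    exact Finset.sum_congr rfl fun i _ => Finset.sum_congr rfl fun j _ => ht.tracial _ _
  · simp [h, restrictPos]

theorem IsPositiveTrace.apply_posCone {t : A →ₗ[ℂ] ℂ} (ht : IsPositiveTrace t) (a : posCone A) :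
    t (a : A) = ((t a).re : ℂ) := by
  obtain ⟨_, x, rfl⟩ := a
  exact (Complex.eq_re_of_ofReal_le (r := 0) (by simpa using ht.nonneg x))

theorem bijOn_restrictPos (hA : IsSimpleCStar A) (hC : InClassC1 A) :
    Set.BijOn (restrictPos (A := A)) (tracialStates A) (quasitraces A) := by
  refine ⟨fun t ht => ⟨ht.1.isQuasitrace, ?_⟩, fun t ht t' ht' h => ?_, fun τ hτ => ?_⟩
  · simp [restrictPos, ht.2]
  · refine span_posCone_eq t t' fun x => ?_
    have h1 := ht.1.apply_posCone ⟨star x * x, x, rfl⟩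
    have h2 := ht'.1.apply_posCone ⟨star x * x, x, rfl⟩
    have h3 := congrFun h ⟨star x * x, x, rfl⟩
    rw [show t (star x * x) = _ from h1, show t' (star x * x) = _ from h2]
    exact congrArg Complex.ofReal h3
  · obtain ⟨t, ht, h⟩ := hτ.1.1.exists_trace hA hC
    refine ⟨t, ⟨ht, ?_⟩, ?_⟩
    · have := h ⟨1, 1, by simp⟩
      rw [hτ.2] at this
      simpa using this
    · ext a
      simp [restrictPos, h a]

end Extension

end TracialAH

end

/-! ### Values of states of `K₀(A)` at projections. -/

noncomputable section

namespace TracialAH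

section ProjectionValues

variable {A : Type*} [CStarAlgebra A]

/-- The class of a projection in `V(A)`. -/
def VMon.mk (p : MatProj A) : VMon A := Quotient.mk (mvnSetoid A) p

theorem VMon.mk_eq {p q : MatProj A} (h : MvN p q) : VMon.mk p = VMon.mk q := Quotient.sound h

theorem VMon.mk_add (p q : MatProj A) : VMon.mk p + VMon.mk q = VMon.mk (p.sum q) := rfl

open Classical in
/-- The value of a homomorphism on `K₀(A)` at the class of a projection `e`, with the junk value `0`
if `e` is not a projection. -/
def projVal (s : K0 A →+ ℝ) {ι : Type*} [Fintype ι] (e : Matrix ι ι A) : ℝ :=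
  if h : IsStarProjection e then
    s (Algebra.GrothendieckAddGroup.of
      (VMon.mk (MatProj.reindex (Fintype.equivFin ι) e h)))
  else 0

variable {s : K0 A →+ ℝ} {ι κ : Type*} [Fintype ι] [Fintype κ]

theorem projVal_eq_reindex {e : Matrix ι ι A} (he : IsStarProjection e) {n : ℕ}
    (σ : ι ≃ Fin n) : projVal s e = s (Algebra.GrothendieckAddGroup.of
      (VMon.mk (MatProj.reindex σ e he))) := by
  rw [projVal, dif_pos he]
  congr 2
  exact VMon.mk_eq (MvN.of_equiv _ _ _ _ (Equiv.refl ι) fun i j => rfl)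

theorem projVal_fin {n : ℕ} {p : Matrix (Fin n) (Fin n) A} (hp : IsStarProjection p) :
    projVal s p = s (K0.cls p hp) :=
  projVal_eq_reindex hp (Equiv.refl _)

theorem projVal_eq_of_mul {e : Matrix ι ι A} {f : Matrix κ κ A} (he : IsStarProjection e)
    (hf : IsStarProjection f) (v : Matrix κ ι A) (h1 : vᴴ * v = e) (h2 : v * vᴴ = f) :
    projVal s e = projVal s f := by
  rw [projVal_eq_reindex he (Fintype.equivFin ι), projVal_eq_reindex hf (Fintype.equivFin κ)]
  congr 2
  exact VMon.mk_eq (MvN.of_reindex _ _ _ _ v h1 h2)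

theorem projVal_fromBlocks {e : Matrix ι ι A} {f : Matrix κ κ A} (he : IsStarProjection e)
    (hf : IsStarProjection f) :
    projVal s (Matrix.fromBlocks e 0 0 f) = projVal s e + projVal s f := by
  rw [projVal_eq_reindex he (Fintype.equivFin ι), projVal_eq_reindex hf (Fintype.equivFin κ),
    projVal_eq_reindex (isStarProjection_fromBlocks he hf)
      (((Fintype.equivFin ι).sumCongr (Fintype.equivFin κ)).trans finSumFinEquiv), ← map_add,
      ← map_add, VMon.mk_add]
  congr 2
  refine VMon.mk_eq (MvN.of_equiv _ _ (isStarProjection_fromBlocks he hf) _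
    ((Fintype.equivFin ι).sumCongr (Fintype.equivFin κ)) ?_)
  rintro (i | i) (j | j)
  · change e ((Fintype.equivFin ι).symm (Fintype.equivFin ι i))
      ((Fintype.equivFin ι).symm (Fintype.equivFin ι j)) = e i j
    simp
  · rfl
  · rfl
  · change f ((Fintype.equivFin κ).symm (Fintype.equivFin κ i))
      ((Fintype.equivFin κ).symm (Fintype.equivFin κ j)) = f i j
    simp

theorem _root_.IsStarProjection.conjTranspose_eq {e : Matrix ι ι A} (he : IsStarProjection e) : eᴴ = e :=
  he.isSelfAdjoint.star_eq

theorem _root_.IsStarProjection.mul_self_eq {e : Matrix ι ι A} (he : IsStarProjection e) : e * e = e :=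
  he.isIdempotentElem.eq

theorem mul_eq_zero_symm {e f : Matrix ι ι A} (he : IsStarProjection e) (hf : IsStarProjection f)
    (h : e * f = 0) : f * e = 0 := by
  have := congrArg Matrix.conjTranspose h
  rwa [Matrix.conjTranspose_mul, he.conjTranspose_eq, hf.conjTranspose_eq,
    Matrix.conjTranspose_zero] at this

/-- The column with entries `e`, `f` is a partial isometry from `e + f` to `diag(e, f)`. -/
theorem projVal_add {e f : Matrix ι ι A} (he : IsStarProjection e) (hf : IsStarProjection f)
    (h : e * f = 0) : projVal s (e + f) = projVal s e + projVal s f := by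
  rw [← projVal_fromBlocks he hf]
  refine projVal_eq_of_mul (he.add hf h) (isStarProjection_fromBlocks he hf)
    (Matrix.fromRows e f) ?_ ?_
  · rw [Matrix.conjTranspose_fromRows_eq_fromCols_conjTranspose, Matrix.fromCols_mul_fromRows,
      he.conjTranspose_eq, hf.conjTranspose_eq, he.mul_self_eq, hf.mul_self_eq]
  · rw [Matrix.conjTranspose_fromRows_eq_fromCols_conjTranspose, Matrix.fromRows_mul_fromCols,
      he.conjTranspose_eq, hf.conjTranspose_eq, he.mul_self_eq, hf.mul_self_eq, h,
      mul_eq_zero_symm he hf h]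

theorem projVal_zero : projVal s (0 : Matrix ι ι A) = 0 := by
  have h0 := IsStarProjection.zero (Matrix ι ι A)
  have := projVal_add (s := s) h0 h0 (by simp)
  rw [add_zero] at this
  linarith

theorem projVal_sum {o : Type*} (t : Finset o) {f : o → Matrix ι ι A}
    (hf : ∀ i ∈ t, IsStarProjection (f i)) (h : ∀ i ∈ t, ∀ j ∈ t, i ≠ j → f i * f j = 0) :
    projVal s (∑ i ∈ t, f i) = ∑ i ∈ t, projVal s (f i) := by
  classical
  induction t using Finset.induction_on with
  | empty => simpa using projVal_zero
  | insert i t hi ih =>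
    have hf' : ∀ j ∈ t, IsStarProjection (f j) := fun j hj => hf j (by simp [hj])
    have h' : ∀ j ∈ t, ∀ k ∈ t, j ≠ k → f j * f k = 0 := fun j hj k hk =>
      h j (by simp [hj]) k (by simp [hk])
    rw [Finset.sum_insert hi, Finset.sum_insert hi, projVal_add (hf i (by simp))
      (isStarProjection_sum t hf' h'), ih hf' h']
    rw [Finset.mul_sum, Finset.sum_eq_zero]
    exact fun j hj => h i (by simp) j (by simp [hj]) (by rintro rfl; exact hi hj)

theorem projVal_nonneg (hs : s ∈ stateSpace A) (e : Matrix ι ι A) : 0 ≤ projVal s e := by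
  by_cases he : IsStarProjection e
  · rw [projVal_eq_reindex he (Fintype.equivFin ι)]
    exact hs.1 _ _ (MatProj.reindex (Fintype.equivFin ι) e he).isProj
  · rw [projVal, dif_neg he]

theorem projVal_le (hs : s ∈ stateSpace A) {e f : Matrix ι ι A} (he : IsStarProjection e)
    (hf : IsStarProjection f) (h : e * f = e) : projVal s e ≤ projVal s f := by
  have h1 := projVal_add (s := s) he (he.sub_of_mul_eq_left hf h)
    (by rw [mul_sub, h, he.mul_self_eq, sub_self])
  rw [add_sub_cancel] at h1
  linarith [projVal_nonneg hs (f - e)]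

/-- `1 ⊗ e` is a sum of orthogonal projections `v k (v k)*`, where the column `v k` has `e` in block
`k`; each is equivalent to `e`. -/
theorem projVal_kronecker_one [DecidableEq κ] {e : Matrix ι ι A} (he : IsStarProjection e) :
    projVal s (Matrix.of fun (i j : κ × ι) => if i.1 = j.1 then e i.2 j.2 else 0) =
      Fintype.card κ * projVal s e := by
  let v : κ → Matrix (κ × ι) ι A := fun k => Matrix.of fun i j => if i.1 = k then e i.2 j else 0
  have hv : ∀ k l, (v k)ᴴ * v l = if k = l then e else 0 := by
    intro k l
    ext i j
    rw [Matrix.mul_apply, Fintype.sum_prod_type, Finset.sum_comm]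
    by_cases hkl : k = l
    · subst hkl
      simp only [v, Matrix.conjTranspose_apply, Matrix.of_apply, apply_ite star, star_zero, ite_mul,
        mul_ite, zero_mul, mul_zero, if_true]
      simp only [← ite_and, and_self, Finset.sum_ite_eq', Finset.mem_univ,
        if_true]
      conv_rhs => rw [← he.mul_self_eq]
      rw [Matrix.mul_apply]
      refine Finset.sum_congr rfl fun m _ => ?_
      rw [← Matrix.conjTranspose_apply, he.conjTranspose_eq]
    · rw [if_neg hkl]
      refine Finset.sum_eq_zero fun m _ => Finset.sum_eq_zero fun n _ => ?_
      simp only [v, Matrix.conjTranspose_apply, Matrix.of_apply]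
      by_cases h1 : n = k
      · rw [if_neg (h1 ▸ hkl : n ≠ l), mul_zero]
      · rw [if_neg h1, star_zero, zero_mul]
  have hve : ∀ k, v k * e = v k := by
    intro k
    ext i j
    rw [Matrix.mul_apply]
    simp only [v, Matrix.of_apply]
    by_cases h1 : i.1 = k
    · simp only [if_pos h1]
      rw [← Matrix.mul_apply, he.mul_self_eq]
    · simp [if_neg h1]
  have hp : ∀ k, IsStarProjection (v k * (v k)ᴴ) := fun k =>
    { isIdempotentElem := by
        unfold IsIdempotentElem
        calc v k * (v k)ᴴ * (v k * (v k)ᴴ) = v k * ((v k)ᴴ * v k) * (v k)ᴴ := by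
              simp only [Matrix.mul_assoc]
          _ = _ := by rw [hv, if_pos rfl, hve]
      isSelfAdjoint := by
        change (v k * (v k)ᴴ)ᴴ = _
        rw [Matrix.conjTranspose_mul, Matrix.conjTranspose_conjTranspose] }
  have hsum : (Matrix.of fun (i j : κ × ι) => if i.1 = j.1 then e i.2 j.2 else 0) =
      ∑ k, v k * (v k)ᴴ := by
    ext ⟨i, i'⟩ ⟨j, j'⟩
    rw [Matrix.sum_apply]
    have h1 : ∀ k, (v k * (v k)ᴴ) (i, i') (j, j') = if i = k then (if j = k then e i' j' else 0)
        else 0 := by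
      intro k
      rw [Matrix.mul_apply]
      simp only [v, Matrix.conjTranspose_apply, Matrix.of_apply]
      by_cases h1 : i = k
      · by_cases h2 : j = k
        · simp only [if_pos h1, if_pos h2]
          have := congrFun (congrFun (he.mul_self_eq) i') j'
          rw [Matrix.mul_apply] at this
          rw [← this]
          refine Finset.sum_congr rfl fun m _ => ?_
          rw [← Matrix.conjTranspose_apply, he.conjTranspose_eq]
        · simp [h2]
      · simp [h1]
    simp only [h1, Matrix.of_apply]
    simp [eq_comm]
  rw [hsum, projVal_sum _ (fun k _ => hp k)]
  · rw [Finset.sum_congr rfl fun k _ =>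
      (projVal_eq_of_mul (s := s) he (hp k) (v k) (by rw [hv, if_pos rfl]) rfl).symm]
    simp
  · intro k _ l _ hkl
    calc v k * (v k)ᴴ * (v l * (v l)ᴴ) = v k * ((v k)ᴴ * v l) * (v l)ᴴ := by
          simp only [Matrix.mul_assoc]
      _ = _ := by rw [hv, if_neg hkl]; simp

/-- From `E = S* Z* Z S ≤ ‖Z* Z‖ S* S`, polar decomposition yields `x` in the closed right ideal of
`S`, and `F` acts there as the identity. -/
theorem exists_star_mul_self_eq_of_leftInverse {B : Type*} [CStarAlgebra B] [PartialOrder B]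
    [StarOrderedRing B] {E F S Z : B} (hE : IsStarProjection E) (hZS : Z * S = E)
    (hFS : F * S = S) : ∃ x, star x * x = E ∧ F * x = x := by
  have hc1 : star E = E := hE.isSelfAdjoint.star_eq
  have hc2 : E * E = E := hE.isIdempotentElem.eq
  have hle : E * star E ≤ ‖star Z * Z‖ • (star S * S) := by
    rw [hc1, hc2]
    have h1 : star Z * Z ≤ ‖star Z * Z‖ • (1 : B) := by
      rw [← Algebra.algebraMap_eq_smul_one]
      exact IsSelfAdjoint.le_algebraMap_norm_self (IsSelfAdjoint.star_mul_self Z)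
    have h2 := star_left_conjugate_le_conjugate h1 S
    have h3 : star S * (star Z * Z) * S = E := by
      rw [← mul_assoc, ← StarMul.star_mul, mul_assoc, hZS, hc1, hc2]
    rwa [h3, mul_smul_comm, smul_mul_assoc, mul_one] at h2
  obtain ⟨x, hx, hy⟩ := exists_star_mul_self_eq_of_le (norm_nonneg _) hle
  rw [hc1, hc2] at hx
  refine ⟨x, hx, ?_⟩
  have := hy (1 - F) (by rw [sub_mul, one_mul, hFS, sub_self])
  rw [sub_mul, one_mul, sub_eq_zero] at this
  exact this.symm

/-- If `T` maps into the range of `f` and has a left inverse on the range of `e`, then `e` is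
equivalent to a subprojection of `f`. -/
theorem projVal_le_of_leftInverse (hs : s ∈ stateSpace A) {e : Matrix ι ι A} {f : Matrix κ κ A}
    (he : IsStarProjection e) (hf : IsStarProjection f) (T : Matrix κ ι A) (Y : Matrix ι κ A)
    (hY : Y * T = e) (hT : f * T = T) : projVal s e ≤ projVal s f := by
  classical
  let _ := CStarAlgebra.spectralOrder A
  have _ := CStarAlgebra.spectralOrderedRing A
  have he' : IsStarProjection (Matrix.fromBlocks e 0 0 (0 : Matrix κ κ A)) :=
    isStarProjection_fromBlocks he (IsStarProjection.zero _)
  have hf' : IsStarProjection (Matrix.fromBlocks (0 : Matrix ι ι A) 0 0 f) :=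
    isStarProjection_fromBlocks (IsStarProjection.zero _) hf
  have hval1 : projVal s (Matrix.fromBlocks e 0 0 (0 : Matrix κ κ A)) = projVal s e := by
    rw [projVal_fromBlocks he (IsStarProjection.zero _), projVal_zero, add_zero]
  have hval2 : projVal s (Matrix.fromBlocks (0 : Matrix ι ι A) 0 0 f) = projVal s f := by
    rw [projVal_fromBlocks (IsStarProjection.zero _) hf, projVal_zero, zero_add]
  rw [← hval1, ← hval2]
  set E := Matrix.fromBlocks e 0 0 (0 : Matrix κ κ A)
  set F := Matrix.fromBlocks (0 : Matrix ι ι A) 0 0 f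
  -- The rectangular `T` and `Y` become off-diagonal blocks of square matrices over `ι ⊕ κ`, so that
  -- the argument runs in one C*-algebra.
  have hZS : Matrix.fromBlocks (0 : Matrix ι ι A) Y 0 0 *
      Matrix.fromBlocks 0 0 T (0 : Matrix κ κ A) = E := by
    rw [Matrix.fromBlocks_multiply, hY]
    simp [E]
  have hFS : F * Matrix.fromBlocks 0 0 T (0 : Matrix κ κ A) =
      Matrix.fromBlocks 0 0 T (0 : Matrix κ κ A) := by
    rw [Matrix.fromBlocks_multiply, hT]
    simp
  -- `CStarMatrix` is the same set of matrices with its C*-norm, which is needed only here and in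
  -- the next step.
  obtain ⟨x, hx, hFx⟩ : ∃ x : Matrix (ι ⊕ κ) (ι ⊕ κ) A, xᴴ * x = E ∧ F * x = x :=
    exists_star_mul_self_eq_of_leftInverse (B := CStarMatrix (ι ⊕ κ) (ι ⊕ κ) A)
      ⟨he'.isIdempotentElem, he'.isSelfAdjoint⟩ hZS hFS
  have hxE : x * E = x := mul_eq_self_of_star_mul_self (A := CStarMatrix (ι ⊕ κ) (ι ⊕ κ) A)
    ⟨he'.isIdempotentElem, he'.isSelfAdjoint⟩ hx
  have hxx : IsStarProjection (x * xᴴ) :=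
    { isIdempotentElem := by
        unfold IsIdempotentElem
        calc x * xᴴ * (x * xᴴ) = x * (xᴴ * x) * xᴴ := by simp only [Matrix.mul_assoc]
          _ = _ := by rw [hx, hxE]
      isSelfAdjoint := by
        change (x * xᴴ)ᴴ = _
        rw [Matrix.conjTranspose_mul, Matrix.conjTranspose_conjTranspose] }
  rw [projVal_eq_of_mul he' hxx x hx rfl]
  refine projVal_le hs hxx hf' ?_
  have h4 : xᴴ * F = xᴴ := by
    have := congrArg Matrix.conjTranspose hFx
    rwa [Matrix.conjTranspose_mul, hf'.conjTranspose_eq] at this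
  rw [Matrix.mul_assoc, h4]

end ProjectionValues

end TracialAH

end

/-! ### Comparison of projection fields with equal rank functions. -/

noncomputable section

namespace TracialAH

section Shift

open scoped Kronecker

theorem kronecker_mulVec_apply {o p I J : Type*} [Fintype o] [Fintype I] (S : Matrix p o ℂ)
    (u : Matrix J I ℂ) (ξ : o × I → ℂ) (c : p) (j : J) :
    ((S ⊗ₖ u) *ᵥ ξ) (c, j) = ∑ b, S c b * (u *ᵥ fun i => ξ (b, i)) j := by
  simp only [Matrix.mulVec, dotProduct, Matrix.kroneckerMap_apply, Fintype.sum_prod_type,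
    Finset.mul_sum, mul_assoc]

theorem continuous_kronecker {X o p I J : Type*} [TopologicalSpace X] (S : Matrix p o ℂ)
    {v : X → Matrix J I ℂ} (hv : Continuous v) : Continuous fun x => S ⊗ₖ v x := by
  refine continuous_matrix fun i j => ?_
  simp only [Matrix.kroneckerMap_apply]
  exact continuous_const.mul (hv.matrix_elem _ _)

variable {X I J : Type*} [TopologicalSpace X] [Fintype I] [Fintype J] [DecidableEq I]
  [DecidableEq J]

theorem continuous_matrix_inv {W : X → Matrix I I ℂ} (hW : Continuous W)
    (h : ∀ x, IsUnit (W x)) : Continuous fun x => (W x)⁻¹ := by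
  simp only [Matrix.inv_def, Ring.inverse_eq_inv']
  exact (hW.matrix_det.inv₀ fun x => ((Matrix.isUnit_iff_isUnit_det _).1 (h x)).ne_zero).smul
    hW.matrix_adjugate

/-- At `x₀` a partial isometry `g` carries the range of `e` onto that of `f`. Injectivity persists
nearby because `g* f g e + (1 - e)` is `1` at `x₀` and its determinant is continuous. -/
theorem exists_injOn_range {e : X → Matrix I I ℂ} {f : X → Matrix J J ℂ} (he : Continuous e)
    (hf : Continuous f) (hep : ∀ x, IsStarProjection (e x)) (hfp : ∀ x, IsStarProjection (f x))
    (x₀ : X) (htr : (e x₀).trace = (f x₀).trace) :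
    ∃ (g : Matrix J I ℂ) (U : Set X), IsOpen U ∧ x₀ ∈ U ∧ ∀ x ∈ U, ∀ ξ, e x *ᵥ ξ = ξ →
      (f x * g * e x) *ᵥ ξ = 0 → ξ = 0 := by
  obtain ⟨k, hk⟩ : ∃ k, (e x₀).rank = k := ⟨_, rfl⟩
  have hk' : (f x₀).rank = k := by
    rw [trace_eq_rank (hep x₀), trace_eq_rank (hfp x₀)] at htr
    rw [← hk]
    exact_mod_cast htr.symm
  obtain ⟨w, hw1, hw2⟩ := exists_frame (hep x₀) hk
  obtain ⟨y, hy1, hy2⟩ := exists_frame (hfp x₀) hk'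
  let D : X → Matrix I I ℂ := fun x => (y * wᴴ)ᴴ * (f x * (y * wᴴ) * e x) + (1 - e x)
  have hD : Continuous D := by fun_prop
  refine ⟨y * wᴴ, {x | (D x).det ≠ 0}, isOpen_ne_fun hD.matrix_det continuous_const, ?_,
    fun x hx ξ h1 h2 => ?_⟩
  · have h0 : D x₀ = 1 := by
      have : (y * wᴴ)ᴴ * (f x₀ * (y * wᴴ) * e x₀) = e x₀ := by
        rw [← hy2, ← hw2, Matrix.conjTranspose_mul, Matrix.conjTranspose_conjTranspose]
        calc _ = w * (yᴴ * y) * (yᴴ * y) * (wᴴ * w) * wᴴ := by simp only [Matrix.mul_assoc]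
          _ = _ := by simp only [hy1, hw1, Matrix.mul_one]
      simp only [D, this]
      abel
    simp [h0]
  · have h3 : D x *ᵥ ξ = 0 := by
      simp only [D]
      rw [Matrix.add_mulVec, ← Matrix.mulVec_mulVec, h2, Matrix.sub_mulVec, h1]
      simp
    exact Matrix.eq_zero_of_mulVec_eq_zero hx h3

/-- The matrix of the shift by `a`. -/
def shiftMatrix (N l : ℕ) (a : Fin l) : Matrix (Fin (N + l)) (Fin N) ℂ :=
  Matrix.of fun c b => if (c : ℕ) = b + a then 1 else 0

omit [Fintype J] [DecidableEq I] [DecidableEq J] in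
-- Adding the local maps `u a` directly could destroy injectivity; shifting the `a`-th one by `a`
-- makes the sum triangular. For the smallest `a₀` with `h a₀ ≠ 0`, block `b + a₀` of the image is
-- `h a₀ • u a₀ ξ_b` plus terms in `ξ_{b'}` with `b' < b`, so `ξ` vanishes block by block. Only `l`
-- extra blocks are needed, for every `N`.
theorem shift_injective {N l : ℕ} {u : Fin l → Matrix J I ℂ} {h : Fin l → ℝ} {e : Matrix I I ℂ}
    (hsum : ∑ a, h a = 1)
    (hinj : ∀ a, h a ≠ 0 → ∀ ξ, e *ᵥ ξ = ξ → u a *ᵥ ξ = 0 → ξ = 0) {ξ : Fin N × I → ℂ}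
    (h1 : ((1 : Matrix (Fin N) (Fin N) ℂ) ⊗ₖ e) *ᵥ ξ = ξ)
    (h2 : (∑ a, (h a : ℂ) • (shiftMatrix N l a ⊗ₖ u a)) *ᵥ ξ = 0) : ξ = 0 := by
  have hξ : ∀ b, e *ᵥ (fun i => ξ (b, i)) = fun i => ξ (b, i) := by
    intro b
    ext i
    have := congrFun h1 (b, i)
    rw [kronecker_mulVec_apply] at this
    rw [← this]
    simp [Matrix.one_apply]
  obtain ⟨a₀, ha₀, hmin⟩ : ∃ a₀, h a₀ ≠ 0 ∧ ∀ a < a₀, h a = 0 := by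
    have hne : (Finset.univ.filter fun a => h a ≠ 0).Nonempty := by
      by_contra hc
      rw [Finset.not_nonempty_iff_eq_empty, Finset.filter_eq_empty_iff] at hc
      rw [Finset.sum_eq_zero fun a ha => not_not.1 (hc ha)] at hsum
      exact zero_ne_one hsum
    obtain ⟨a₀, ha, hm⟩ := Finset.exists_min_image _ id hne
    refine ⟨a₀, (Finset.mem_filter.1 ha).2, fun a hlt => ?_⟩
    by_contra hc
    exact absurd (hm a (by simp [hc])) (not_le.2 hlt)
  have key : ∀ n : ℕ, ∀ b : Fin N, (b : ℕ) = n → (fun i => ξ (b, i)) = 0 := by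
    intro n
    induction n using Nat.strong_induction_on with
    | _ n ih =>
      intro b hb
      refine hinj a₀ ha₀ _ (hξ b) ?_
      ext j
      let c : Fin (N + l) := ⟨b + a₀, by omega⟩
      have h3 := congrFun h2 (c, j)
      rw [Matrix.sum_mulVec, Finset.sum_apply] at h3
      simp only [Matrix.smul_mulVec, Pi.smul_apply, kronecker_mulVec_apply] at h3
      rw [Finset.sum_eq_single a₀, Finset.sum_eq_single b] at h3
      · have h4 : shiftMatrix N l a₀ c b = 1 := by simp [shiftMatrix, c]
        rw [h4, one_mul, smul_eq_mul] at h3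
        rcases mul_eq_zero.1 h3 with h5 | h5
        · exact absurd (by exact_mod_cast h5) ha₀
        · exact h5
      · intro b' _ hbb
        have h4 : shiftMatrix N l a₀ c b' = 0 := by
          simp only [shiftMatrix, c, Matrix.of_apply]
          rw [if_neg]
          intro h
          exact hbb (Fin.ext (by omega))
        rw [h4, zero_mul]
      · simp
      · intro a _ haa
        rcases lt_or_gt_of_ne haa with hlt | hlt
        · rw [hmin a hlt]
          simp
        · rw [Finset.sum_eq_zero, smul_zero]
          intro b' _
          by_cases hc : (c : ℕ) = b' + a
          · have hlt' : (a₀ : ℕ) < a := hlt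
            have : (b' : ℕ) < n := by
              simp only [c] at hc
              omega
            rw [ih b' this b' rfl]
            simp
          · simp [shiftMatrix, hc]
      · simp
  ext ⟨b, i⟩
  exact congrFun (key b b rfl) i

/-- Two continuous fields of projections with the same rank function over a compact space are
equivalent up to a uniformly bounded number of summands, for all multiples. -/
theorem exists_leftInverse_kronecker [CompactSpace X] [T2Space X] {e : X → Matrix I I ℂ}
    {f : X → Matrix J J ℂ} (he : Continuous e) (hf : Continuous f)
    (hep : ∀ x, IsStarProjection (e x)) (hfp : ∀ x, IsStarProjection (f x))
    (htr : ∀ x, (e x).trace = (f x).trace) :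
    ∃ l : ℕ, ∀ N : ℕ, ∃ (T : X → Matrix (Fin (N + l) × J) (Fin N × I) ℂ)
      (Y : X → Matrix (Fin N × I) (Fin (N + l) × J) ℂ), Continuous T ∧ Continuous Y ∧
      ∀ x, Y x * T x = (1 : Matrix (Fin N) (Fin N) ℂ) ⊗ₖ e x ∧
        ((1 : Matrix (Fin (N + l)) (Fin (N + l)) ℂ) ⊗ₖ f x) * T x = T x := by
  choose g U hUo hxU hinj using fun x₀ => exists_injOn_range he hf hep hfp x₀ (htr x₀)
  obtain ⟨t, h, -, hsum, hsupp⟩ := exists_finite_partition U hUo hxU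
  let σ := Fintype.equivFin t
  refine ⟨Fintype.card t, fun N => ?_⟩
  let k : Fin (Fintype.card t) → C(X, ℝ) := fun a => h (σ.symm a)
  let u : Fin (Fintype.card t) → X → Matrix J I ℂ := fun a x => f x * g (σ.symm a) * e x
  -- The local comparison maps, weighted by a partition of unity and separated by shifts. The number
  -- of extra summands is the number of charts and does not involve `N`.
  let T : X → Matrix (Fin (N + Fintype.card t) × J) (Fin N × I) ℂ := fun x =>
    ∑ a, (k a x : ℂ) • (shiftMatrix N _ a ⊗ₖ u a x)
  let E : X → Matrix (Fin N × I) (Fin N × I) ℂ := fun x => (1 : Matrix (Fin N) (Fin N) ℂ) ⊗ₖ e x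
  have hE : Continuous E := continuous_kronecker _ he
  have hEp : ∀ x, E x * E x = E x := fun x => by
    simp only [E]
    rw [← Matrix.mul_kronecker_mul, Matrix.one_mul, (hep x).isIdempotentElem.eq]
  have hEs : ∀ x, (E x)ᴴ = E x := fun x => by
    have h1 : (e x)ᴴ = e x := (hep x).isSelfAdjoint.star_eq
    simp only [E]
    rw [Matrix.conjTranspose_kronecker, Matrix.conjTranspose_one, h1]
  have hT : Continuous T := by
    refine continuous_finsetSum _ fun a _ => ?_
    have h1 : Continuous (u a) := by fun_prop
    exact (Complex.continuous_ofReal.comp (k a).continuous).smul (continuous_kronecker _ h1)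
  have hTE : ∀ x, T x * E x = T x := fun x => by
    simp only [T, E]
    rw [Matrix.sum_mul]
    refine Finset.sum_congr rfl fun a _ => ?_
    rw [Matrix.smul_mul, ← Matrix.mul_kronecker_mul, Matrix.mul_one]
    simp only [u]
    rw [Matrix.mul_assoc, (hep x).isIdempotentElem.eq]
  have hFT : ∀ x, ((1 : Matrix (Fin (N + Fintype.card t)) (Fin (N + Fintype.card t)) ℂ) ⊗ₖ f x) *
      T x = T x := fun x => by
    simp only [T]
    rw [Matrix.mul_sum]
    refine Finset.sum_congr rfl fun a _ => ?_
    rw [Matrix.mul_smul, ← Matrix.mul_kronecker_mul, Matrix.one_mul]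
    simp only [u]
    rw [← Matrix.mul_assoc, ← Matrix.mul_assoc, (hfp x).isIdempotentElem.eq]
  -- Invertible because `T` is injective on the range of `E`. Since `T* T = W E`, the matrix `W⁻¹
  -- T*` is a continuous left inverse of `T` on that range.
  let W : X → Matrix (Fin N × I) (Fin N × I) ℂ := fun x => (T x)ᴴ * T x + (1 - E x)
  have hW : Continuous W := by fun_prop
  have hWu : ∀ x, IsUnit (W x) := by
    intro x
    rw [← Matrix.mulVec_injective_iff_isUnit]
    rw [← Matrix.coe_mulVecLin, ← LinearMap.ker_eq_bot, LinearMap.ker_eq_bot']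
    intro ξ hξ
    rw [Matrix.mulVecLin_apply] at hξ
    have h1 : W x = (Matrix.fromRows (T x) (1 - E x))ᴴ * Matrix.fromRows (T x) (1 - E x) := by
      rw [Matrix.conjTranspose_fromRows_eq_fromCols_conjTranspose, Matrix.fromCols_mul_fromRows,
        Matrix.conjTranspose_sub, hEs, Matrix.conjTranspose_one]
      simp only [W]
      congr 1
      rw [Matrix.sub_mul, Matrix.one_mul, Matrix.mul_sub, Matrix.mul_one, hEp]
      simp
    rw [h1, Matrix.conjTranspose_mul_self_mulVec_eq_zero, Matrix.fromRows_mulVec] at hξ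
    have h2 : T x *ᵥ ξ = 0 := funext fun i => congrFun hξ (Sum.inl i)
    have h3 : (1 - E x) *ᵥ ξ = 0 := funext fun i => congrFun hξ (Sum.inr i)
    rw [Matrix.sub_mulVec, Matrix.one_mulVec, sub_eq_zero] at h3
    refine shift_injective (h := fun a => k a x) ?_ (fun a ha => ?_) h3.symm h2
    · rw [← hsum x]
      exact Equiv.sum_comp σ.symm fun i => h i x
    · refine hinj _ x ?_
      by_contra hx
      exact ha (hsupp _ x hx)
  refine ⟨T, fun x => (W x)⁻¹ * (T x)ᴴ, hT,
    (continuous_matrix_inv hW hWu).matrix_mul hT.matrix_conjTranspose, fun x => ⟨?_, hFT x⟩⟩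
  have h1 : (T x)ᴴ * T x = W x * E x := by
    simp only [W]
    rw [Matrix.add_mul, Matrix.mul_assoc, hTE, Matrix.sub_mul, hEp]
    simp
  have h2 : (W x)⁻¹ * W x = 1 := Matrix.nonsing_inv_mul _ ((Matrix.isUnit_iff_isUnit_det _).1 (hWu x))
  change (W x)⁻¹ * (T x)ᴴ * T x = E x
  rw [Matrix.mul_assoc, h1, ← Matrix.mul_assoc, h2, Matrix.one_mul]

end Shift

end TracialAH

end

/-! ### States of `K₀(A)` on `P M_r(C(X)) P` depend only on ranks. -/

noncomputable section

namespace TracialAH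

/-- Dividing by `N` and letting it grow removes the `l` extra summands. -/
theorem le_of_forall_nat_mul_le {a b : ℝ} {l : ℕ} (h : ∀ N : ℕ, N * a ≤ (N + l : ℕ) * b) :
    a ≤ b := by
  by_contra hab
  rw [not_le] at hab
  obtain ⟨N, hN⟩ := exists_nat_gt (l * b / (a - b))
  rw [div_lt_iff₀ (sub_pos.2 hab)] at hN
  have := h N
  push_cast at this
  linarith

namespace HomogeneousSubalgebra

open scoped Kronecker

variable {A : Type*} [CStarAlgebra A] (H : HomogeneousSubalgebra A) {ι κ μ : Type*}

/-- `toAlg` compresses by `P`; if the right factor already absorbs `P` on the left, the compression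
between the two factors is harmless. -/
theorem toAlg_mul_of_mul_eq {a b : MatFun H.X H.r} (hb : H.P * b = b) :
    H.toAlg (a * b) = H.toAlg a * H.toAlg b := by
  have h1 : ∀ c, H.toAlg c = H.toAlg (H.P * c * H.P) := fun c => by
    rw [H.toAlg_of_mem (compress_mem_corner c)]
    rfl
  rw [h1 a, h1 b, ← H.toAlg_mul (compress_mem_corner a) (compress_mem_corner b), h1]
  congr 1
  have h2 := H.isProj.isIdempotentElem.eq
  calc H.P * (a * b) * H.P = H.P * a * b * H.P := by simp only [mul_assoc]
    _ = H.P * a * (H.P * H.P * b) * H.P := by rw [h2, hb]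
    _ = _ := by simp only [mul_assoc]

/-- The block of a matrix-valued function. -/
def block (F : C(H.X, Matrix (κ × Fin H.r) (ι × Fin H.r) ℂ)) (j : κ) (i : ι) : MatFun H.X H.r :=
  MatFun.mk (fun x => Matrix.of fun ρ σ => F x (j, ρ) (i, σ))
    (continuous_matrix fun _ _ => F.continuous.matrix_elem _ _)

theorem block_apply (F : C(H.X, Matrix (κ × Fin H.r) (ι × Fin H.r) ℂ)) (j : κ) (i : ι) (x : H.X)
    (ρ σ : Fin H.r) : H.block F j i x ρ σ = F x (j, ρ) (i, σ) := rfl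

/-- The matrix over `A` given by a matrix-valued function. -/
def lift (F : C(H.X, Matrix (κ × Fin H.r) (ι × Fin H.r) ℂ)) : Matrix κ ι A :=
  Matrix.of fun j i => H.toAlg (H.block F j i)

theorem lift_apply (F : C(H.X, Matrix (κ × Fin H.r) (ι × Fin H.r) ℂ)) (j : κ) (i : ι) :
    H.lift F j i = H.toAlg (H.block F j i) := rfl

/-- The projection `1 ⊗ P`. -/
def amp (ι : Type*) [DecidableEq ι] : C(H.X, Matrix (ι × Fin H.r) (ι × Fin H.r) ℂ) :=
  ⟨fun x => (1 : Matrix ι ι ℂ) ⊗ₖ H.P x, continuous_kronecker _ (MatFun.continuous H.P)⟩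

variable [Fintype ι] [Fintype κ] [DecidableEq ι] [DecidableEq κ]

omit [Fintype ι] in
theorem amp_apply (x : H.X) : H.amp ι x = (1 : Matrix ι ι ℂ) ⊗ₖ H.P x := rfl

theorem isStarProjection_amp (x : H.X) : IsStarProjection (H.amp ι x) where
  isIdempotentElem := by
    unfold IsIdempotentElem
    rw [amp_apply, ← Matrix.mul_kronecker_mul, Matrix.one_mul,
      (H.isProj_apply x).isIdempotentElem.eq]
  isSelfAdjoint := by
    have h1 : (H.P x)ᴴ = H.P x := (H.isProj_apply x).isSelfAdjoint.star_eq
    change ((1 : Matrix ι ι ℂ) ⊗ₖ H.P x)ᴴ = _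
    rw [Matrix.conjTranspose_kronecker, Matrix.conjTranspose_one, h1]
    rfl

theorem block_of_amp_mul {G : C(H.X, Matrix (ι × Fin H.r) (μ × Fin H.r) ℂ)}
    (hG : ∀ x, H.amp ι x * G x = G x) (i : ι) (m : μ) : H.P * H.block G i m = H.block G i m := by
  ext1 x
  ext ρ σ
  rw [MatFun.mul_apply, Matrix.mul_apply, block_apply]
  conv_rhs => rw [← hG x]
  rw [Matrix.mul_apply, Fintype.sum_prod_type, Finset.sum_eq_single i]
  · refine Finset.sum_congr rfl fun τ _ => ?_
    rw [amp_apply, Matrix.kroneckerMap_apply, Matrix.one_apply_eq, one_mul, block_apply]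
  · intro i' _ hi
    refine Finset.sum_eq_zero fun τ _ => ?_
    rw [amp_apply, Matrix.kroneckerMap_apply, Matrix.one_apply_ne hi.symm, zero_mul, zero_mul]
  · simp

omit [Fintype κ] [DecidableEq κ] in
theorem lift_mul {F : C(H.X, Matrix (κ × Fin H.r) (ι × Fin H.r) ℂ)}
    {G : C(H.X, Matrix (ι × Fin H.r) (μ × Fin H.r) ℂ)}
    {K : C(H.X, Matrix (κ × Fin H.r) (μ × Fin H.r) ℂ)} (hK : ∀ x, F x * G x = K x)
    (hG : ∀ x, H.amp ι x * G x = G x) : H.lift F * H.lift G = H.lift K := by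
  ext j m
  rw [Matrix.mul_apply]
  simp only [lift_apply]
  rw [Finset.sum_congr rfl fun i _ => (H.toAlg_mul_of_mul_eq (H.block_of_amp_mul hG i m)).symm,
    ← map_sum]
  congr 1
  ext1 x
  have h1 : (∑ i, H.block F j i * H.block G i m) x = ∑ i, (H.block F j i * H.block G i m) x :=
    map_sum (MatFun.eval x) _ _
  rw [h1]
  ext ρ σ
  rw [Matrix.sum_apply, block_apply, ← hK, Matrix.mul_apply, Fintype.sum_prod_type]
  refine Finset.sum_congr rfl fun i _ => ?_
  rw [MatFun.mul_apply, Matrix.mul_apply]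
  rfl

omit [Fintype ι] [Fintype κ] [DecidableEq ι] [DecidableEq κ] in
theorem lift_conjTranspose {F : C(H.X, Matrix (κ × Fin H.r) (ι × Fin H.r) ℂ)}
    {G : C(H.X, Matrix (ι × Fin H.r) (κ × Fin H.r) ℂ)} (h : ∀ x, (F x)ᴴ = G x) :
    (H.lift F)ᴴ = H.lift G := by
  ext i j
  rw [Matrix.conjTranspose_apply, lift_apply, lift_apply, ← H.toAlg_star]
  congr 1
  ext1 x
  ext ρ σ
  rw [block_apply, ← h]
  rfl

/-- A continuous projection-valued function below `1 ⊗ P`. -/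
structure IsProjFun (F : C(H.X, Matrix (ι × Fin H.r) (ι × Fin H.r) ℂ)) : Prop where
  isStarProjection : ∀ x, IsStarProjection (F x)
  amp_mul : ∀ x, H.amp ι x * F x = F x

variable {H}

theorem IsProjFun.lift {F : C(H.X, Matrix (ι × Fin H.r) (ι × Fin H.r) ℂ)} (hF : H.IsProjFun F) :
    IsStarProjection (H.lift F) where
  isIdempotentElem := H.lift_mul (fun x => (hF.isStarProjection x).isIdempotentElem) hF.amp_mul
  isSelfAdjoint := H.lift_conjTranspose fun x => (hF.isStarProjection x).isSelfAdjoint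

variable (H)

theorem isProjFun_amp : H.IsProjFun (H.amp ι) :=
  ⟨H.isStarProjection_amp, fun x => (H.isStarProjection_amp x).isIdempotentElem⟩

/-- The function `1_N ⊗ F`. -/
def multiple (N : ℕ) (F : C(H.X, Matrix (ι × Fin H.r) (ι × Fin H.r) ℂ)) :
    C(H.X, Matrix ((Fin N × ι) × Fin H.r) ((Fin N × ι) × Fin H.r) ℂ) :=
  ⟨fun x => ((1 : Matrix (Fin N) (Fin N) ℂ) ⊗ₖ F x).submatrix (Equiv.prodAssoc _ _ _)
    (Equiv.prodAssoc _ _ _), (continuous_kronecker _ F.continuous).matrix_submatrix _ _⟩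

omit [Fintype ι] [DecidableEq ι] in
theorem multiple_apply (N : ℕ) (F : C(H.X, Matrix (ι × Fin H.r) (ι × Fin H.r) ℂ)) (x : H.X) :
    H.multiple N F x = ((1 : Matrix (Fin N) (Fin N) ℂ) ⊗ₖ F x).submatrix (Equiv.prodAssoc _ _ _)
    (Equiv.prodAssoc _ _ _) := rfl

omit [Fintype ι] in
theorem amp_prod (N : ℕ) : H.amp (Fin N × ι) = H.multiple N (H.amp ι) := by
  ext x ⟨⟨a, i⟩, ρ⟩ ⟨⟨b, j⟩, σ⟩
  simp only [multiple_apply, amp_apply, Matrix.submatrix_apply, Matrix.kroneckerMap_apply,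
    Equiv.prodAssoc_apply, Matrix.one_apply, Prod.mk.injEq]
  by_cases h1 : a = b <;> by_cases h2 : i = j <;> simp [h1, h2]

theorem IsProjFun.multiple {F : C(H.X, Matrix (ι × Fin H.r) (ι × Fin H.r) ℂ)}
    (hF : H.IsProjFun F) (N : ℕ) : H.IsProjFun (H.multiple N F) where
  isStarProjection x :=
    { isIdempotentElem := by
        unfold IsIdempotentElem
        rw [multiple_apply, Matrix.submatrix_mul_equiv, ← Matrix.mul_kronecker_mul, Matrix.one_mul,
          (hF.isStarProjection x).isIdempotentElem.eq]
      isSelfAdjoint := by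
        have h1 : (F x)ᴴ = F x := (hF.isStarProjection x).isSelfAdjoint.star_eq
        change (H.multiple N F x)ᴴ = _
        rw [multiple_apply, Matrix.conjTranspose_submatrix, Matrix.conjTranspose_kronecker,
          Matrix.conjTranspose_one, h1] }
  amp_mul x := by
    rw [amp_prod, multiple_apply, multiple_apply, Matrix.submatrix_mul_equiv,
      ← Matrix.mul_kronecker_mul, Matrix.one_mul, hF.amp_mul]

omit [DecidableEq ι] in
theorem trace_multiple (N : ℕ) (F : C(H.X, Matrix (ι × Fin H.r) (ι × Fin H.r) ℂ)) (x : H.X) :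
    (H.multiple N F x).trace = N * (F x).trace := by
  have h := Equiv.sum_comp (Equiv.prodAssoc (Fin N) ι (Fin H.r)) fun i =>
    ((1 : Matrix (Fin N) (Fin N) ℂ) ⊗ₖ F x) i i
  have h1 : (H.multiple N F x).trace = ((1 : Matrix (Fin N) (Fin N) ℂ) ⊗ₖ F x).trace := h
  rw [h1, Matrix.trace_kronecker, Matrix.trace_one]
  simp

omit [Fintype ι] [DecidableEq ι] in
theorem lift_multiple (N : ℕ) (F : C(H.X, Matrix (ι × Fin H.r) (ι × Fin H.r) ℂ)) :
    H.lift (H.multiple N F) =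
      Matrix.of fun (i j : Fin N × ι) => if i.1 = j.1 then H.lift F i.2 j.2 else 0 := by
  ext ⟨a, i⟩ ⟨b, j⟩
  rw [lift_apply, Matrix.of_apply]
  by_cases h : a = b
  · subst h
    rw [if_pos rfl, lift_apply]
    congr 1
    ext1 x
    ext ρ σ
    simp [block_apply, multiple_apply]
  · rw [if_neg h, ← map_zero H.toAlg]
    congr 1
    ext1 x
    ext ρ σ
    simp [block_apply, multiple_apply, h]

variable {s : K0 A →+ ℝ}

theorem projVal_lift_multiple {F : C(H.X, Matrix (ι × Fin H.r) (ι × Fin H.r) ℂ)}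
    (hF : H.IsProjFun F) (N : ℕ) :
    projVal s (H.lift (H.multiple N F)) = N * projVal s (H.lift F) := by
  rw [lift_multiple, projVal_kronecker_one hF.lift, Fintype.card_fin]

/-- The comparison of projection fields gives `N s(F) ≤ (N + l) s(G)` for all `N` with a fixed `l`.
-/
theorem projVal_lift_le (hs : s ∈ stateSpace A)
    {F : C(H.X, Matrix (ι × Fin H.r) (ι × Fin H.r) ℂ)}
    {G : C(H.X, Matrix (κ × Fin H.r) (κ × Fin H.r) ℂ)} (hF : H.IsProjFun F) (hG : H.IsProjFun G)
    (h : ∀ x, (F x).trace = (G x).trace) :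
    projVal s (H.lift F) ≤ projVal s (H.lift G) := by
  obtain ⟨l, hl⟩ := exists_leftInverse_kronecker F.continuous G.continuous hF.isStarProjection
    hG.isStarProjection h
  refine le_of_forall_nat_mul_le (l := l) fun N => ?_
  obtain ⟨T, Y, hT, hY, hTY⟩ := hl N
  let T' : C(H.X, Matrix ((Fin (N + l) × κ) × Fin H.r) ((Fin N × ι) × Fin H.r) ℂ) :=
    ⟨fun x => (T x).submatrix (Equiv.prodAssoc _ _ _) (Equiv.prodAssoc _ _ _),
      hT.matrix_submatrix _ _⟩
  let Y' : C(H.X, Matrix ((Fin N × ι) × Fin H.r) ((Fin (N + l) × κ) × Fin H.r) ℂ) :=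
    ⟨fun x => (Y x).submatrix (Equiv.prodAssoc _ _ _) (Equiv.prodAssoc _ _ _),
      hY.matrix_submatrix _ _⟩
  have h1 : ∀ x, H.multiple (N + l) G x * T' x = T' x := fun x => by
    change Matrix.submatrix _ _ _ * Matrix.submatrix _ _ _ = Matrix.submatrix _ _ _
    rw [Matrix.submatrix_mul_equiv, (hTY x).2]
  have h2 : ∀ x, Y' x * T' x = H.multiple N F x := fun x => by
    change Matrix.submatrix _ _ _ * Matrix.submatrix _ _ _ = Matrix.submatrix _ _ _
    rw [Matrix.submatrix_mul_equiv, (hTY x).1]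
  have h3 : ∀ x, H.amp (Fin (N + l) × κ) x * T' x = T' x := fun x => by
    rw [← h1, ← Matrix.mul_assoc, (hG.multiple H (N + l)).amp_mul]
  rw [← H.projVal_lift_multiple hF, ← H.projVal_lift_multiple hG]
  exact projVal_le_of_leftInverse hs (hF.multiple H N).lift (hG.multiple H (N + l)).lift (H.lift T')
    (H.lift Y') (H.lift_mul h2 h3) (H.lift_mul h1 h3)

theorem projVal_lift_eq (hs : s ∈ stateSpace A)
    {F : C(H.X, Matrix (ι × Fin H.r) (ι × Fin H.r) ℂ)}
    {G : C(H.X, Matrix (κ × Fin H.r) (κ × Fin H.r) ℂ)} (hF : H.IsProjFun F) (hG : H.IsProjFun G)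
    (h : ∀ x, (F x).trace = (G x).trace) :
    projVal s (H.lift F) = projVal s (H.lift G) :=
  (H.projVal_lift_le hs hF hG h).antisymm (H.projVal_lift_le hs hG hF fun x => (h x).symm)

/-- The function `F` cut down by a `0`-`1`-valued function. -/
def restr (χ : C(H.X, ℝ)) (F : C(H.X, Matrix (ι × Fin H.r) (ι × Fin H.r) ℂ)) :
    C(H.X, Matrix (ι × Fin H.r) (ι × Fin H.r) ℂ) :=
  ⟨fun x => (χ x : ℂ) • F x, by fun_prop⟩

omit [Fintype ι] [DecidableEq ι] in
theorem restr_apply (χ : C(H.X, ℝ)) (F : C(H.X, Matrix (ι × Fin H.r) (ι × Fin H.r) ℂ)) (x : H.X) :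
    H.restr χ F x = (χ x : ℂ) • F x := rfl

theorem IsProjFun.restr {F : C(H.X, Matrix (ι × Fin H.r) (ι × Fin H.r) ℂ)}
    (hF : H.IsProjFun F) {χ : C(H.X, ℝ)} (hχ : ∀ x, χ x = 0 ∨ χ x = 1) :
    H.IsProjFun (H.restr χ F) where
  isStarProjection x := by
    rw [restr_apply]
    rcases hχ x with h | h
    · rw [h, Complex.ofReal_zero, zero_smul]
      exact IsStarProjection.zero _
    · rw [h, Complex.ofReal_one, one_smul]
      exact hF.isStarProjection x
  amp_mul x := by rw [restr_apply, Matrix.mul_smul, hF.amp_mul]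

/-- On the support of `χ` the ranks are `k` and `R`, so `R` copies of `χ F` and `k` copies of `χ P`
have the same rank function. -/
theorem projVal_lift_restr (hs : s ∈ stateSpace A)
    {F : C(H.X, Matrix (ι × Fin H.r) (ι × Fin H.r) ℂ)} (hF : H.IsProjFun F) {χ : C(H.X, ℝ)}
    (hχ : ∀ x, χ x = 0 ∨ χ x = 1) {k R : ℕ}
    (hk : ∀ x, χ x ≠ 0 → (F x).trace = k ∧ (H.P x).trace = R) :
    R * projVal s (H.lift (H.restr χ F)) = k * projVal s (H.lift (H.restr χ (H.amp Unit))) := by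
  have h1 := hF.restr H hχ
  have h2 := (H.isProjFun_amp (ι := Unit)).restr H hχ
  rw [← H.projVal_lift_multiple h1, ← H.projVal_lift_multiple h2]
  refine H.projVal_lift_eq hs (h1.multiple H R) (h2.multiple H k) fun x => ?_
  rw [trace_multiple, trace_multiple, restr_apply, restr_apply, Matrix.trace_smul,
    Matrix.trace_smul, amp_apply, Matrix.trace_kronecker, Matrix.trace_one]
  by_cases hx : χ x = 0
  · simp [hx]
  · rw [(hk x hx).1, (hk x hx).2]
    simp
    ring

theorem projVal_lift_restr_eq (hs : s ∈ stateSpace A)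
    {F : C(H.X, Matrix (ι × Fin H.r) (ι × Fin H.r) ℂ)} (hF : H.IsProjFun F) {χ : C(H.X, ℝ)}
    (hχ : ∀ x, χ x = 0 ∨ χ x = 1) (ξ : H.X) (hk : ∀ x, χ x ≠ 0 →
      (F x).trace = (F ξ).trace ∧ (H.P x).trace = (H.P ξ).trace) :
    projVal s (H.lift (H.restr χ F)) = (F ξ).trace.re / (H.P ξ).trace.re *
      projVal s (H.lift (H.restr χ (H.amp Unit))) := by
  have h1 := trace_eq_rank (hF.isStarProjection ξ)
  have h2 := trace_eq_rank (H.isProj_apply ξ)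
  have h3 := H.projVal_lift_restr hs hF hχ fun x hx =>
    ⟨(hk x hx).1.trans h1, (hk x hx).2.trans h2⟩
  have h4 : (0 : ℝ) < ((H.P ξ).rank : ℝ) := by exact_mod_cast H.rank_pos ξ
  rw [h1, h2, Complex.natCast_re, Complex.natCast_re, div_mul_eq_mul_div, ← h3]
  field_simp

omit [Fintype ι] [DecidableEq ι] in
theorem lift_eq_sum_restr {o : Type*} [Fintype o] {χ : o → C(H.X, ℝ)}
    (hsum : ∀ x, ∑ j, χ j x = 1) (F : C(H.X, Matrix (ι × Fin H.r) (ι × Fin H.r) ℂ)) :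
    H.lift F = ∑ j, H.lift (H.restr (χ j) F) := by
  ext i i'
  rw [Matrix.sum_apply]
  simp only [lift_apply]
  rw [← map_sum]
  congr 1
  ext1 x
  have h1 : (∑ j, H.block (H.restr (χ j) F) i i') x = ∑ j, H.block (H.restr (χ j) F) i i' x :=
    map_sum (MatFun.eval x) _ _
  rw [h1]
  ext ρ σ
  rw [Matrix.sum_apply]
  simp only [block_apply, restr_apply, Matrix.smul_apply, smul_eq_mul]
  rw [← Finset.sum_mul, ← Complex.ofReal_sum, hsum]
  simp

/-- The value of a state of `K₀(A)` at a projection over `P M_r(C(X)) P` is determined by the rank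
function of the projection. -/
theorem projVal_lift_eq_sum (hs : s ∈ stateSpace A)
    {F : C(H.X, Matrix (ι × Fin H.r) (ι × Fin H.r) ℂ)} (hF : H.IsProjFun F) {o : Type*} [Fintype o]
    {χ : o → C(H.X, ℝ)} (hχ : ∀ j x, χ j x = 0 ∨ χ j x = 1) (hsum : ∀ x, ∑ j, χ j x = 1)
    (ξ : o → H.X) (hk : ∀ j x, χ j x ≠ 0 → (F x).trace = (F (ξ j)).trace ∧
      (H.P x).trace = (H.P (ξ j)).trace) :
    projVal s (H.lift F) = ∑ j, (F (ξ j)).trace.re / (H.P (ξ j)).trace.re *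
      projVal s (H.lift (H.restr (χ j) (H.amp Unit))) := by
  -- Values in `{0, 1}` with sum `1` force disjoint supports, so the pieces of `F` are orthogonal.
  have hmul : ∀ i j x, i ≠ j → χ i x * χ j x = 0 := by
    classical
    intro i j x hij
    rcases hχ i x with h | h
    · rw [h, zero_mul]
    · rcases hχ j x with h' | h'
      · rw [h', mul_zero]
      · have h1 : ∑ k ∈ {i, j}, χ k x ≤ ∑ k, χ k x :=
          Finset.sum_le_sum_of_subset_of_nonneg (Finset.subset_univ _) fun k _ _ => by
            rcases hχ k x with h0 | h0 <;> simp [h0]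
        rw [hsum, Finset.sum_pair hij, h, h'] at h1
        norm_num at h1
  rw [H.lift_eq_sum_restr hsum F, projVal_sum _ fun j _ => (hF.restr H (hχ j)).lift]
  · exact Finset.sum_congr rfl fun j _ => H.projVal_lift_restr_eq hs hF (hχ j) (ξ j) (hk j)
  · intro i _ j _ hij
    have h0 : H.lift (0 : C(H.X, Matrix (ι × Fin H.r) (ι × Fin H.r) ℂ)) = 0 := by
      ext a b
      exact map_zero H.toAlg
    rw [← h0]
    refine H.lift_mul (fun x => ?_) (hF.restr H (hχ j)).amp_mul
    rw [restr_apply, restr_apply, Matrix.smul_mul, Matrix.mul_smul, smul_smul, ← Complex.ofReal_mul,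
      hmul i j x hij]
    simp

end HomogeneousSubalgebra

/-- A compact space has a finite partition into clopen sets on which finitely many integer-valued
continuous functions are constant. -/
theorem exists_clopen_partition {X : Type*} [TopologicalSpace X] [CompactSpace X] {o : Type*}
    [Finite o] {f : o → X → ℂ} (hf : ∀ a, Continuous (f a)) (hn : ∀ a x, ∃ n : ℕ, f a x = n) :
    ∃ (t : Finset X) (χ : t → C(X, ℝ)), (∀ j x, χ j x = 0 ∨ χ j x = 1) ∧ (∀ x, ∑ j, χ j x = 1) ∧
      ∀ j x, χ j x ≠ 0 → ∀ a, f a x = f a j := by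
  classical
  -- `ψ` picks one point from each joint level set. Naturals at distance less than `1` are equal, so
  -- `ψ` is locally constant, and compactness makes its range finite.
  let S : Setoid X := Setoid.ker fun x a => f a x
  let ψ : X → X := fun x => (Quotient.mk S x).out
  have hψ1 : ∀ x a, f a (ψ x) = f a x := fun x a =>
    congrFun (Quotient.exact (s := S) (Quotient.out_eq (Quotient.mk S x))) a
  have hψ : IsLocallyConstant ψ := by
    rw [IsLocallyConstant.iff_eventually_eq]
    intro x
    have h1 : ∀ᶠ y in nhds x, ∀ a, f a y = f a x := by
      rw [Filter.eventually_all]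
      intro a
      filter_upwards [Metric.tendsto_nhds.1 (hf a).continuousAt 1 one_pos] with y hy
      obtain ⟨m, hm⟩ := hn a x
      obtain ⟨n, hn⟩ := hn a y
      rw [hm, hn] at hy ⊢
      rw [dist_eq_norm] at hy
      have h2 : ‖((n : ℤ) - (m : ℤ) : ℂ)‖ < 1 := by simpa using hy
      rw [← Int.cast_sub, Complex.norm_intCast] at h2
      have h3 : |((n : ℤ) - m)| < 1 := by exact_mod_cast h2
      have h4 : (n : ℤ) - m = 0 := Int.abs_lt_one_iff.1 h3
      have h5 : n = m := by omega
      rw [h5]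
    filter_upwards [h1] with y hy
    have : Quotient.mk S y = Quotient.mk S x := Quotient.sound (s := S) (funext hy)
    simp only [ψ, this]
  have hfin : (Set.range ψ).Finite := hψ.range_finite
  let χ : hfin.toFinset → C(X, ℝ) := fun j =>
    ⟨fun x => if ψ x = j then 1 else 0, (hψ.comp fun y => if y = j then (1 : ℝ) else 0).continuous⟩
  refine ⟨hfin.toFinset, χ, fun j x => ?_, fun x => ?_, fun j x hx a => ?_⟩
  · by_cases h : ψ x = j <;> simp [χ, h]
  · rw [Finset.sum_eq_single ⟨ψ x, by simp⟩]
    · simp [χ]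
    · rintro ⟨y, hy⟩ _ hne
      have : ψ x ≠ y := fun h => hne (Subtype.ext h.symm)
      simp [χ, this]
    · simp
  · have : ψ x = j := by
      by_contra h
      simp [χ, h] at hx
    rw [← this, hψ1]

end TracialAH

end

/-! ### Perturbing almost projections to projections. -/

noncomputable section

namespace TracialAH

section Perturbation

/-- A continuous function that is `0` below `1/3` and `1` above `2/3`. -/
def step (t : ℝ) : ℝ := max 0 (min 1 (3 * t - 1))

/-- On `[1/3, 2/3]` one has `t (1 - t) ≥ 2/9`, so `t` lies outside. There one of the factors `|t|`,
`|1 - t|` is at least `2/3`, which bounds the other by `3w/2`. -/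
theorem step_eq {w t : ℝ} (hw : w < 2 / 9) (h : |t * t - t| ≤ w) :
    (step t = 0 ∨ step t = 1) ∧ |step t - t| ≤ 2 * w := by
  have h1 := abs_le.1 h
  have hw0 : 0 ≤ w := (abs_nonneg _).trans h
  rcases lt_or_ge t (1 / 3) with ht | ht
  · have hs : step t = 0 := by
      rw [step, max_eq_left]
      exact (min_le_right _ _).trans (by linarith)
    rw [hs]
    refine ⟨Or.inl rfl, ?_⟩
    rw [zero_sub, abs_neg, abs_le]
    constructor <;> nlinarith
  · have ht' : 2 / 3 < t := by
      by_contra hc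
      nlinarith
    have hs : step t = 1 := by
      rw [step, min_eq_left (by linarith), max_eq_right zero_le_one]
    rw [hs]
    refine ⟨Or.inr rfl, ?_⟩
    rw [abs_le]
    constructor <;> nlinarith

/-- `step b` is the projection: `step` is `0` or `1` on the quasispectrum, and `step 0 = 0` keeps it
in the closed non-unital subalgebra. -/
theorem exists_projection_near {B : Type*} [NonUnitalCStarAlgebra B] {b : B}
    (hb : IsSelfAdjoint b) {w : ℝ} (hw : w < 2 / 9) (h : ‖b * b - b‖ ≤ w)
    (S : NonUnitalStarSubalgebra ℂ B) (hS : IsClosed (S : Set B)) (hbS : b ∈ S) :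
    ∃ e ∈ S, IsStarProjection e ∧ ‖e - b‖ ≤ 2 * w := by
  have : IsClosed (S : Set B) := hS
  have hc : Continuous step := by
    unfold step
    fun_prop
  have h0 : step 0 = 0 := by norm_num [step]
  have hbb : cfcₙ (fun t : ℝ => t * t - t) b = b * b - b := by
    rw [cfcₙ_sub (fun t : ℝ => t * t) (fun t => t) b, cfcₙ_mul (fun t : ℝ => t) (fun t => t) b,
      cfcₙ_id' ℝ b]
  have hsp : ∀ t ∈ quasispectrum ℝ b, |t * t - t| ≤ w := by
    intro t ht
    refine (norm_apply_le_norm_cfcₙ (fun t : ℝ => t * t - t) b ht).trans ?_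
    rw [hbb]
    exact h
  refine ⟨cfcₙ step b, cfcₙ_mem (𝕜' := ℂ) _ hbS, ⟨?_, cfcₙ_predicate _ b⟩, ?_⟩
  · unfold IsIdempotentElem
    rw [← cfcₙ_mul step step b hc.continuousOn h0 hc.continuousOn h0]
    refine cfcₙ_congr fun t ht => ?_
    rcases (step_eq hw (hsp t ht)).1 with h1 | h1 <;> simp [h1]
  · have : cfcₙ (fun t => step t - t) b = cfcₙ step b - b := by
      rw [cfcₙ_sub step (fun t => t) b hc.continuousOn h0, cfcₙ_id' ℝ b]
    rw [← this]
    exact norm_cfcₙ_le fun t ht => (step_eq hw (hsp t ht)).2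

variable {A : Type*} [CStarAlgebra A] {ι : Type*} [Fintype ι]

/-- The element `1 - (e - q)²` maps `e` to `e q e`. If it is invertible, then `q e` has a left
inverse on the range of `e` and maps into that of `q`. -/
theorem projVal_le_of_isUnit [DecidableEq ι] {s : K0 A →+ ℝ} (hs : s ∈ stateSpace A)
    {e q : Matrix ι ι A} (he : IsStarProjection e) (hq : IsStarProjection q)
    (h : IsUnit (1 - (e - q) * (e - q))) : projVal s e ≤ projVal s q := by
  obtain ⟨u, hu⟩ := h
  have he2 := he.mul_self_eq
  have hq2 := hq.mul_self_eq
  have h1 : (u : Matrix ι ι A) * e = e * q * e := by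
    rw [hu]
    simp only [sub_mul, mul_sub, one_mul, he2, hq2]
    rw [Matrix.mul_assoc q e e, he2]
    abel
  refine projVal_le_of_leftInverse hs he hq (q * e) (u.inv * e * q) ?_ ?_
  · calc (u.inv * e * q) * (q * e) = u.inv * (e * (q * q) * e) := by simp only [Matrix.mul_assoc]
      _ = u.inv * (u.val * e) := by rw [hq2, h1]
      _ = e := by rw [← Matrix.mul_assoc, u.inv_val, Matrix.one_mul]
  · rw [← Matrix.mul_assoc, hq2]

theorem projVal_eq_of_isUnit [DecidableEq ι] {s : K0 A →+ ℝ} (hs : s ∈ stateSpace A)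
    {e q : Matrix ι ι A} (he : IsStarProjection e) (hq : IsStarProjection q)
    (h : IsUnit (1 - (e - q) * (e - q))) : projVal s e = projVal s q := by
  refine (projVal_le_of_isUnit hs he hq h).antisymm (projVal_le_of_isUnit hs hq he ?_)
  have : (q - e) * (q - e) = (e - q) * (e - q) := by
    rw [← neg_sub e q, neg_mul_neg]
  rwa [this]

/-- The matrices with entries in a subalgebra. -/
def matrixSubalgebra (S : NonUnitalStarSubalgebra ℂ A) (ι : Type*) [Fintype ι] :
    NonUnitalStarSubalgebra ℂ (CStarMatrix ι ι A) where
  carrier := {M | ∀ i j, M i j ∈ S}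
  add_mem' ha hb i j := add_mem (ha i j) (hb i j)
  zero_mem' _ _ := zero_mem S
  mul_mem' ha hb i j := by
    rw [CStarMatrix.mul_apply]
    exact sum_mem fun k _ => mul_mem (ha i k) (hb k j)
  smul_mem' c _ ha i j := SMulMemClass.smul_mem c (ha i j)
  star_mem' ha i j := star_mem (ha j i)

/-- A projection whose entries are close to a closed subalgebra is close to a projection with
entries in this subalgebra, which has the same class. -/
theorem exists_approx_projection {q : Matrix ι ι A} (hq : IsStarProjection q) {δ : ℝ}
    (hδ : 0 < δ) : ∃ ε > 0, ∀ S : NonUnitalStarSubalgebra ℂ A, IsClosed (S : Set A) →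
      (∀ i j, ∃ y ∈ S, ‖q i j - y‖ < ε) → ∃ e : Matrix ι ι A, IsStarProjection e ∧
        (∀ i j, e i j ∈ S) ∧ (∀ i j, ‖q i j - e i j‖ < δ) ∧
        ∀ s ∈ stateSpace A, projVal s e = projVal s q := by
  classical
  let _ := CStarAlgebra.spectralOrder A
  have _ := CStarAlgebra.spectralOrderedRing A
  let B := CStarMatrix ι ι A
  let Q : B := q
  have hQ1 : star Q = Q := hq.conjTranspose_eq
  have hQ2 : Q * Q = Q := hq.mul_self_eq
  let b : B → B := fun y => (2⁻¹ : ℂ) • (y + star y)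
  have hsa : ∀ y, IsSelfAdjoint (b y) := fun y => by
    rw [IsSelfAdjoint]
    simp only [b]
    rw [star_smul, star_add, star_star, add_comm]
    simp
  have hbQ : b Q = Q := by
    simp only [b, hQ1, ← two_smul ℂ Q, smul_smul]
    norm_num
  -- A continuous bound for the total distance from `Q` to the projection obtained by symmetrizing
  -- `y` and applying `step`; it vanishes at `Q`.
  let φ : B → ℝ := fun y => 2 * ‖b y * b y - b y‖ + ‖Q - b y‖
  have hb : Continuous b := by fun_prop
  have hφ : Continuous φ := by fun_prop
  have hφ0 : φ Q = 0 := by simp [φ, hbQ, hQ2]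
  have hδ' : 0 < min δ (1 / 9) := by positivity
  -- Openness is taken in the entrywise product topology, which converts entrywise closeness into
  -- closeness in the C*-norm.
  have hopen : IsOpen {y : ι → ι → A | φ y < min δ (1 / 9)} := isOpen_lt hφ continuous_const
  obtain ⟨ε, hε, hball⟩ := Metric.isOpen_iff.1 hopen q (by
    change φ Q < _
    rwa [hφ0])
  refine ⟨ε, hε, fun S hS hy => ?_⟩
  choose y hyS hyq using hy
  have h1 : φ y < min δ (1 / 9) := by
    refine hball (Metric.mem_ball.2 ?_)
    refine (dist_pi_lt_iff hε).2 fun i => (dist_pi_lt_iff hε).2 fun j => ?_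
    rw [dist_comm, dist_eq_norm]
    exact hyq i j
  have hbsa : IsSelfAdjoint (b y) := hsa y
  have hyM : y ∈ matrixSubalgebra S ι := hyS
  have hbM : b y ∈ matrixSubalgebra S ι :=
    SMulMemClass.smul_mem _ (add_mem hyM (star_mem hyM))
  have hclosed : IsClosed (matrixSubalgebra S ι : Set B) := by
    have h2 : (matrixSubalgebra S ι : Set B) = ⋂ i, ⋂ j, {M : ι → ι → A | M i j ∈ S} := by
      ext M
      exact ⟨fun h => Set.mem_iInter.2 fun i => Set.mem_iInter.2 fun j => h i j,
        fun h i j => Set.mem_iInter.1 (Set.mem_iInter.1 h i) j⟩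
    rw [h2]
    exact isClosed_iInter fun i => isClosed_iInter fun j =>
      hS.preimage (show Continuous fun M : ι → ι → A => M i j by fun_prop)
  have hw1 : 2 * ‖b y * b y - b y‖ < 1 / 9 := by
    have := h1.trans_le (min_le_right _ _)
    simp only [φ] at this
    linarith [norm_nonneg (Q - b y)]
  obtain ⟨e, heM, he, heb⟩ := exists_projection_near hbsa (by linarith) le_rfl
    (matrixSubalgebra S ι) hclosed hbM
  have hQe : ‖Q - e‖ < min δ (1 / 9) := by
    refine lt_of_le_of_lt ?_ h1
    calc ‖Q - e‖ ≤ ‖Q - b y‖ + ‖b y - e‖ := norm_sub_le_norm_sub_add_norm_sub _ _ _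
      _ ≤ φ y := by
        simp only [φ]
        rw [norm_sub_rev (b y) e]
        linarith
  have he' : @IsStarProjection (Matrix ι ι A) _ _ e := ⟨he.isIdempotentElem, he.isSelfAdjoint⟩
  refine ⟨e, he', heM, fun i j => ?_, fun s hs => ?_⟩
  · exact (CStarMatrix.norm_entry_le_norm (M := Q - e)).trans_lt (hQe.trans_le (min_le_left _ _))
  · refine projVal_eq_of_isUnit hs he' hq ?_
    have h3 : ‖(e - Q) * (e - Q)‖ < 1 := by
      have h4 : ‖e - Q‖ < 1 / 9 := by
        rw [norm_sub_rev]
        exact hQe.trans_le (min_le_right _ _)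
      refine (norm_mul_le _ _).trans_lt ?_
      nlinarith [norm_nonneg (e - Q)]
    obtain ⟨u, hu⟩ := isUnit_one_sub_of_norm_lt_one h3
    exact ⟨⟨u.val, u.inv, u.val_inv, u.inv_val⟩, hu⟩

end Perturbation

end TracialAH

end

/-! ### Cutting projections down to a homogeneous subalgebra, and limits of approximate traces. -/

noncomputable section

namespace TracialAH

section Decomposition

variable {A : Type*} [CStarAlgebra A] {ι : Type*} [Fintype ι] [DecidableEq ι]

theorem isStarProjection_diagonal {p : A} (hp : IsStarProjection p) :
    IsStarProjection (Matrix.diagonal fun _ : ι => p) where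
  isIdempotentElem := by
    unfold IsIdempotentElem
    rw [Matrix.diagonal_mul_diagonal, hp.isIdempotentElem.eq]
  isSelfAdjoint := by
    change (Matrix.diagonal fun _ : ι => p)ᴴ = _
    rw [Matrix.diagonal_conjTranspose]
    congr 1
    exact funext fun _ => hp.isSelfAdjoint.star_eq

/-- The `K₀`-version of the smallness of `1 - p`: `m` orthogonal copies of `diag(p, …, p)` fit below
`1`. -/
theorem nsmul_projVal_diagonal_le {s : K0 A →+ ℝ} (hs : s ∈ stateSpace A) {p : A}
    (hp : IsStarProjection p) {m : ℕ} {v : Fin m → A} (hv : ∀ i, star (v i) * v i = p)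
    (hvv : ∀ i j, i ≠ j → star (v i) * v j = 0) :
    m * projVal s (Matrix.diagonal fun _ : ι => p) ≤ projVal s (1 : Matrix ι ι A) := by
  let D : Matrix ι ι A := Matrix.diagonal fun _ => p
  let V : Fin m → Matrix ι ι A := fun i => Matrix.diagonal fun _ => v i
  let W : Fin m → Matrix ι ι A := fun i => Matrix.diagonal fun _ => v i * star (v i)
  have hD : IsStarProjection D := isStarProjection_diagonal hp
  have hW : ∀ i, IsStarProjection (W i) := fun i =>
    isStarProjection_diagonal (isStarProjection_mul_star hp (hv i))
  have hVs : ∀ i, (V i)ᴴ = Matrix.diagonal fun _ => star (v i) := fun i => by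
    rw [Matrix.diagonal_conjTranspose]
    rfl
  have h0 : ∀ i j, i ≠ j → W i * W j = 0 := fun i j hij => by
    simp only [W]
    rw [Matrix.diagonal_mul_diagonal, mul_star_mul_mul_star_eq_zero (hvv i j hij),
      Matrix.diagonal_zero]
  have h1 : projVal s (∑ i, W i) = m * projVal s D := by
    rw [projVal_sum _ (fun i _ => hW i) fun i _ j _ hij => h0 i j hij,
      Finset.sum_congr rfl fun i _ => (projVal_eq_of_mul hD (hW i) (V i)
        (by rw [hVs, Matrix.diagonal_mul_diagonal, hv])
        (by rw [hVs, Matrix.diagonal_mul_diagonal])).symm]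
    simp
  rw [← h1]
  exact projVal_le hs (isStarProjection_sum _ (fun i _ => hW i) fun i _ j _ hij => h0 i j hij)
    (IsStarProjection.one _) (mul_one _)

namespace HomogeneousSubalgebra

variable (H : HomogeneousSubalgebra A)

theorem unit_mul_mul_unit_mul {a b : A} (ha : a ∈ H.cut) :
    H.unit * a * (H.unit * b) = H.unit * (a * b) := by
  rw [ha.1, mul_assoc, ← mul_assoc H.unit H.unit, H.isStarProjection.isIdempotentElem.eq,
    ← mul_assoc, ← ha.1, mul_assoc]

/-- The entries of `p e` come from unique matrix functions, and injectivity of the embedding carries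
the projection identities over to these functions. -/
theorem exists_isProjFun {e : Matrix ι ι A} (he : IsStarProjection e)
    (hcut : ∀ i j, e i j ∈ H.cut) :
    ∃ F : C(H.X, Matrix (ι × Fin H.r) (ι × Fin H.r) ℂ), H.IsProjFun F ∧
      ∀ i j, H.lift F i j = H.unit * e i j := by
  have h0 : ∀ i j, ∃ c ∈ corner H.P H.isProj, H.toAlg c = H.unit * e i j := fun i j =>
    (hcut i j).2
  choose c hc hce using h0
  have hinj : ∀ {a b : MatFun H.X H.r}, a ∈ corner H.P H.isProj → b ∈ corner H.P H.isProj →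
      H.toAlg a = H.toAlg b → a = b := fun ha hb h =>
    sub_eq_zero.1 (H.toAlg_injective (sub_mem ha hb) (by rw [map_sub, h, sub_self]))
  have hmul : ∀ i j, ∑ k, c i k * c k j = c i j := by
    intro i j
    refine hinj (sum_mem fun k _ => mul_mem (hc i k) (hc k j)) (hc i j) ?_
    rw [map_sum, hce]
    conv_rhs => rw [← he.mul_self_eq, Matrix.mul_apply, Finset.mul_sum]
    refine Finset.sum_congr rfl fun k _ => ?_
    rw [H.toAlg_mul (hc i k) (hc k j), hce, hce, H.unit_mul_mul_unit_mul (hcut i k)]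
  have hstar : ∀ i j, star (c j i) = c i j := by
    intro i j
    refine hinj (star_mem (hc j i)) (hc i j) ?_
    rw [H.toAlg_star, hce, hce, StarMul.star_mul, H.isStarProjection.isSelfAdjoint.star_eq,
      ← Matrix.conjTranspose_apply, he.conjTranspose_eq, (hcut i j).1]
  let F : C(H.X, Matrix (ι × Fin H.r) (ι × Fin H.r) ℂ) :=
    ⟨fun x => Matrix.of fun a b => c a.1 b.1 x a.2 b.2,
      continuous_matrix fun a b => (MatFun.continuous (c a.1 b.1)).matrix_elem _ _⟩
  have hF : ∀ x i j ρ σ, F x (i, ρ) (j, σ) = c i j x ρ σ := fun x i j ρ σ => rfl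
  refine ⟨F, ⟨fun x => ⟨?_, ?_⟩, fun x => ?_⟩, fun i j => ?_⟩
  · unfold IsIdempotentElem
    ext ⟨i, ρ⟩ ⟨j, σ⟩
    rw [Matrix.mul_apply, Fintype.sum_prod_type]
    have h1 : (∑ k, c i k * c k j) x = ∑ k, (c i k * c k j) x := map_sum (MatFun.eval x) _ _
    rw [hF, ← hmul, h1, Matrix.sum_apply]
    refine Finset.sum_congr rfl fun k _ => ?_
    rw [MatFun.mul_apply, Matrix.mul_apply]
    rfl
  · change (F x)ᴴ = F x
    ext ⟨i, ρ⟩ ⟨j, σ⟩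
    rw [Matrix.conjTranspose_apply, hF, hF, ← hstar i j]
    rfl
  · ext ⟨i, ρ⟩ ⟨j, σ⟩
    rw [Matrix.mul_apply, Fintype.sum_prod_type, Finset.sum_eq_single i]
    · have h1 : H.P x * c i j x = c i j x :=
        congrArg (fun f : MatFun H.X H.r => f x) (mem_corner_iff'.1 (hc i j)).1
      rw [hF, ← h1, Matrix.mul_apply]
      refine Finset.sum_congr rfl fun τ _ => ?_
      rw [amp_apply, Matrix.kroneckerMap_apply, Matrix.one_apply_eq, one_mul, hF]
    · intro k _ hk
      refine Finset.sum_eq_zero fun τ _ => ?_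
      rw [amp_apply, Matrix.kroneckerMap_apply, Matrix.one_apply_ne hk.symm, zero_mul, zero_mul]
    · simp
  · rw [← hce]
    rfl

/-- `e` splits orthogonally into `p e` and `(1-p) e`, and the second summand lies below `diag(1-p,
…, 1-p)`. -/
theorem abs_projVal_sub_le {s : K0 A →+ ℝ} (hs : s ∈ stateSpace A) {e : Matrix ι ι A}
    (he : IsStarProjection e) (hcut : ∀ i j, e i j ∈ H.cut)
    {F : C(H.X, Matrix (ι × Fin H.r) (ι × Fin H.r) ℂ)} (hF : H.IsProjFun F)
    (hFe : ∀ i j, H.lift F i j = H.unit * e i j) {m : ℕ} {v : Fin m → A}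
    (hv : ∀ i, star (v i) * v i = 1 - H.unit) (hvv : ∀ i j, i ≠ j → star (v i) * v j = 0) :
    m * |projVal s e - projVal s (H.lift F)| ≤ projVal s (1 : Matrix ι ι A) := by
  have hu := H.isStarProjection
  set D : Matrix ι ι A := Matrix.diagonal fun _ => 1 - H.unit with hDdef
  have hD : IsStarProjection D := isStarProjection_diagonal hu.one_sub
  have hcomm : Commute D e := by
    rw [commute_iff_eq]
    ext i j
    rw [hDdef, Matrix.diagonal_mul, Matrix.mul_diagonal, sub_mul, mul_sub, one_mul, mul_one,
      (hcut i j).1]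
  have hDe : IsStarProjection (D * e) := hD.mul he hcomm
  have hsum : H.lift F + D * e = e := by
    ext i j
    rw [Matrix.add_apply, hFe, hDdef, Matrix.diagonal_mul, sub_mul, one_mul, add_sub_cancel]
  have horth : H.lift F * (D * e) = 0 := by
    have h1 : H.lift F = e - D * e := eq_sub_of_add_eq hsum
    rw [h1, sub_mul, hDe.mul_self_eq, ← Matrix.mul_assoc, ← hcomm.eq, Matrix.mul_assoc,
      he.mul_self_eq, sub_self]
  have h2 : projVal s e = projVal s (H.lift F) + projVal s (D * e) := by
    rw [← projVal_add hF.lift hDe horth, hsum]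
  rw [h2, add_sub_cancel_left, abs_of_nonneg (projVal_nonneg hs _)]
  refine le_trans ?_ (nsmul_projVal_diagonal_le hs hu.one_sub hv hvv)
  refine mul_le_mul_of_nonneg_left (projVal_le hs hDe hD ?_) (Nat.cast_nonneg m)
  rw [hcomm.eq, Matrix.mul_assoc, hD.mul_self_eq]

end HomogeneousSubalgebra

end Decomposition

section Limit

variable {A : Type*} [CStarAlgebra A]

open Filter in
/-- A limit of functionals that are tracial on larger and larger subsets. -/
theorem exists_trace_of_approx {L : ℝ} {s : MatProj A → ℝ} {M : A → ℝ}
    (h : ∀ (F : Finset A) (G : Finset (MatProj A)) (δ : ℝ), 0 < δ →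
      ∃ (f : A →ₗ[ℂ] ℂ) (C : Set A), (∀ a, ‖f a‖ ≤ L * ‖a‖) ∧ (∀ x ∈ F, ∃ y ∈ C, ‖x - y‖ < δ) ∧
        (∀ x ∈ C, ∀ y ∈ C, f (x * y) = f (y * x)) ∧ (∀ x ∈ C, 0 ≤ f (star x * x)) ∧
        (∀ x, (f (star x * x)).re ≤ M x) ∧ ∀ q ∈ G, |(f (Matrix.trace q.mat)).re - s q| ≤ δ) :
    ∃ t : A →ₗ[ℂ] ℂ, IsPositiveTrace t ∧ (∀ x, (t (star x * x)).re ≤ M x) ∧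
      ∀ q : MatProj A, (t (Matrix.trace q.mat)).re = s q := by
  classical
  let I := Finset A × Finset (MatProj A) × ℕ
  have h' := fun i : I => h i.1 i.2.1 (1 / ((i.2.2 : ℝ) + 1)) (by positivity)
  choose f C hfL hFC htr hpos hM hs using h'
  -- An ultrafilter makes all the bounded families `f i a` converge at once, whatever the size of
  -- `A`.
  let U : Ultrafilter I := Ultrafilter.of atTop
  have hU : (U : Filter I) ≤ atTop := Ultrafilter.of_le _
  have hlim : ∀ a, ∃ z, Tendsto (fun i => f i a) U (nhds z) := by
    intro a
    obtain ⟨z, -, hz⟩ := (isCompact_closedBall (0 : ℂ) (L * ‖a‖)).ultrafilter_le_nhds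
      (U.map fun i => f i a) (by
        rw [Filter.le_principal_iff, Ultrafilter.coe_map, Filter.mem_map]
        exact Filter.univ_mem' fun i => mem_closedBall_zero_iff.2 (hfL i a))
    exact ⟨z, hz⟩
  choose t ht using hlim
  have hδ : Tendsto (fun i : I => 1 / ((i.2.2 : ℝ) + 1)) U (nhds 0) := by
    refine Tendsto.mono_left ?_ hU
    have h1 : Tendsto (fun i : I => i.2.2) atTop atTop :=
      tendsto_atTop.2 fun n => (eventually_ge_atTop ((∅, ∅, n) : I)).mono fun i hi => hi.2.2
    exact tendsto_one_div_add_atTop_nhds_zero_nat.comp h1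
  let T : A →ₗ[ℂ] ℂ :=
    { toFun := t
      map_add' := fun a b => tendsto_nhds_unique (ht (a + b)) (by
        simpa only [map_add] using (ht a).add (ht b))
      map_smul' := fun c a => tendsto_nhds_unique (ht (c • a)) (by
        simpa only [map_smul, RingHom.id_apply] using (ht a).const_smul c) }
  have happrox : ∀ x : A, ∃ y : I → A, Tendsto y U (nhds x) ∧ ∀ᶠ i in U, y i ∈ C i := by
    intro x
    have h1 : ∀ i, ∃ y, x ∈ i.1 → y ∈ C i ∧ ‖x - y‖ < 1 / ((i.2.2 : ℝ) + 1) := fun i => by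
      by_cases hx : x ∈ i.1
      · obtain ⟨y, hy1, hy2⟩ := hFC i x hx
        exact ⟨y, fun _ => ⟨hy1, hy2⟩⟩
      · exact ⟨0, fun h => absurd h hx⟩
    choose y hy using h1
    have h2 : ∀ᶠ i in (U : Filter I), x ∈ i.1 :=
      hU ((eventually_ge_atTop (({x}, ∅, 0) : I)).mono fun i hi => hi.1 (by simp))
    refine ⟨y, ?_, h2.mono fun i hi => (hy i hi).1⟩
    rw [tendsto_iff_norm_sub_tendsto_zero]
    refine squeeze_zero' (Eventually.of_forall fun i => norm_nonneg _) (h2.mono fun i hi => ?_) hδ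
    rw [norm_sub_rev]
    exact (hy i hi).2.le
  -- The uniform bound `L` allows the argument to move with the index. This is needed because `f i`
  -- is tracial and positive only on its own set `C i`.
  have hconv : ∀ {a : A} {y : I → A}, Tendsto y U (nhds a) →
      Tendsto (fun i => f i (y i)) U (nhds (t a)) := by
    intro a y hy
    have h1 : Tendsto (fun i => f i (y i - a)) U (nhds 0) := by
      refine squeeze_zero_norm (fun i => hfL i _) ?_
      have h2 := (tendsto_iff_norm_sub_tendsto_zero.1 hy).const_mul L
      rwa [mul_zero] at h2
    have h3 := h1.add (ht a)
    simpa using h3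
  refine ⟨T, ⟨fun x => ?_, fun x y => ?_⟩, fun x => ?_, fun q => ?_⟩
  · obtain ⟨x', hx, hxC⟩ := happrox x
    exact ge_of_tendsto (hconv (hx.star.mul hx)) (hxC.mono fun i hi => hpos i _ hi)
  · obtain ⟨x', hx, hxC⟩ := happrox x
    obtain ⟨y', hy, hyC⟩ := happrox y
    refine tendsto_nhds_unique (hconv (hx.mul hy)) ((hconv (hy.mul hx)).congr' ?_)
    filter_upwards [hxC, hyC] with i h1 h2
    exact htr i _ h2 _ h1
  · exact le_of_tendsto ((Complex.continuous_re.tendsto _).comp (ht (star x * x)))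
      (Eventually.of_forall fun i => hM i x)
  · have h2 : ∀ᶠ i in (U : Filter I), q ∈ i.2.1 :=
      hU ((eventually_ge_atTop ((∅, {q}, 0) : I)).mono fun i hi => hi.2.1 (by simp))
    refine tendsto_nhds_unique ((Complex.continuous_re.tendsto _).comp (ht (Matrix.trace q.mat))) ?_
    rw [tendsto_iff_norm_sub_tendsto_zero]
    exact squeeze_zero' (Eventually.of_forall fun i => norm_nonneg _)
      (h2.mono fun i hi => hs i q hi) hδ

end Limit

section Values

variable {A : Type*} [CStarAlgebra A]

theorem K0.hom_ext {s s' : K0 A →+ ℝ}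
    (h : ∀ q : MatProj A, projVal s q.mat = projVal s' q.mat) : s = s' := by
  refine Algebra.GrothendieckAddGroup.lift.symm.injective (AddMonoidHom.ext ?_)
  rintro ⟨q⟩
  have h1 := h q
  rw [projVal_fin q.isProj, projVal_fin q.isProj] at h1
  exact h1

theorem projVal_one_fin_one {s : K0 A →+ ℝ} (hs : s ∈ stateSpace A) :
    projVal s (1 : Matrix (Fin 1) (Fin 1) A) = 1 := by
  rw [projVal_fin (IsStarProjection.one _)]
  exact hs.2

theorem projVal_traceK0 {t : A →ₗ[ℂ] ℂ} (ht : IsPositiveTrace t) {ι : Type*} [Fintype ι]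
    {e : Matrix ι ι A} (he : IsStarProjection e) :
    projVal (traceK0 t ht) e = (t (Matrix.trace e)).re := by
  rw [projVal_eq_reindex he (Fintype.equivFin ι)]
  have h := traceK0_cls t ht _ (MatProj.reindex (Fintype.equivFin ι) e he).isProj
  refine h.trans ?_
  congr 2
  exact Equiv.sum_comp (Fintype.equivFin ι).symm fun i => e i i

theorem IsPositiveTrace.apply_trace_eq_re {t : A →ₗ[ℂ] ℂ} (ht : IsPositiveTrace t) {ι : Type*}
    [Fintype ι] {e : Matrix ι ι A} (he : IsStarProjection e) :
    t (Matrix.trace e) = ((t (Matrix.trace e)).re : ℂ) := by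
  have h : 0 ≤ t (Matrix.trace e) := by
    rw [← he.mul_self_eq]
    nth_rewrite 1 [← he.conjTranspose_eq]
    simp only [Matrix.trace, Matrix.diag_apply, Matrix.mul_apply, map_sum,
      Matrix.conjTranspose_apply]
    exact Finset.sum_nonneg fun i _ => Finset.sum_nonneg fun j _ => ht.nonneg _
  exact Complex.eq_re_of_ofReal_le (r := 0) (by simpa using h)

end Values

end TracialAH

end

/-! ### Simultaneous approximation of elements and projections, and bounds for tracial states. -/

noncomputable section

namespace TracialAH

open scoped Matrix.Norms.L2Operator

section Data

variable {A : Type*} [CStarAlgebra A]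

theorem exists_pos_forall_le {α : Type*} (G : Finset α) {ε : α → ℝ} (hε : ∀ q, 0 < ε q) {δ : ℝ}
    (hδ : 0 < δ) : ∃ ε₀ > 0, ε₀ ≤ δ ∧ ∀ q ∈ G, ε₀ ≤ ε q := by
  classical
  induction G using Finset.induction_on with
  | empty => exact ⟨δ, hδ, le_rfl, by simp⟩
  | insert q G _ ih =>
    obtain ⟨ε₀, h0, h1, h2⟩ := ih
    refine ⟨min ε₀ (ε q), lt_min h0 (hε q), (min_le_left _ _).trans h1, fun q' hq' => ?_⟩
    rcases Finset.mem_insert.1 hq' with rfl | h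
    · exact min_le_right _ _
    · exact (min_le_left _ _).trans (h2 q' h)

/-- Finitely many elements and finitely many projections are approximated in a subalgebra
`P M_r(C(X)) P`, with a partition of `X` into clopen sets on which all ranks are constant. -/
theorem InClassC1.exists_data (hA : IsSimpleCStar A) (hC : InClassC1 A) {s : K0 A →+ ℝ}
    (hs : s ∈ stateSpace A) (F : Finset A) (G : Finset (MatProj A)) {δ : ℝ} (hδ : 0 < δ) :
    ∃ (H : HomogeneousSubalgebra A) (o : Finset H.X) (χ : o → C(H.X, ℝ)),
      (∀ j x, χ j x = 0 ∨ χ j x = 1) ∧ (∀ x, ∑ j, χ j x = 1) ∧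
      (∀ j x, χ j x ≠ 0 → (H.P x).trace = (H.P j).trace) ∧
      (∀ x ∈ F, ∃ y ∈ H.cut, ‖x - y‖ < δ) ∧
      ∀ q ∈ G, ∃ (e : Matrix (Fin q.size) (Fin q.size) A)
        (K : C(H.X, Matrix (Fin q.size × Fin H.r) (Fin q.size × Fin H.r) ℂ)),
        H.IsProjFun K ∧ (∀ i j, H.lift K i j = H.unit * e i j) ∧ (∀ i j, e i j ∈ H.cut) ∧
        ‖Matrix.trace q.mat - Matrix.trace e‖ ≤ δ ∧
        |projVal s q.mat - projVal s (H.lift K)| ≤ δ ∧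
        ∀ j x, χ j x ≠ 0 → (K x).trace = (K j).trace ∧ (H.P x).trace = (H.P j).trace := by
  classical
  -- Entrywise error `δ/(n+1)` in size `n` gives error at most `δ` for the trace, including the case
  -- `n = 0`.
  have happ := fun q : MatProj A => exists_approx_projection q.isProj
    (show 0 < δ / ((q.size : ℝ) + 1) by positivity)
  choose ε hε happ using happ
  obtain ⟨ε₀, hε₀, hεδ, hεG⟩ := exists_pos_forall_le G hε hδ
  let N : MatProj A → ℝ := fun q => projVal s (1 : Matrix (Fin q.size) (Fin q.size) A)
  have hN : ∀ q, 0 ≤ N q := fun q => projVal_nonneg hs _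
  -- For each `q ∈ G` the loss in cutting down by `p` is at most `N q / m < δ`.
  obtain ⟨m, hm⟩ := exists_nat_gt ((∑ q ∈ G, N q) / δ)
  rw [div_lt_iff₀ hδ] at hm
  have hm0 : (0 : ℝ) < m := by
    by_contra hc
    have h1 : (m : ℝ) = 0 := le_antisymm (not_lt.1 hc) (Nat.cast_nonneg m)
    rw [h1, zero_mul] at hm
    exact absurd hm (not_lt.2 (Finset.sum_nonneg fun q _ => hN q))
  obtain ⟨H, v, hv, hvv, hF⟩ := hC.exists_approximation hA
    (F ∪ G.biUnion fun q => Finset.univ.image fun ij : Fin q.size × Fin q.size => q.mat ij.1 ij.2)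
    hε₀ m
  have hG : ∀ q : G, ∃ (e : Matrix (Fin q.1.size) (Fin q.1.size) A)
      (K : C(H.X, Matrix (Fin q.1.size × Fin H.r) (Fin q.1.size × Fin H.r) ℂ)),
      H.IsProjFun K ∧ (∀ i j, H.lift K i j = H.unit * e i j) ∧ (∀ i j, e i j ∈ H.cut) ∧
      ‖Matrix.trace q.1.mat - Matrix.trace e‖ ≤ δ ∧
      |projVal s q.1.mat - projVal s (H.lift K)| ≤ δ := by
    rintro ⟨q, hq⟩
    obtain ⟨e, he, hcut, hqe, hse⟩ := happ q H.cut H.isClosed_cut fun i j => by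
      obtain ⟨y, hy, hxy⟩ := hF (q.mat i j) (Finset.mem_union_right _ (Finset.mem_biUnion.2
        ⟨q, hq, Finset.mem_image.2 ⟨(i, j), Finset.mem_univ _, rfl⟩⟩))
      exact ⟨y, hy, hxy.trans_le (hεG q hq)⟩
    obtain ⟨K, hK, hKe⟩ := H.exists_isProjFun he hcut
    refine ⟨e, K, hK, hKe, hcut, ?_, ?_⟩
    · rw [← Matrix.trace_sub]
      refine (norm_sum_le _ _).trans ((Finset.sum_le_sum fun i _ => (hqe i i).le).trans ?_)
      rw [Finset.sum_const, Finset.card_univ, Fintype.card_fin, nsmul_eq_mul, mul_div_assoc',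
        div_le_iff₀ (by positivity)]
      nlinarith
    · rw [← hse s hs]
      have h1 := H.abs_projVal_sub_le hs he hcut hK hKe hv hvv
      have h2 : N q ≤ ∑ q ∈ G, N q := Finset.single_le_sum (fun q _ => hN q) hq
      have h3 : m * |projVal s e - projVal s (H.lift K)| ≤ m * δ := h1.trans (h2.trans hm.le)
      exact le_of_mul_le_mul_left h3 hm0
  choose e K hK hKe hcut hqe hqs using hG
  -- The value `none` records the rank of `P`, so that the partition is constant for it as well.
  let f : Option G → H.X → ℂ := fun a x => a.elim (H.P x).trace fun q => (K q x).trace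
  obtain ⟨o, χ, hχ, hsum, hconst⟩ := exists_clopen_partition (f := f)
    (by
      rintro (_ | q)
      · exact (MatFun.continuous H.P).matrix_trace
      · exact (K q).continuous.matrix_trace)
    (by
      rintro (_ | q) x
      · exact ⟨_, trace_eq_rank (H.isProj_apply x)⟩
      · exact ⟨_, trace_eq_rank ((hK q).isStarProjection x)⟩)
  refine ⟨H, o, χ, hχ, hsum, fun j x hx => hconst j x hx none, fun x hx => ?_, fun q hq => ?_⟩
  · obtain ⟨y, hy, hxy⟩ := hF x (Finset.mem_union_left _ hx)
    exact ⟨y, hy, hxy.trans_le hεδ⟩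
  · exact ⟨e ⟨q, hq⟩, K ⟨q, hq⟩, hK ⟨q, hq⟩, hKe ⟨q, hq⟩, hcut ⟨q, hq⟩, hqe ⟨q, hq⟩, hqs ⟨q, hq⟩,
      fun j x hx => ⟨hconst j x hx (some ⟨q, hq⟩), hconst j x hx none⟩⟩

end Data

section TracialStates

variable {A : Type*} [CStarAlgebra A]

theorem IsPositiveTrace.apply_nonneg [PartialOrder A] [StarOrderedRing A] {t : A →ₗ[ℂ] ℂ}
    (ht : IsPositiveTrace t) {a : A} (ha : 0 ≤ a) : 0 ≤ t a := by
  obtain ⟨x, rfl⟩ := CStarAlgebra.nonneg_iff_eq_star_mul_self.1 ha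
  exact ht.nonneg x

/-- Positivity gives the bound `‖a‖` on self-adjoint elements; splitting into real and imaginary
parts costs the factor `2`, which is harmless for compactness and limits. -/
theorem norm_apply_le_of_mem_tracialStates {t : A →ₗ[ℂ] ℂ} (ht : t ∈ tracialStates A) (x : A) :
    ‖t x‖ ≤ 2 * ‖x‖ := by
  let _ := CStarAlgebra.spectralOrder A
  have _ := CStarAlgebra.spectralOrderedRing A
  have hsa : ∀ a : A, IsSelfAdjoint a → ‖t a‖ ≤ ‖a‖ := by
    intro a ha
    have h1 := ht.1.apply_nonneg (sub_nonneg.2 ha.le_algebraMap_norm_self)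
    have h2 := ht.1.apply_nonneg (neg_le_iff_add_nonneg.1 ha.neg_algebraMap_norm_le_self)
    have h3 : t (algebraMap ℝ A ‖a‖) = (‖a‖ : ℂ) := by
      rw [Algebra.algebraMap_eq_smul_one, ← Complex.coe_smul, map_smul, ht.2, smul_eq_mul, mul_one]
    rw [map_sub, h3, Complex.le_def] at h1
    rw [map_add, h3, Complex.le_def] at h2
    simp only [Complex.zero_re, Complex.sub_re, Complex.ofReal_re, Complex.zero_im, Complex.sub_im,
      Complex.ofReal_im, Complex.add_re] at h1 h2
    have h4 : t a = ((t a).re : ℂ) := Complex.ext rfl (by simp; linarith [h1.2])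
    rw [h4, Complex.norm_real, Real.norm_eq_abs, abs_le]
    constructor <;> linarith [h1.1, h2.1]
  have h1 := realPart_add_I_smul_imaginaryPart x
  calc ‖t x‖ = ‖t (realPart x : A) + Complex.I * t (imaginaryPart x : A)‖ := by
        conv_lhs => rw [← h1, map_add, map_smul, smul_eq_mul]
    _ ≤ ‖t (realPart x : A)‖ + ‖t (imaginaryPart x : A)‖ := by
        refine (norm_add_le _ _).trans_eq ?_
        rw [norm_mul, Complex.norm_I, one_mul]
    _ ≤ ‖x‖ + ‖x‖ := add_le_add ((hsa _ (realPart x).2).trans (realPart.norm_le x))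
        ((hsa _ (imaginaryPart x).2).trans (imaginaryPart.norm_le x))
    _ = 2 * ‖x‖ := by ring

theorem mem_tracialStates_of_projVal {s : K0 A →+ ℝ} (hs : s ∈ stateSpace A) {t : A →ₗ[ℂ] ℂ}
    (ht : IsPositiveTrace t) (h : ∀ q : MatProj A, (t (Matrix.trace q.mat)).re = projVal s q.mat) :
    ∃ ht' : t ∈ tracialStates A, (rMap A ⟨t, ht'⟩ : K0 A →+ ℝ) = s := by
  have h1 : t 1 = 1 := by
    have h2 := h ⟨1, 1, IsStarProjection.one _⟩
    have h3 := ht.apply_trace_eq_re (IsStarProjection.one (Matrix (Fin 1) (Fin 1) A))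
    rw [h2, projVal_one_fin_one hs] at h3
    simpa using h3
  refine ⟨⟨ht, h1⟩, K0.hom_ext fun q => ?_⟩
  rw [← h q]
  exact projVal_traceK0 ht q.isProj

end TracialStates

end TracialAH

end

/-! ### Dominated states come from dominated traces. -/

noncomputable section

namespace TracialAH

open scoped Matrix.Norms.L2Operator

variable {A : Type*} [CStarAlgebra A]

namespace HomogeneousSubalgebra

variable (H : HomogeneousSubalgebra A)

theorem toAlg_scal_mul (h : C(H.X, ℝ)) {b : MatFun H.X H.r} (hb : H.P * b = b) :
    H.toAlg (H.scal h H.P) * H.toAlg b = H.toAlg (H.scal h b) := by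
  rw [← H.toAlg_mul_of_mul_eq hb]
  congr 1
  ext1 x
  conv_rhs => rw [← hb]
  simp

theorem toAlg_scal_sum {o : Type*} [Fintype o] (c : o → ℝ) (χ : o → C(H.X, ℝ))
    (b : MatFun H.X H.r) : H.toAlg (H.scal (∑ j, c j • χ j) b) =
      ∑ j, (c j : ℂ) • H.toAlg (H.scal (χ j) b) := by
  rw [← Finset.sum_congr rfl fun j _ => map_smul H.toAlg (c j : ℂ) (H.scal (χ j) b), ← map_sum]
  congr 1
  ext1 x
  have h1 : (∑ j, (c j : ℂ) • H.scal (χ j) b) x = ∑ j, ((c j : ℂ) • H.scal (χ j) b) x :=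
    map_sum (MatFun.eval x) _ _
  rw [h1, scal_apply, ContinuousMap.sum_apply, Complex.ofReal_sum, Finset.sum_smul]
  refine Finset.sum_congr rfl fun j _ => ?_
  rw [MatFun.smul_apply, scal_apply, smul_smul]
  simp

theorem unit_mul_scal (h : C(H.X, ℝ)) : H.unit * H.toAlg (H.scal h H.P) = H.toAlg (H.scal h H.P) :=
  H.unit_mul ⟨_, H.scal_mem h self_mem_corner, rfl⟩

theorem scal_mul_unit (h : C(H.X, ℝ)) : H.toAlg (H.scal h H.P) * H.unit = H.toAlg (H.scal h H.P) :=
  H.mul_unit ⟨_, H.scal_mem h self_mem_corner, rfl⟩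

/-- `h P` is central in the subalgebra and lies under its unit, so it commutes with all of the cut
algebra. Hence `t(h P ·)` is tracial there. -/
theorem commute_scal (h : C(H.X, ℝ)) {a : A} (ha : a ∈ H.cut) :
    Commute a (H.toAlg (H.scal h H.P)) := by
  obtain ⟨h1, c, hc, hca⟩ := ha
  have h2 := H.toAlg_commute_scal_unit 1 h hc
  rw [H.scal_one, hca, commute_iff_eq] at h2
  rw [commute_iff_eq, ← H.unit_mul_scal h, ← mul_assoc, ← h1, h2, ← mul_assoc, H.scal_mul_unit,
    H.unit_mul_scal]

theorem scal_le [PartialOrder A] [StarOrderedRing A] {h : C(H.X, ℝ)} {M : ℝ}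
    (hM : ∀ x, h x ≤ M) (hM0 : 0 ≤ M) : H.toAlg (H.scal h H.P) ≤ M • (1 : A) := by
  have h1 : H.toAlg (H.scal h H.P) ≤ H.toAlg ((M : ℂ) • H.P) := by
    refine H.toAlg_mono (H.scal_mem h self_mem_corner) (SMulMemClass.smul_mem _ self_mem_corner)
      fun x => ?_
    rw [scal_apply, MatFun.smul_apply, ← sub_smul, ← Complex.ofReal_sub]
    exact (H.P_posSemidef x).smul (by exact_mod_cast sub_nonneg.2 (hM x))
  rw [map_smul, Complex.coe_smul] at h1
  exact h1.trans (smul_le_smul_of_nonneg_left H.isStarProjection.le_one hM0)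

theorem scal_nonneg [PartialOrder A] [StarOrderedRing A] {h : C(H.X, ℝ)} (hh : ∀ x, 0 ≤ h x) :
    0 ≤ H.toAlg (H.scal h H.P) :=
  H.toAlg_nonneg (H.scal_mem h self_mem_corner) (H.scal_posSemidef hh H.P_posSemidef)

end HomogeneousSubalgebra

theorem sum_mul_mem_Icc {o : Type*} [Fintype o] {c χ : o → ℝ} {M : ℝ} (hc : ∀ j, 0 ≤ c j)
    (hcM : ∀ j, c j ≤ M) (hχ : ∀ j, 0 ≤ χ j) (hsum : ∑ j, χ j = 1) :
    0 ≤ ∑ j, c j * χ j ∧ ∑ j, c j * χ j ≤ M := by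
  refine ⟨Finset.sum_nonneg fun j _ => mul_nonneg (hc j) (hχ j), ?_⟩
  calc ∑ j, c j * χ j ≤ ∑ j, M * χ j :=
        Finset.sum_le_sum fun j _ => mul_le_mul_of_nonneg_right (hcM j) (hχ j)
    _ = M := by rw [← Finset.mul_sum, hsum, mul_one]

theorem abs_re_sub_le {f : A →ₗ[ℂ] ℂ} {L δ r : ℝ} (hL : 0 ≤ L) (hf : ∀ a, ‖f a‖ ≤ L * ‖a‖)
    {x y : A} (hxy : ‖x - y‖ ≤ δ) (hr : |r - (f y).re| ≤ δ) : |(f x).re - r| ≤ (L + 1) * δ := by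
  have h1 : |(f x).re - (f y).re| ≤ L * δ := by
    rw [← Complex.sub_re, ← map_sub]
    exact (Complex.abs_re_le_norm _).trans ((hf _).trans (mul_le_mul_of_nonneg_left hxy hL))
  have h2 := abs_sub_le (f x).re (f y).re r
  rw [abs_sub_comm (f y).re r] at h2
  linarith

/-- A state of `K₀(A)` dominated by a multiple of a tracial state `t` is given by a trace that is
dominated by this multiple of `t`. -/
theorem exists_dominated_trace (hA : IsSimpleCStar A) (hC : InClassC1 A) {s : K0 A →+ ℝ}
    (hs : s ∈ stateSpace A) {t : A →ₗ[ℂ] ℂ} (ht : t ∈ tracialStates A) {M : ℝ} (hM : 0 ≤ M)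
    (hdom : ∀ e : Matrix Unit Unit A, projVal s e ≤ M * projVal (traceK0 t ht.1) e) :
    ∃ t' : A →ₗ[ℂ] ℂ, IsPositiveTrace t' ∧
      (∀ x, (t' (star x * x)).re ≤ M * (t (star x * x)).re) ∧
      ∀ q : MatProj A, (t' (Matrix.trace q.mat)).re = projVal s q.mat := by
  let _ := CStarAlgebra.spectralOrder A
  have _ := CStarAlgebra.spectralOrderedRing A
  have hL : 0 ≤ 2 * M := by positivity
  refine exists_trace_of_approx (L := 2 * M) fun F G δ hδ => ?_
  have hδ' : 0 < δ / (2 * M + 1) := by positivity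
  obtain ⟨H, o, χ, hχ, hsum, -, hF, hG⟩ := hC.exists_data hA hs F G hδ'
  set τ := traceK0 t ht.1 with hτ
  let z : o → Matrix Unit Unit A := fun j => H.lift (H.restr (χ j) (H.amp Unit))
  -- The density of `s` with respect to `t` on the piece `z j`; domination bounds it by `M`.
  let c : o → ℝ := fun j => projVal s (z j) / projVal τ (z j)
  have hτ0 : ∀ j, 0 ≤ projVal τ (z j) := fun j => projVal_nonneg (traceK0_mem t ht) _
  have hs0 : ∀ j, 0 ≤ projVal s (z j) := fun j => projVal_nonneg hs _
  have hc0 : ∀ j, 0 ≤ c j := fun j => div_nonneg (hs0 j) (hτ0 j)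
  have hcM : ∀ j, c j ≤ M := fun j => div_le_of_le_mul₀ (hτ0 j) hM (hdom _)
  -- If the denominator is `0`, the default value `0` of the quotient is correct, because domination
  -- makes the numerator `0` too.
  have hcz : ∀ j, c j * projVal τ (z j) = projVal s (z j) := fun j => by
    by_cases h : projVal τ (z j) = 0
    · have h1 := hdom (z j)
      rw [h, mul_zero] at h1
      rw [h, mul_zero, le_antisymm h1 (hs0 j)]
    · exact div_mul_cancel₀ _ h
  let h : C(H.X, ℝ) := ∑ j, c j • χ j
  have hh : ∀ x, 0 ≤ h x ∧ h x ≤ M := fun x => by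
    have h1 := sum_mul_mem_Icc (χ := fun j => χ j x) hc0 hcM
      (fun j => by rcases hχ j x with h0 | h0 <;> simp [h0]) (hsum x)
    simpa [h] using h1
  set w : A := H.toAlg (H.scal h H.P) with hw
  have hw0 : 0 ≤ w := H.scal_nonneg fun x => (hh x).1
  have hwM : w ≤ M • (1 : A) := H.scal_le (fun x => (hh x).2) hM
  have hwn : ‖w‖ ≤ M := by
    rw [CStarAlgebra.norm_le_iff_le_algebraMap w hM hw0, Algebra.algebraMap_eq_smul_one]
    exact hwM
  have hconj : ∀ x, t (w * (star x * x)) = t (x * w * star x) := fun x => by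
    rw [← mul_assoc, ht.1.tracial, ← mul_assoc]
  have hfL : ∀ a, ‖t (w * a)‖ ≤ 2 * M * ‖a‖ := fun a => by
    refine (norm_apply_le_of_mem_tracialStates ht _).trans ?_
    rw [mul_assoc]
    exact mul_le_mul_of_nonneg_left ((norm_mul_le _ _).trans
      (mul_le_mul_of_nonneg_right hwn (norm_nonneg _))) zero_le_two
  refine ⟨t ∘ₗ LinearMap.mulLeft ℂ w, H.cut, hfL, fun x hx => ?_, fun x hx y hy => ?_,
    fun x _ => ?_, fun x => ?_, fun q hq => ?_⟩
  · obtain ⟨y, hy, hxy⟩ := hF x hx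
    exact ⟨y, hy, hxy.trans_le (div_le_self hδ.le (by linarith))⟩
  · change t (w * (x * y)) = t (w * (y * x))
    rw [← mul_assoc, ht.1.tracial, ← mul_assoc, (H.commute_scal h hy).eq, mul_assoc]
  · change 0 ≤ t (w * (star x * x))
    rw [hconj]
    exact ht.1.apply_nonneg (star_right_conjugate_nonneg hw0 x)
  · change (t (w * (star x * x))).re ≤ _
    have h1 := ht.1.apply_nonneg (sub_nonneg.2 (star_right_conjugate_le_conjugate hwM x))
    rw [mul_smul_comm, mul_one, smul_mul_assoc, ← Complex.coe_smul, map_sub, map_smul,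
      ht.1.tracial x (star x), Complex.le_def] at h1
    rw [hconj]
    have h2 := h1.1
    simp only [Complex.zero_re, Complex.sub_re, smul_eq_mul, Complex.re_ofReal_mul] at h2
    linarith
  · obtain ⟨e, K, hK, hKe, hcut, hqe, hqs, hconst⟩ := hG q hq
    -- On each piece, `s` and `t` evaluate `K` as the same rank ratio times their values at `z j`,
    -- so the factor `c j` turns one into the other.
    have hval : (t (w * Matrix.trace e)).re = projVal s (H.lift K) := by
      have h1 : w * Matrix.trace e =
          ∑ j, (c j : ℂ) • Matrix.trace (H.lift (H.restr (χ j) K)) := by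
        simp only [Matrix.trace, Matrix.diag_apply, Finset.mul_sum, Finset.smul_sum]
        rw [Finset.sum_comm]
        refine Finset.sum_congr rfl fun i _ => ?_
        rw [hw, ← H.scal_mul_unit, mul_assoc, ← hKe, HomogeneousSubalgebra.lift_apply,
          H.toAlg_scal_mul h (H.block_of_amp_mul hK.amp_mul i i), H.toAlg_scal_sum]
        rfl
      rw [h1, map_sum, Complex.re_sum, H.projVal_lift_eq_sum hs hK hχ hsum (fun j => j) hconst]
      refine Finset.sum_congr rfl fun j _ => ?_
      rw [map_smul, smul_eq_mul, Complex.re_ofReal_mul,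
        ← projVal_traceK0 ht.1 (hK.restr H (hχ j)).lift,
        H.projVal_lift_restr_eq (traceK0_mem t ht) hK (hχ j) j (hconst j), mul_left_comm]
      congr 1
      exact hcz j
    have h2 := abs_re_sub_le (f := t ∘ₗ LinearMap.mulLeft ℂ w) hL hfL hqe
      (r := projVal s q.mat) (by
        change |projVal s q.mat - (t (w * Matrix.trace e)).re| ≤ _
        rw [hval]
        exact hqs)
    rwa [mul_div_cancel₀ _ (by positivity)] at h2

end TracialAH

end

/-! ### Extreme traces give extreme states. -/

noncomputable section

namespace TracialAH

variable {A : Type*} [CStarAlgebra A]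

theorem projVal_convexComb (s s' : K0 A →+ ℝ) (a b : ℝ) {ι : Type*} [Fintype ι]
    (e : Matrix ι ι A) : projVal (a • s + b • s') e = a * projVal s e + b * projVal s' e := by
  unfold projVal
  split_ifs <;> simp

/-- If `r_A(t) = a s + b s'`, then `s ≤ r_A(t)/a`, so `s` is given by a tracial state `t₁` with `a
t₁ ≤ t`. The remainder `(t - a t₁)/b` is again a tracial state, and extremality of `t` gives `t₁ =
t`. -/
theorem traceK0_mem_extremePoints (hA : IsSimpleCStar A) (hC : InClassC1 A) {t : A →ₗ[ℂ] ℂ}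
    (ht : t ∈ Set.extremePoints ℝ (tracialStates A)) :
    traceK0 t ht.1.1 ∈ Set.extremePoints ℝ (stateSpace A) := by
  rw [mem_extremePoints_iff_left]
  refine ⟨traceK0_mem t ht.1, fun s hs s' hs' ⟨a, b, ha, hb, hab, heq⟩ => ?_⟩
  obtain ⟨t₁, ht₁, hle, hval⟩ := exists_dominated_trace hA hC hs ht.1 (M := 1 / a) (by positivity)
    fun e => by
      rw [← heq, projVal_convexComb, div_mul_eq_mul_div, one_mul, le_div_iff₀ ha]
      linarith [mul_nonneg hb.le (projVal_nonneg hs' e)]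
  obtain ⟨ht₁', hs₁⟩ := mem_tracialStates_of_projVal hs ht₁ hval
  let t₂ : A →ₗ[ℂ] ℂ := (1 / b) • (t - a • t₁)
  have h2 : ∀ x, t₂ x = (1 / b : ℝ) * (t x - a * t₁ x) := fun x => by simp [t₂]
  have ht₂ : t₂ ∈ tracialStates A := by
    refine ⟨⟨fun x => ?_, fun x y => ?_⟩, ?_⟩
    · have h3 := Complex.le_def.1 (ht.1.1.nonneg x)
      have h4 := Complex.le_def.1 (ht₁.nonneg x)
      have h5 := hle x
      rw [div_mul_eq_mul_div, one_mul, le_div_iff₀ ha] at h5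
      rw [h2]
      refine mul_nonneg (by exact_mod_cast (by positivity : 0 ≤ 1 / b)) (Complex.le_def.2 ⟨?_, ?_⟩)
      · simp only [Complex.zero_re, Complex.sub_re, Complex.re_ofReal_mul]
        linarith
      · simp only [Complex.sub_im, Complex.im_ofReal_mul, ← h3.2, ← h4.2]
        simp
    · rw [h2, h2, ht.1.1.tracial, ht₁.tracial]
    · rw [h2, ht.1.2, ht₁'.2, mul_one, ← Complex.ofReal_one, ← Complex.ofReal_sub,
        ← eq_sub_of_add_eq' hab, ← Complex.ofReal_mul, one_div, inv_mul_cancel₀ hb.ne']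
  have h6 : t₁ = t := by
    refine ht.2 ht₁' ht₂ ⟨a, b, ha, hb, hab, ?_⟩
    simp only [t₂]
    rw [smul_smul, mul_one_div_cancel hb.ne', one_smul, add_sub_cancel]
  subst h6
  exact hs₁.symm

end TracialAH

end

/-! ### Every extreme state comes from an extreme trace. -/

noncomputable section

namespace TracialAH

open scoped Matrix.Norms.L2Operator

section MatrixTrace

theorem norm_apply_le_l2_opNorm {m n : Type*} [Fintype m] [Fintype n] [DecidableEq n]
    (M : Matrix m n ℂ) (i : m) (j : n) : ‖M i j‖ ≤ ‖M‖ := by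
  have h1 := Matrix.l2_opNorm_mulVec M (EuclideanSpace.single j (1 : ℂ))
  rw [PiLp.norm_single, norm_one, mul_one] at h1
  refine le_trans ?_ ((PiLp.norm_apply_le _ i).trans h1)
  simp

/-- The trace on the corner at a projection `P` has norm at most the rank of `P`. -/
theorem norm_trace_le {n : Type*} [Fintype n] [DecidableEq n] {P b : Matrix n n ℂ}
    (hP : IsStarProjection P) (hb : P * b * P = b) : ‖b.trace‖ ≤ P.trace.re * ‖b‖ := by
  obtain ⟨w, hw1, hw2⟩ := exists_frame hP rfl
  have hw : ‖w‖ ≤ 1 := by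
    have h1 := Matrix.l2_opNorm_conjTranspose_mul_self w
    have h2 : ‖(1 : Matrix (Fin P.rank) (Fin P.rank) ℂ)‖ ≤ 1 := by
      rcases subsingleton_or_nontrivial (Matrix (Fin P.rank) (Fin P.rank) ℂ) with hn | hn
      · simp [Subsingleton.elim (1 : Matrix (Fin P.rank) (Fin P.rank) ℂ) 0]
      · exact CStarRing.norm_one.le
    rw [hw1] at h1
    rw [h1] at h2
    nlinarith [norm_nonneg w]
  have hn : ‖wᴴ * b * w‖ ≤ ‖b‖ := by
    have h1 := (Matrix.l2_opNorm_mul (wᴴ * b) w).trans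
      (mul_le_mul_of_nonneg_right (Matrix.l2_opNorm_mul wᴴ b) (norm_nonneg w))
    rw [Matrix.l2_opNorm_conjTranspose] at h1
    have h2 : ‖w‖ * ‖b‖ ≤ ‖b‖ := mul_le_of_le_one_left (norm_nonneg b) hw
    exact h1.trans ((mul_le_of_le_one_right (by positivity) hw).trans h2)
  have htr : b.trace = (wᴴ * b * w).trace := by
    rw [Matrix.trace_mul_comm, ← Matrix.mul_assoc, hw2, ← hb, ← Matrix.mul_assoc, ← Matrix.mul_assoc,
      hP.isIdempotentElem.eq]
  rw [htr, trace_eq_rank hP, Complex.natCast_re]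
  calc ‖(wᴴ * b * w).trace‖ ≤ ∑ i : Fin P.rank, ‖(wᴴ * b * w) i i‖ := norm_sum_le _ _
    _ ≤ ∑ i : Fin P.rank, ‖b‖ := Finset.sum_le_sum fun i _ => (norm_apply_le_l2_opNorm _ i i).trans hn
    _ = _ := by simp

end MatrixTrace

variable {A : Type*} [CStarAlgebra A]

namespace HomogeneousSubalgebra

variable (H : HomogeneousSubalgebra A)

/-- A bounded functional on `P M_r(C(X)) P` gives a bounded functional on `A`. -/
theorem exists_functional {f₀ : MatFun H.X H.r →ₗ[ℂ] ℂ} {L : ℝ} (hL : 0 ≤ L)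
    (h : ∀ b ∈ corner H.P H.isProj, ‖f₀ b‖ ≤ L * ‖b‖) :
    ∃ f : A →ₗ[ℂ] ℂ, (∀ a, ‖f a‖ ≤ L * ‖a‖) ∧
      ∀ a, ∀ b ∈ corner H.P H.isProj, H.unit * a = H.toAlg b → f a = f₀ b := by
  let S : Submodule ℂ (MatFun H.X H.r) := (corner H.P H.isProj).toSubmodule
  let φ : S →ₗ[ℂ] A := H.toAlg.domRestrict S
  have hφ : Function.Injective φ := by
    rw [injective_iff_map_eq_zero]
    exact fun b hb => Subtype.ext (H.toAlg_injective b.2 hb)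
  let e : S ≃ₗ[ℂ] LinearMap.range φ := LinearEquiv.ofInjective φ hφ
  have he : ∀ y, ‖((e.symm y : S) : MatFun H.X H.r)‖ = ‖y‖ := fun y => by
    obtain ⟨b, rfl⟩ := e.surjective y
    rw [e.symm_apply_apply]
    exact (H.norm_toAlg b.2).symm
  let g₀ : StrongDual ℂ (LinearMap.range φ) :=
    LinearMap.mkContinuous (f₀.domRestrict S ∘ₗ e.symm.toLinearMap) L fun y => by
      rw [← he]
      exact h _ (e.symm y).2
  obtain ⟨g, hg, hgn⟩ := exists_extension_norm_eq _ g₀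
  have hg₀ : ‖g‖ ≤ L := hgn.trans_le (LinearMap.mkContinuous_norm_le _ hL _)
  have hu : ‖H.unit‖ ≤ 1 := H.isStarProjection.norm_le
  -- The Hahn–Banach extension is applied to `p a`, so that on the cut algebra only the part in the
  -- subalgebra counts.
  refine ⟨g.toLinearMap ∘ₗ LinearMap.mulLeft ℂ H.unit, fun a => ?_, fun a b hb hab => ?_⟩
  · refine (g.le_opNorm _).trans (mul_le_mul hg₀ ?_ (norm_nonneg _) hL)
    exact (norm_mul_le _ _).trans (mul_le_of_le_one_left (norm_nonneg a) hu)
  · change g (H.unit * a) = _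
    rw [hab]
    refine (hg (e ⟨b, hb⟩)).trans ?_
    change f₀ (e.symm (e ⟨b, hb⟩) : S) = _
    rw [e.symm_apply_apply]

theorem block_mem_corner {ι : Type*} [Fintype ι] [DecidableEq ι]
    {K : C(H.X, Matrix (ι × Fin H.r) (ι × Fin H.r) ℂ)} (hK : H.IsProjFun K) (i : ι) :
    H.block K i i ∈ corner H.P H.isProj := by
  have h1 := H.block_of_amp_mul hK.amp_mul i i
  have h2 : star (H.block K i i) = H.block K i i := by
    ext1 x
    ext ρ σ
    have h3 := (hK.isStarProjection x).conjTranspose_eq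
    conv_rhs => rw [block_apply, ← h3]
    rfl
  refine mem_corner_iff'.2 ⟨h1, ?_⟩
  have h4 := congrArg star h1
  rwa [StarMul.star_mul, h2, H.isProj.isSelfAdjoint.star_eq] at h4

/-- A positive combination of the traces at finitely many points. -/
def pointTrace {o : Type*} [Fintype o] (a : o → ℝ) (ξ : o → H.X) : MatFun H.X H.r →ₗ[ℂ] ℂ :=
  ∑ j, (a j : ℂ) • (Matrix.traceLinearMap (Fin H.r) ℂ ℂ ∘ₗ (MatFun.eval (ξ j)).toLinearMap)

variable {H} {o : Type*} [Fintype o] {a : o → ℝ} {ξ : o → H.X}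

theorem pointTrace_apply (b : MatFun H.X H.r) :
    H.pointTrace a ξ b = ∑ j, (a j : ℂ) * (b (ξ j)).trace := by
  rw [pointTrace, LinearMap.sum_apply]
  rfl

theorem pointTrace_mul_comm (b c : MatFun H.X H.r) :
    H.pointTrace a ξ (b * c) = H.pointTrace a ξ (c * b) := by
  simp only [pointTrace_apply, MatFun.mul_apply]
  exact Finset.sum_congr rfl fun j _ => by rw [Matrix.trace_mul_comm]

theorem pointTrace_nonneg (ha : ∀ j, 0 ≤ a j) (b : MatFun H.X H.r) :
    0 ≤ H.pointTrace a ξ (star b * b) := by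
  rw [pointTrace_apply]
  exact Finset.sum_nonneg fun j _ => mul_nonneg (by exact_mod_cast ha j)
    (Matrix.posSemidef_conjTranspose_mul_self (b (ξ j))).trace_nonneg

theorem norm_pointTrace_le (ha : ∀ j, 0 ≤ a j) {b : MatFun H.X H.r}
    (hb : b ∈ corner H.P H.isProj) :
    ‖H.pointTrace a ξ b‖ ≤ (∑ j, a j * (H.P (ξ j)).trace.re) * ‖b‖ := by
  rw [pointTrace_apply, Finset.sum_mul]
  refine (norm_sum_le _ _).trans (Finset.sum_le_sum fun j _ => ?_)
  rw [norm_mul, Complex.norm_real, Real.norm_of_nonneg (ha j), mul_assoc]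
  have h1 := norm_trace_le (H.isProj_apply (ξ j)) (H.mem_corner_apply.1 hb (ξ j))
  have h2 : 0 ≤ (H.P (ξ j)).trace.re := by
    rw [trace_eq_rank (H.isProj_apply (ξ j)), Complex.natCast_re]
    positivity
  exact mul_le_mul_of_nonneg_left
    (h1.trans (mul_le_mul_of_nonneg_left (MatFun.norm_apply_le b _) h2)) (ha j)

end HomogeneousSubalgebra

theorem projVal_one_unit {s : K0 A →+ ℝ} (hs : s ∈ stateSpace A) :
    projVal s (1 : Matrix Unit Unit A) = 1 := by
  rw [← projVal_one_fin_one hs]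
  refine projVal_eq_of_mul (IsStarProjection.one _) (IsStarProjection.one _)
    (Matrix.of fun _ _ => 1) ?_ ?_
  · ext i j
    simp [Matrix.mul_apply]
  · ext i j
    simp [Matrix.mul_apply, Matrix.one_apply, Subsingleton.elim i j]

/-- Every state of `K₀(A)` is given by a trace. -/
theorem exists_trace_of_mem_stateSpace (hA : IsSimpleCStar A) (hC : InClassC1 A) {s : K0 A →+ ℝ}
    (hs : s ∈ stateSpace A) : ∃ t : A →ₗ[ℂ] ℂ, IsPositiveTrace t ∧
      ∀ q : MatProj A, (t (Matrix.trace q.mat)).re = projVal s q.mat := by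
  -- No domination is wanted here; the bound by the norm only fits the form of the limit lemma and
  -- is immediate from `‖f‖ ≤ 1`.
  suffices h : ∃ t : A →ₗ[ℂ] ℂ, IsPositiveTrace t ∧
      (∀ x, (t (star x * x)).re ≤ 1 * ‖star x * x‖) ∧
      ∀ q : MatProj A, (t (Matrix.trace q.mat)).re = projVal s q.mat from
    h.imp fun t ht => ⟨ht.1, ht.2.2⟩
  refine exists_trace_of_approx (L := 1) fun F G δ hδ => ?_
  obtain ⟨H, o, χ, hχ, hsum, hP, hF, hG⟩ := hC.exists_data hA hs F G (half_pos hδ)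
  let z : o → Matrix Unit Unit A := fun j => H.lift (H.restr (χ j) (H.amp Unit))
  -- The weight of the point trace at `j` is chosen so that `P` receives the mass `s(z j)` there.
  let a : o → ℝ := fun j => projVal s (z j) / (H.P j).trace.re
  have hR : ∀ x, 0 < (H.P x).trace.re := fun x => by
    rw [trace_eq_rank (H.isProj_apply x), Complex.natCast_re]
    exact_mod_cast H.rank_pos x
  have ha : ∀ j, 0 ≤ a j := fun j => div_nonneg (projVal_nonneg hs _) (hR j).le
  have htr : ∀ x, (H.amp Unit x).trace = (H.P x).trace := fun x => by
    rw [HomogeneousSubalgebra.amp_apply, Matrix.trace_kronecker, Matrix.trace_one]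
    simp
  -- The total mass is `s([p]) ≤ s([1]) = 1`, which bounds the functional by `1` in norm.
  have hsum1 : ∑ j : o, a j * (H.P (j : H.X)).trace.re ≤ 1 := by
    have h1 := H.projVal_lift_eq_sum hs (H.isProjFun_amp (ι := Unit)) hχ hsum (fun j => j)
      fun j x hx => by rw [htr, htr]; exact ⟨hP j x hx, hP j x hx⟩
    rw [← projVal_one_unit hs]
    refine le_trans (le_of_eq ?_) (projVal_le hs (H.isProjFun_amp (ι := Unit)).lift
      (IsStarProjection.one _) (mul_one _))
    rw [h1]
    refine Finset.sum_congr rfl fun j _ => ?_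
    rw [htr, div_self (hR j).ne', one_mul]
    exact div_mul_cancel₀ _ (hR j).ne'
  obtain ⟨f, hf, hfe⟩ := H.exists_functional (f₀ := H.pointTrace a fun j => j) zero_le_one
    fun b hb => (HomogeneousSubalgebra.norm_pointTrace_le ha hb).trans
      (mul_le_mul_of_nonneg_right hsum1 (norm_nonneg b))
  refine ⟨f, H.cut, hf, fun x hx => ?_, fun x hx y hy => ?_, fun x hx => ?_, fun x => ?_,
    fun q hq => ?_⟩
  · obtain ⟨y, hy, hxy⟩ := hF x hx
    exact ⟨y, hy, hxy.trans (half_lt_self hδ)⟩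
  · obtain ⟨-, b, hb, hbx⟩ := id hx
    obtain ⟨-, c, hc, hcy⟩ := id hy
    rw [hfe (x * y) (b * c) (mul_mem hb hc), hfe (y * x) (c * b) (mul_mem hc hb),
      HomogeneousSubalgebra.pointTrace_mul_comm]
    · rw [H.toAlg_mul hc hb, hcy, hbx, H.unit_mul_mul_unit_mul hy]
    · rw [H.toAlg_mul hb hc, hcy, hbx, H.unit_mul_mul_unit_mul hx]
  · obtain ⟨h1, b, hb, hbx⟩ := id hx
    rw [hfe (star x * x) (star b * b) (mul_mem (star_mem hb) hb)]
    · exact HomogeneousSubalgebra.pointTrace_nonneg ha b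
    · have h2 : H.unit * star x = star (H.unit * x) := by
        rw [h1, StarMul.star_mul, H.isStarProjection.isSelfAdjoint.star_eq]
      rw [H.toAlg_mul (star_mem hb) hb, H.toAlg_star, hbx, ← h2,
        H.unit_mul_mul_unit_mul (star_mem hx)]
  · exact (Complex.re_le_norm _).trans (hf _)
  · obtain ⟨e, K, hK, hKe, hcut, hqe, hqs, hconst⟩ := hG q hq
    have hval : (f (Matrix.trace e)).re = projVal s (H.lift K) := by
      have h1 : f (Matrix.trace e) = ∑ j : o, (a j : ℂ) * (K j).trace := by
        simp only [Matrix.trace, Matrix.diag_apply, map_sum]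
        rw [Finset.sum_congr rfl fun i _ =>
          hfe (e i i) (H.block K i i) (H.block_mem_corner hK i) (hKe i i).symm]
        simp only [HomogeneousSubalgebra.pointTrace_apply]
        rw [Finset.sum_comm]
        refine Finset.sum_congr rfl fun j _ => ?_
        rw [← Finset.mul_sum, Fintype.sum_prod_type]
        rfl
      rw [h1, Complex.re_sum, H.projVal_lift_eq_sum hs hK hχ hsum (fun j => j) hconst]
      refine Finset.sum_congr rfl fun j _ => ?_
      rw [Complex.re_ofReal_mul]
      simp only [a, z]
      ring
    have h2 := abs_re_sub_le zero_le_one hf hqe (r := projVal s q.mat) (by rw [hval]; exact hqs)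
    linarith

/-- The tracial states that induce a given state of `K₀(A)` form a compact set. -/
theorem isCompact_tracialStates_fiber (s : MatProj A → ℝ) :
    IsCompact {φ : A → ℂ | ∃ t ∈ tracialStates A,
      (∀ q : MatProj A, (t (Matrix.trace q.mat)).re = s q) ∧ ⇑t = φ} := by
  -- In the pointwise topology the fibre is a closed subset of a product of discs.
  refine (isCompact_univ_pi fun a : A => isCompact_closedBall (0 : ℂ) (2 * ‖a‖)).of_isClosed_subset
    ?_ ?_
  · have h1 : {φ : A → ℂ | ∃ t ∈ tracialStates A,
        (∀ q : MatProj A, (t (Matrix.trace q.mat)).re = s q) ∧ ⇑t = φ} =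
        {φ | (∀ x y, φ (x + y) = φ x + φ y) ∧ (∀ (c : ℂ) x, φ (c • x) = c • φ x) ∧
          (∀ x, 0 ≤ φ (star x * x)) ∧ (∀ x y, φ (x * y) = φ (y * x)) ∧ φ 1 = 1 ∧
          ∀ q : MatProj A, (φ (Matrix.trace q.mat)).re = s q} := by
      ext φ
      constructor
      · rintro ⟨t, ht, hs, rfl⟩
        exact ⟨map_add t, map_smul t, ht.1.nonneg, ht.1.tracial, ht.2, hs⟩
      · rintro ⟨h1, h2, h3, h4, h5, h6⟩
        exact ⟨⟨⟨φ, h1⟩, h2⟩, ⟨⟨h3, h4⟩, h5⟩, h6, rfl⟩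
    rw [h1]
    simp only [Set.ofPred_and, Set.ofPred_forall]
    refine IsClosed.inter ?_ (IsClosed.inter ?_ (IsClosed.inter ?_ (IsClosed.inter ?_
      (IsClosed.inter ?_ ?_))))
    · exact isClosed_iInter fun x => isClosed_iInter fun y => isClosed_eq (by fun_prop) (by fun_prop)
    · exact isClosed_iInter fun x => isClosed_iInter fun y => isClosed_eq (by fun_prop) (by fun_prop)
    · exact isClosed_iInter fun x => isClosed_le (by fun_prop) (by fun_prop)
    · exact isClosed_iInter fun x => isClosed_iInter fun y => isClosed_eq (by fun_prop) (by fun_prop)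
    · exact isClosed_eq (by fun_prop) (by fun_prop)
    · exact isClosed_iInter fun q => isClosed_eq (by fun_prop) (by fun_prop)
  · rintro φ ⟨t, ht, -, rfl⟩ a -
    exact mem_closedBall_zero_iff.2 (norm_apply_le_of_mem_tracialStates ht a)

/-- The fibre of `r_A` over `s` is nonempty since every state comes from a trace, and compact, so it
has an extreme point. Being the fibre over an extreme point of an affine map, it is a face, so this
point is extreme among all tracial states. -/
theorem exists_extreme_traceK0_eq (hA : IsSimpleCStar A) (hC : InClassC1 A) {s : K0 A →+ ℝ}
    (hs : s ∈ Set.extremePoints ℝ (stateSpace A)) :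
    ∃ (t : A →ₗ[ℂ] ℂ) (ht : t ∈ Set.extremePoints ℝ (tracialStates A)),
      traceK0 t ht.1.1 = s := by
  obtain ⟨t₀, ht₀, hq₀⟩ := exists_trace_of_mem_stateSpace hA hC hs.1
  obtain ⟨φ, hφ⟩ := (isCompact_tracialStates_fiber fun q : MatProj A =>
    projVal s q.mat).extremePoints_nonempty
      ⟨t₀, t₀, (mem_tracialStates_of_projVal hs.1 ht₀ hq₀).1, hq₀, rfl⟩
  obtain ⟨⟨t, ht, hq, rfl⟩, hext⟩ := hφ
  have hts : traceK0 t ht.1 = s := K0.hom_ext fun q => by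
    rw [projVal_traceK0 ht.1 q.isProj, hq]
  refine ⟨t, mem_extremePoints_iff_left.2 ⟨ht, fun t₁ h₁ t₂ h₂ hseg => ?_⟩, hts⟩
  obtain ⟨a, b, ha, hb, hab, rfl⟩ := hseg
  have h3 : s ∈ openSegment ℝ (traceK0 t₁ h₁.1) (traceK0 t₂ h₂.1) := by
    refine ⟨a, b, ha, hb, hab, K0.hom_ext fun q => ?_⟩
    rw [projVal_convexComb, projVal_traceK0 h₁.1 q.isProj, projVal_traceK0 h₂.1 q.isProj, ← hq]
    simp
  -- Extremality of `s` puts both endpoints into the fibre; this is the face property.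
  obtain ⟨h4, h5⟩ := (mem_extremePoints.1 hs).2 _ (traceK0_mem t₁ h₁) _ (traceK0_mem t₂ h₂) h3
  have key : ∀ {t' : A →ₗ[ℂ] ℂ} (h' : t' ∈ tracialStates A), traceK0 t' h'.1 = s →
      ∀ q : MatProj A, (t' (Matrix.trace q.mat)).re = projVal s q.mat := fun h' hs' q => by
    rw [← hs', projVal_traceK0 h'.1 q.isProj]
  exact DFunLike.coe_injective (hext ⟨t₁, h₁, key h₁ h4, rfl⟩ ⟨t₂, h₂, key h₂ h5, rfl⟩
    ⟨a, b, ha, hb, hab, rfl⟩)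

theorem image_rMap_extremePoints (hA : IsSimpleCStar A) (hC : InClassC1 A) :
    rMap A '' (Subtype.val ⁻¹' Set.extremePoints ℝ (tracialStates A)) =
      Subtype.val ⁻¹' Set.extremePoints ℝ (stateSpace A) := by
  ext s
  constructor
  · rintro ⟨t, ht, rfl⟩
    exact traceK0_mem_extremePoints hA hC ht
  · intro hs
    obtain ⟨t, ht, hts⟩ := exists_extreme_traceK0_eq hA hC hs
    exact ⟨⟨t, ht.1⟩, ht, Subtype.ext hts⟩

end TracialAH

end

theorem mainTheorem9 (A : Type*) [CStarAlgebra A] (hsimple : TracialAH.IsSimpleCStar A)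
    (hA : TracialAH.InClassC1 A) :
    (∀ τ : TracialAH.posCone A → ℝ, TracialAH.IsQuasitrace τ →
      ∃ t : A →ₗ[ℂ] ℂ, TracialAH.IsPositiveTrace t ∧
        ∀ a : TracialAH.posCone A, t (a : A) = (τ a : ℂ)) ∧
    Set.BijOn TracialAH.restrictPos (TracialAH.tracialStates A) (TracialAH.quasitraces A) ∧
    (TopologicalSpace.SeparableSpace A →
      TracialAH.rMap A '' (Subtype.val ⁻¹' Set.extremePoints ℝ (TracialAH.tracialStates A)) =
        Subtype.val ⁻¹' Set.extremePoints ℝ (TracialAH.stateSpace A)) := by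
  exact ⟨fun τ hτ => hτ.1.exists_trace hsimple hA, TracialAH.bijOn_restrictPos hsimple hA,
    fun _ => TracialAH.image_rMap_extremePoints hsimple hA⟩
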